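/- Let $Y,U,Z$ be separable complex Hilbert spaces, let $A:\mathcal D(A)\subseteq Y\to Y$ generate a strongly continuous semigroup $e^{At}$ on $Y$ with $\|e^{At}\|_{\mathcal L(Y)}\le Me^{-\omega t}$ for all $t\ge 0$ ($M\ge 1$, $\omega>0$), let $B:U\to[\mathcal D(A^*)]'$ and $R:Y\to Z$ be bounded linear operators, and let $B^*:\mathcal D(A^*)\to U$ be the adjoint of $B$. Write $A^{\pm\epsilon}$, ${A^*}^{\pm\epsilon}$ for the fractional powers $(-A)^{\pm\epsilon}$, $(-A^*)^{\pm\epsilon}$. Assume that $$B^*e^{A^*t}x=F(t)x+G(t)x,\qquad t>0,\ x\in\mathcal D(A^*),$$ with bounded linear operators $F(t):Y\to U$ and $G(t):\mathcal D(A^*)\to U$ such that (i) there are $\gamma\in(0,1)$ and $\eta,N>0$ with $\|F(t)\|_{\mathcal L(Y,U)}\le N t^{-\gamma}e^{-\eta t}$ for all $t>0$; (ii) there is $T>0$ such that $G(\cdot)$ extends to an element of $\mathcal L(Y,L^p(0,T;U))$ for every $p\in[1,\infty)$; (iii) there are $T>0$ and $\epsilon>0$ such that (a) $G(\cdot){A^*}^{-\epsilon}$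 extends to an element of $\mathcal L(Y,C([0,T];U))$; (b) $R^*R\in\mathcal L(\mathcal D(A^\epsilon),\mathcal D({A^*}^\epsilon))$; (c) for some $q\in(1,2)$ the operator $B^*e^{A^*\cdot}{A^*}^\epsilon$, defined on $\mathcal D({A^*}^{1+\epsilon})$, extends to an element of $\mathcal L(Y,L^q(0,T;U))$. Let $L$ be the input-to-state map $Lv(t)=\int_0^t e^{A(t-s)}Bv(s)\,ds$, $t\ge 0$, let $L^*$ be its adjoint, $L^*y(s)=\int_s^\infty B^*e^{A^*(t-s)}y(t)\,dt$ (understood by duality, $\int_0^\infty(L^*y,u)_U\,dt=\int_0^\infty(y,Lu)_Y\,dt$ for all bounded measurable $u:(0,\infty)\to U$ of bounded support), and let $$\Lambda=I+L^*R^*RL .$$ For $p\ge1$ and $\delta\in\mathbb R$ let $L^p_\delta(0,\infty;U)=\{f:\ e^{\delta\cdot}f\in L^p(0,\infty;U)\}$ with the norm $\|e^{\delta\cdot}f\|_{L^p(0,\infty;U)}$. Then: 1. $\Lambda$ is an isomorphism of $L^2(0,\infty;U)$ onto itself, and for every $\theta\in[0,\min\{\omega,\eta\})$ it is a bounded operator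 from $L^q_\theta(0,\infty;U)$ to itself. 2. For every $\delta\in(0,\min\{\omega,\eta\})$ there is $\sigma_0\in(0,\delta)$ such that $\Lambda$ has a bounded inverse $$\Lambda^{-1}:L^q_\delta(0,\infty;U)\longrightarrow L^q_{\delta-\sigma_0}(0,\infty;U),$$ that is, for every $h\in L^q_\delta(0,\infty;U)$ the equation $\Lambda g=h$ has exactly one solution $g\in L^q_{\delta-\sigma_0}(0,\infty;U)$, and $g$ depends linearly and boundedly on $h$. -/

import Mathlib

open MeasureTheory Set Filter Topology
open scoped ENNReal NNReal

noncomputable section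

namespace LQ

/-- A strongly continuous one-parameter semigroup `(e^{At})_{t ≥ 0}` of bounded operators on `Y`.
Only the values at `t ≥ 0` matter. -/
structure C0Semigroup (Y : Type*) [NormedAddCommGroup Y] [InnerProductSpace ℂ Y] where
  /-- the operator `e^{At}` -/
  op : ℝ → Y →L[ℂ] Y
  op_zero : op 0 = 1
  op_add : ∀ s t : ℝ, 0 ≤ s → 0 ≤ t → op (s + t) = op s ∘L op t
  strong_cont : ∀ x : Y, ContinuousOn (fun t => op t x) (Ici 0)

/-- The half-line `(0,∞)` with Lebesgue measure. -/
def halfLine : Measure ℝ := volume.restrict (Ioi 0)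

section Spaces

variable (X : Type*) [NormedAddCommGroup X] [InnerProductSpace ℂ X]

/-- The weighted space `L^p_δ(0,∞;X)`: the (classes of) functions `f` on `(0,∞)` such that
`t ↦ e^{δt} f(t)` belongs to `L^p(0,∞;X)`. -/
def WeightedLp (p : ℝ≥0∞) (δ : ℝ) : Submodule ℂ (ℝ →ₘ[halfLine] X) where
  carrier := {f | MemLp (fun t => Real.exp (δ * t) • f t) p halfLine}
  zero_mem' := by
    refine (MemLp.zero' (p := p) (μ := halfLine) (ε := X)).ae_eq ?_
    filter_upwards [AEEqFun.coeFn_zero (α := ℝ) (β := X) (μ := halfLine)] with t ht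
    simp [ht]
  add_mem' := by
    intro f g hf hg
    refine (MemLp.add hf hg).ae_eq ?_
    filter_upwards [AEEqFun.coeFn_add f g] with t ht
    simp [ht, smul_add]
  smul_mem' := by
    intro c f hf
    refine (MemLp.const_smul hf c).ae_eq ?_
    filter_upwards [AEEqFun.coeFn_smul c f] with t ht
    simp only [Pi.smul_apply, ht]
    exact smul_comm _ _ _

variable {X}

/-- The norm of `L^p_δ(0,∞;X)`, i.e. the `L^p(0,∞;X)`-norm of `t ↦ e^{δt} f(t)`. -/
def weightedNorm (p : ℝ≥0∞) (δ : ℝ) (f : ℝ →ₘ[halfLine] X) : ℝ≥0∞ :=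
  eLpNorm (fun t => Real.exp (δ * t) • f t) p halfLine

/-- The relation `K` between functions is the graph of a bounded linear operator
from all of `L^p_δ(0,∞;X)` to `L^p_θ(0,∞;X)`. -/
def IsBoundedOperator (K : (ℝ → X) → (ℝ → X) → Prop) (p : ℝ≥0∞) (δ θ : ℝ) : Prop :=
  ∃ T : WeightedLp X p δ →ₗ[ℂ] WeightedLp X p θ,
    (∀ (f : WeightedLp X p δ) (g : WeightedLp X p θ),
      T f = g ↔ K (f : ℝ →ₘ[halfLine] X) (g : ℝ →ₘ[halfLine] X)) ∧
    ∃ C : ℝ≥0, ∀ f : WeightedLp X p δ,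
      weightedNorm p θ (T f : ℝ →ₘ[halfLine] X) ≤ C * weightedNorm p δ (f : ℝ →ₘ[halfLine] X)

end Spaces

section System

variable {Y U Z : Type*}
  [NormedAddCommGroup Y] [InnerProductSpace ℂ Y] [CompleteSpace Y]
  [NormedAddCommGroup U] [InnerProductSpace ℂ U] [CompleteSpace U]
  [NormedAddCommGroup Z] [InnerProductSpace ℂ Z] [CompleteSpace Z]

/-- The graph of the infinitesimal generator `A`: the pairs `(x, Ax)`, where
`Ax = lim_{t → 0+} (e^{At}x - x)/t`. -/
def generatorGraph (S : C0Semigroup Y) : Submodule ℂ (Y × Y) where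
  carrier := {p | Tendsto (fun t : ℝ => t⁻¹ • (S.op t p.1 - p.1)) (𝓝[>] 0) (𝓝 p.2)}
  zero_mem' := by simp
  add_mem' := by
    intro p r hp hr
    refine (Tendsto.add hp hr).congr fun t => ?_
    simp only [Prod.fst_add, map_add]
    rw [← smul_add]
    congr 1
    abel
  smul_mem' := by
    intro c p hp
    refine (Tendsto.const_smul hp c).congr fun t => ?_
    simp only [Prod.smul_fst, map_smul]
    rw [← smul_sub, smul_comm]

/-- The space `D(A*)` with the graph norm, realized as the graph of the Hilbert space adjoint `A*`:
a point `x` of this space is the pair `(x.1.1, x.1.2) = (x, A*x)`. (The generator is densely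
defined, so that the adjoint of its graph is the graph of `A*`.) -/
abbrev DomAdj (S : C0Semigroup Y) : Type _ := (generatorGraph S).adjoint

/-- The extrapolation space `[D(A*)]'`: the bounded conjugate-linear functionals on `D(A*)`.
An element `y` of `Y` is identified with the functional `x ↦ (y, x)_Y`. -/
abbrev Extrapolation (S : C0Semigroup Y) : Type _ := DomAdj S →L⋆[ℂ] ℂ

lemma generatorGraph_op (S : C0Semigroup Y) {t : ℝ} (ht : 0 ≤ t) {a b : Y}
    (h : (a, b) ∈ generatorGraph S) : (S.op t a, S.op t b) ∈ generatorGraph S := by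
  have h1 : Tendsto (fun s : ℝ => s⁻¹ • (S.op s a - a)) (𝓝[>] 0) (𝓝 b) := h
  have h2 := ((S.op t).continuous.tendsto b).comp h1
  change Tendsto (fun s : ℝ => s⁻¹ • (S.op s (S.op t a) - S.op t a)) (𝓝[>] 0) (𝓝 (S.op t b))
  refine h2.congr' ?_
  filter_upwards [self_mem_nhdsWithin] with s hs
  have hs0 : (0 : ℝ) ≤ s := le_of_lt hs
  have e : S.op s (S.op t a) = S.op t (S.op s a) := by
    have e1 := congrArg (fun T : Y →L[ℂ] Y => T a) (S.op_add s t hs0 ht)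
    have e2 := congrArg (fun T : Y →L[ℂ] Y => T a) (S.op_add t s ht hs0)
    simp only [ContinuousLinearMap.comp_apply] at e1 e2
    rw [← e1, ← e2, add_comm]
  simp only [Function.comp_apply, e]
  rw [← map_sub]
  exact (S.op t).map_smul_of_tower s⁻¹ _

/-- The adjoint semigroup `e^{A*t} = (e^{At})*`. -/
def adjOp (S : C0Semigroup Y) (t : ℝ) : Y →L[ℂ] Y := (S.op t).adjoint

/-- The operator `e^{A*t}`, `t ≥ 0`, acting in `D(A*)` (set to `0` for `t < 0`). -/
def adjOpDom (S : C0Semigroup Y) (t : ℝ) (x : DomAdj S) : DomAdj S :=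
  if ht : 0 ≤ t then
    ⟨(adjOp S t x.1.1, adjOp S t x.1.2), by
      rw [Submodule.mem_adjoint_iff]
      intro a b hab
      have h := (Submodule.mem_adjoint_iff _ _).1 x.2 _ _ (generatorGraph_op S ht hab)
      simpa [adjOp, ContinuousLinearMap.adjoint_inner_right] using h⟩
  else 0

/-- `B* : D(A*) → U`, the adjoint of a control operator `B : U → [D(A*)]'`; it is characterized by
`(u, B*x)_U = ⟨Bu, x⟩`. -/
def controlAdj (S : C0Semigroup Y) (B : U →L[ℂ] Extrapolation S) : DomAdj S →L[ℂ] U :=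
  ((InnerProductSpace.toDual ℂ U).symm.toContinuousLinearEquiv :
    StrongDual ℂ U →L⋆[ℂ] U).comp B.flip

/-- `(-A)^{-ε} x = Γ(ε)⁻¹ ∫_0^∞ t^{ε-1} e^{At} x dt`, the negative fractional power attached to an
exponentially stable semigroup `E t = e^{At}`. With `E = adjOp S` this is `(-A*)^{-ε}`. -/
def negPow (E : ℝ → Y →L[ℂ] Y) (ε : ℝ) (x : Y) : Y :=
  (Real.Gamma ε)⁻¹ • ∫ t in Ioi (0 : ℝ), t ^ (ε - 1) • E t x

/-- `x ∈ D((-A)^ε)` and `(-A)^ε x = y`: the power `(-A)^ε` is the inverse of `(-A)^{-ε}`. -/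
def IsFracPow (E : ℝ → Y →L[ℂ] Y) (ε : ℝ) (x y : Y) : Prop := negPow E ε y = x

/-- The standing assumptions on the control system `y' = Ay + Bu` observed through `R`. -/
structure Assumptions (S : C0Semigroup Y) (B : U →L[ℂ] Extrapolation S) (R : Y →L[ℂ] Z)
    (F : ℝ → Y →L[ℂ] U) (G : ℝ → DomAdj S →L[ℂ] U) (ω η γ ε q : ℝ) : Prop where
  omega_pos : 0 < ω
  eta_pos : 0 < η
  gamma_mem : γ ∈ Ioo (0 : ℝ) 1
  epsilon_pos : 0 < ε
  q_mem : q ∈ Ioo (1 : ℝ) 2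
  /-- exponential stability of the semigroup -/
  stable : ∃ M : ℝ, 1 ≤ M ∧ ∀ t : ℝ, 0 ≤ t → ‖S.op t‖ ≤ M * Real.exp (-ω * t)
  /-- `B* e^{A*t} x = F(t) x + G(t) x` for `x ∈ D(A*)` -/
  decomposition : ∀ t : ℝ, 0 < t → ∀ x : DomAdj S,
    controlAdj S B (adjOpDom S t x) = F t x.1.1 + G t x
  /-- the singular estimate for `F` -/
  F_bound : ∃ N : ℝ, 0 < N ∧ ∀ t : ℝ, 0 < t → ‖F t‖ ≤ N * t ^ (-γ) * Real.exp (-η * t)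
  /-- `G` extends to a bounded operator from `Y` to `L^p(0,T;U)` for every `p ∈ [1,∞)` -/
  G_Lp : ∃ T : ℝ, 0 < T ∧ ∀ p : ℝ, 1 ≤ p → ∃ C : ℝ≥0, ∀ x : DomAdj S,
    MemLp (fun t => G t x) (ENNReal.ofReal p) (volume.restrict (Ioo 0 T)) ∧
    eLpNorm (fun t => G t x) (ENNReal.ofReal p) (volume.restrict (Ioo 0 T)) ≤ C * ‖x.1.1‖ₑ
  /-- for one and the same `T`: `G(·)(-A*)^{-ε}` extends to a bounded operator from `Y` to
  `C([0,T];U)`, and `B* e^{A*·} (-A*)^ε`, defined for the `x ∈ D((-A*)^ε)` with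
  `w = (-A*)^ε x ∈ D(A*)`, extends to a bounded operator from `Y` to `L^q(0,T;U)` -/
  smoothing : ∃ T : ℝ, 0 < T ∧
    (∃ Γ : Y →L[ℂ] C(Icc (0 : ℝ) T, U), ∀ (y : Y) (x : DomAdj S), x.1.1 = negPow (adjOp S) ε y →
      ∀ t : Icc (0 : ℝ) T, 0 < (t : ℝ) → Γ y t = G t x) ∧
    (∃ C : ℝ≥0, ∀ (x : Y) (w : DomAdj S), IsFracPow (adjOp S) ε x w.1.1 →
      MemLp (fun t => controlAdj S B (adjOpDom S t w)) (ENNReal.ofReal q)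
        (volume.restrict (Ioo 0 T)) ∧
      eLpNorm (fun t => controlAdj S B (adjOpDom S t w)) (ENNReal.ofReal q)
        (volume.restrict (Ioo 0 T)) ≤ C * ‖x‖ₑ)
  /-- `R*R` maps `D((-A)^ε)` boundedly into `D((-A*)^ε)` -/
  observation : ∃ c : ℝ, ∀ x y : Y, IsFracPow S.op ε x y →
    ∃ z : Y, IsFracPow (adjOp S) ε (R.adjoint (R x)) z ∧ ‖z‖ ≤ c * ‖y‖

/-- `y = Lv` for the input-to-state map `Lv(t) = ∫_0^t e^{A(t-s)} B v(s) ds`. The integral is taken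
in `[D(A*)]'`, where `⟨e^{A(t-s)} B v(s), x⟩ = ⟨B v(s), e^{A*(t-s)} x⟩`, and `Lv(t) ∈ Y` is asked
for almost every `t > 0`. -/
def IsInputToState (S : C0Semigroup Y) (B : U →L[ℂ] Extrapolation S)
    (v : ℝ → U) (y : ℝ → Y) : Prop :=
  ∀ᵐ t ∂halfLine, ∀ x : DomAdj S,
    inner ℂ x.1.1 (y t) = ∫ s in Ioo 0 t, B (v s) (adjOpDom S (t - s) x)

/-- The controls used to test against: bounded, measurable, of bounded support. -/
def IsTestControl (u : ℝ → U) : Prop :=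
  StronglyMeasurable u ∧ (∃ c : ℝ, ∀ t, ‖u t‖ ≤ c) ∧ ∃ a : ℝ, ∀ t, a < t → u t = 0

/-- `w = L*y`, the adjoint of the input-to-state map,
`L*y(s) = ∫_s^∞ B* e^{A*(t-s)} y(t) dt`. As `B* e^{A*t}` is not defined on all of `Y`, this is
understood by duality: `∫_0^∞ (w, u)_U dt = ∫_0^∞ (y, Lu)_Y dt` for all test controls `u`. -/
def IsAdjInputToState (S : C0Semigroup Y) (B : U →L[ℂ] Extrapolation S)
    (y : ℝ → Y) (w : ℝ → U) : Prop :=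
  (∀ a : ℝ, IntegrableOn w (Ioo 0 a)) ∧
  ∀ (u : ℝ → U) (z : ℝ → Y), IsTestControl u → IsInputToState S B u z →
    Integrable (fun t => inner ℂ (y t) (z t)) halfLine ∧
    ∫ t, inner ℂ (w t) (u t) ∂halfLine = ∫ t, inner ℂ (y t) (z t) ∂halfLine

/-- `h = Λg`, where `Λ = I + L* R* R L`. -/
def IsLambda (S : C0Semigroup Y) (B : U →L[ℂ] Extrapolation S) (R : Y →L[ℂ] Z)
    (g h : ℝ → U) : Prop :=
  ∃ (y : ℝ → Y) (w : ℝ → U), IsInputToState S B g y ∧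
    IsAdjInputToState S B (fun t => R.adjoint (R (y t))) w ∧
    ∀ᵐ t ∂halfLine, h t = g t + w t

end System

end LQ

end

/-!
# Inversion of `Λ = I + L* R* R L` on weighted Lebesgue spaces

Everything is expressed through the kernel `k(τ) = B* e^{A*τ}` on the dense domain `D(A*)`: `L` is
the convolution with `k`, tested against elements of `D(A*)`, and `L*` is its adjoint
(`isLambda_iff`). Weights are absorbed in the kernel: `e^{θt}` turns the convolution with `k` into
the one with `e^{θτ} k(τ)` (`isLam_expMul_iff`), so that only the spaces `L^p(0,∞)` without weight
are used, with kernels `e^{θτ} k(τ)`, `|θ| ≤ θ₀ < ω`.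

Cut `k = ks + kb` at a small `κ > 0`: `ks` is `F` on `(0,κ)`, and `kb` is `G` on `(0,κ)` and `k` on
`[κ,∞)`. As `∫_0^κ τ^{-γ} dτ → 0` for `κ → 0`, Young's inequality bounds the convolution with `ks`
in every `L^p` by an arbitrarily small constant. The kernel `kb` is bounded from `Y` to `L^p`,
with a weight `e^{bτ}`, `b < ω`, for every finite `p`: near `0` this is the assumption on `G`, and
on `[κ,∞)` it follows from `k(τ + a) = k(τ) e^{A*a}` and the decay of the semigroup. By Hölder's
inequality the convolution with `kb` maps `L^{p₁}` to `L^{p₂}` whenever `1 < p₁ ≤ p₂ < ∞`. These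
properties are collected in `Splitting` (`Assumptions.exists_splitting`). They give the boundedness
of `Λ` at once.

In `L^2` without weight, `L* R* R L` is a positive operator, so `Λ` is invertible there
(`Splitting.isUnit_zero`). The weighted operators depend continuously in norm on `θ` at `θ = 0`,
hence `Λ` is also invertible in `L^2_θ` for small `θ > 0` (`Splitting.exists_isUnit_two`).

For the inverse from `L^q_δ` to `L^q_{δ'}`, write `Λ_s = I + Ls* R* R Ls` with the small kernel; it
is invertible in `L^q` and in `L^2` by a Neumann series, and the remainder `Λ - Λ_s` maps `L^q` to
`L^2`, because in each of its terms one factor has the kernel `kb`. With weight `δ`, `Λ g = h` is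
first solved up to an error in `L^2` by `g₁ = Λ_s⁻¹ h`. The error `N g₁` lies in `L^2_δ`, hence
in `L^2_θ` for the small `θ > 0` above, and is removed there by the inverse of `Λ`. The correction
lies in `L^2_θ`, which is contained in `L^q_{δ'}` for `0 < δ' < θ` by Hölder's inequality.
For uniqueness, let `Λ g = 0` with `g` in `L^q_{δ'}`. Then `Λ_s g = - N g` lies in `L^2_{δ'}`. This
equation also has a solution in `L^2_{δ'}`; both solutions lie in `L^q` without weight, where `Λ_s`
is injective, so they agree. Hence `g` is in `L^2_{δ'}`, where `Λ` is injective
(`Splitting.injective_q`, `Splitting.exists_inverse`).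
-/

set_option linter.unusedSectionVars false

noncomputable section

namespace LQ

/-! ### Weak measurability in separable Hilbert spaces -/

section Weak

variable {D Y : Type*} [AddCommGroup D] [Module ℂ D]
  [NormedAddCommGroup Y] [InnerProductSpace ℂ Y] [CompleteSpace Y]
  {ι : D →ₗ[ℂ] Y}

lemma eq_of_inner_dense (hι : DenseRange ι) {y z : Y}
    (h : ∀ x, inner ℂ (ι x) y = inner ℂ (ι x) z) : y = z := by
  have h2 : ∀ a : Y, inner ℂ a y = inner ℂ a z :=
    fun a => hι.induction_on (p := fun a => inner ℂ a y = inner ℂ a z) a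
      (isClosed_eq (by fun_prop) (by fun_prop)) h
  exact ext_inner_left ℂ h2

/-- Riesz representation of a conjugate-linear functional given on a dense set only. -/
lemma exists_inner_eq_of_dense (hι : DenseRange ι) (ℓ : D →ₗ⋆[ℂ] ℂ) (C : ℝ)
    (hC : 0 ≤ C) (h : ∀ x, ‖ℓ x‖ ≤ C * ‖ι x‖) :
    ∃ y : Y, ‖y‖ ≤ C ∧ ∀ x, inner ℂ (ι x) y = ℓ x := by
  let g : Y →L⋆[ℂ] ℂ := ℓ.extendOfNorm ι
  have hg : ∀ x, g (ι x) = ℓ x := fun x => LinearMap.extendOfNorm_eq hι ⟨C, h⟩ x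
  have hgn : ∀ y, ‖g y‖ ≤ C * ‖y‖ := LinearMap.norm_extendOfNorm_apply_le hι C h
  let g' : Y →ₗ[ℂ] ℂ :=
    { toFun := fun y => star (g y)
      map_add' := fun a b => by simp
      map_smul' := fun c a => by simp }
  let G : StrongDual ℂ Y := g'.mkContinuous C fun y => by
    simpa [g'] using hgn y
  refine ⟨(InnerProductSpace.toDual ℂ Y).symm G, ?_, fun x => ?_⟩
  · rw [LinearIsometryEquiv.norm_map]
    exact LinearMap.mkContinuous_norm_le _ hC _
  · rw [← inner_conj_symm, InnerProductSpace.toDual_symm_apply, ← hg x]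
    simp [G, g']

lemma aestronglyMeasurable_inner_of_dense {α : Type*} {mα : MeasurableSpace α} {μ : Measure α}
    (hι : DenseRange ι) {f : α → Y}
    (h : ∀ x, AEStronglyMeasurable (fun a => inner ℂ (ι x) (f a)) μ) (z : Y) :
    AEStronglyMeasurable (fun a => inner ℂ z (f a)) μ := by
  obtain ⟨u, hu, hlim⟩ := mem_closure_iff_seq_limit.1 (hι.closure_range ▸ mem_univ z)
  choose x hx using hu
  refine aestronglyMeasurable_of_tendsto_ae atTop (f := fun n a => inner ℂ (u n) (f a))
    (fun n => ?_) (Eventually.of_forall fun a => ?_)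
  · rw [← hx n]; exact h _
  · exact hlim.inner tendsto_const_nhds

/-- Pettis' theorem in a separable Hilbert space: weakly measurable functions are strongly
measurable. It suffices to test with a dense set of vectors. -/
lemma aestronglyMeasurable_of_inner_dense [TopologicalSpace.SeparableSpace Y]
    {α : Type*} {mα : MeasurableSpace α} {μ : Measure α}
    (hι : DenseRange ι) {f : α → Y}
    (h : ∀ x, AEStronglyMeasurable (fun a => inner ℂ (ι x) (f a)) μ) :
    AEStronglyMeasurable f μ := by
  have hz := aestronglyMeasurable_inner_of_dense hι h
  let V : ℕ → Submodule ℂ Y :=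
    fun n => Submodule.span ℂ (TopologicalSpace.denseSeq Y '' Iio n)
  have hfin : ∀ n, FiniteDimensional ℂ (V n) := fun n =>
    FiniteDimensional.span_of_finite ℂ ((finite_Iio n).image _)
  have hmono : Monotone V := fun m n hmn =>
    Submodule.span_mono (image_mono (Iio_subset_Iio hmn))
  have htop : ⊤ ≤ (⨆ n, V n).topologicalClosure := by
    intro y _
    rw [← SetLike.mem_coe, Submodule.topologicalClosure_coe]
    refine closure_mono ?_ (TopologicalSpace.denseRange_denseSeq Y y)
    rintro _ ⟨n, rfl⟩
    exact (le_iSup V (n + 1)) (Submodule.subset_span ⟨n, by simp, rfl⟩)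
  refine aestronglyMeasurable_of_tendsto_ae atTop (f := fun n a => (V n).starProjection (f a))
    (fun n => ?_) (Eventually.of_forall fun a =>
      Submodule.starProjection_tendsto_self V hmono (f a) htop)
  let b := stdOrthonormalBasis ℂ (V n)
  have : (fun a => (V n).starProjection (f a))
      = fun a => ∑ i, (inner ℂ (b i : Y) (f a)) • (b i : Y) := by
    funext a
    rw [Submodule.starProjection_apply, b.orthogonalProjectionOnto_apply_eq_sum]
    simp
  rw [this]
  exact Finset.aestronglyMeasurable_fun_sum _ fun i _ => (hz _).smul_const _

end Weak

/-! ### Duality of Lebesgue spaces on the half-line -/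

section Pairing

instance : SigmaFinite halfLine := by unfold halfLine; infer_instance

variable {X : Type*} [NormedAddCommGroup X] [InnerProductSpace ℂ X] {p p' : ℝ≥0∞}

lemma integrable_inner_of_memLp {α : Type*} {mα : MeasurableSpace α} {μ : Measure α}
    [ENNReal.HolderConjugate p p'] {f g : α → X} (hf : MemLp f p μ) (hg : MemLp g p' μ) :
    Integrable (fun t => inner ℂ (f t) (g t)) μ := by
  rw [← memLp_one_iff_integrable]
  refine MemLp.of_bilin (fun a b => inner ℂ a b) 1 hf hg (hf.1.inner hg.1)
    (Eventually.of_forall fun t => ?_)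
  simpa using nnnorm_inner_le_nnnorm (𝕜 := ℂ) (f t) (g t)

lemma enorm_integral_inner_le {α : Type*} {mα : MeasurableSpace α} {μ : Measure α}
    [ENNReal.HolderConjugate p p'] {f g : α → X}
    (hf : AEStronglyMeasurable f μ) (hg : AEStronglyMeasurable g μ) :
    ‖∫ t, inner ℂ (f t) (g t) ∂μ‖ₑ ≤ eLpNorm f p μ * eLpNorm g p' μ := by
  calc ‖∫ t, inner ℂ (f t) (g t) ∂μ‖ₑ
      ≤ eLpNorm (fun t => inner ℂ (f t) (g t)) 1 μ := by
        rw [eLpNorm_one_eq_lintegral_enorm]; exact enorm_integral_le_lintegral_enorm _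
    _ ≤ (1 : ℝ≥0) * eLpNorm f p μ * eLpNorm g p' μ :=
        eLpNorm_le_eLpNorm_mul_eLpNorm_of_nnnorm hf hg (fun a b => inner ℂ a b) 1
          (Eventually.of_forall fun t => by
            simpa using nnnorm_inner_le_nnnorm (𝕜 := ℂ) (f t) (g t))
    _ = _ := by simp

lemma IsTestControl.memLp {u : ℝ → X} (hu : IsTestControl u) (p : ℝ≥0∞) :
    MemLp u p halfLine := by
  obtain ⟨hm, ⟨c, hc⟩, a, ha⟩ := hu
  have hi : u = (Iic a).indicator u := by
    funext t
    by_cases ht : t ≤ a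
    · rw [indicator_of_mem (mem_Iic.2 ht)]
    · rw [indicator_of_notMem (by simpa using ht), ha t (not_le.1 ht)]
  rw [hi, memLp_indicator_iff_restrict measurableSet_Iic]
  have : IsFiniteMeasure (halfLine.restrict (Iic a)) := by
    constructor
    rw [Measure.restrict_apply_univ, halfLine, Measure.restrict_apply measurableSet_Iic]
    refine lt_of_le_of_lt (measure_mono (?_ : _ ⊆ Icc 0 a)) measure_Icc_lt_top
    rintro t ⟨h1, h2⟩
    exact ⟨le_of_lt h2, h1⟩
  exact MemLp.of_bound hm.aestronglyMeasurable c (Eventually.of_forall hc)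

/-- The norm of `L^p(0,∞)` is determined by the pairing with test controls: the extremal one,
`‖w‖^(p-2) w`, becomes a test control after truncation. -/
lemma eLpNorm_le_of_forall_testControl (hp1 : 1 < p) (hp : p ≠ ∞) [ENNReal.HolderConjugate p p']
    {w : ℝ → X} (hw : AEStronglyMeasurable w halfLine) (C : ℝ≥0∞)
    (h : ∀ u : ℝ → X, IsTestControl u →
      ‖∫ t, inner ℂ (w t) (u t) ∂halfLine‖ₑ ≤ C * eLpNorm u p' halfLine) :
    eLpNorm w p halfLine ≤ C := by
  have hr1 : 1 < p.toReal := by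
    rw [← ENNReal.toReal_one]; exact (ENNReal.toReal_lt_toReal ENNReal.one_ne_top hp).2 hp1
  have hconj : p.toReal.HolderConjugate p'.toReal := ENNReal.HolderConjugate.toReal hr1
  have hp'1 : 1 < p'.toReal := hconj.symm.lt
  have hp'0 : p' ≠ 0 := by rintro rfl; simp at hp'1; linarith
  have hp't : p' ≠ ∞ := by rintro rfl; simp at hp'1; linarith
  set r := p.toReal with hr
  set r' := p'.toReal with hr'
  set v := hw.mk w with hv
  have hvm : StronglyMeasurable v := hw.stronglyMeasurable_mk
  have hwv : w =ᵐ[halfLine] v := hw.ae_eq_mk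
  let A : ℕ → Set ℝ := fun n => {t | t ≤ n ∧ ‖v t‖ ≤ n}
  have hA : ∀ n, MeasurableSet (A n) := fun n =>
    (measurableSet_le measurable_id measurable_const).inter
      (measurableSet_le hvm.norm.measurable measurable_const)
  have hAmono : Monotone A := fun m n hmn t ht =>
    ⟨ht.1.trans (by exact_mod_cast hmn), ht.2.trans (by exact_mod_cast hmn)⟩
  have hAun : ⋃ n, A n = univ := by
    refine eq_univ_of_forall fun t => mem_iUnion.2 ?_
    obtain ⟨n, hn⟩ := exists_nat_ge (max t ‖v t‖)
    exact ⟨n, (le_max_left _ _).trans hn, (le_max_right _ _).trans hn⟩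
  let u : ℕ → ℝ → X := fun n => (A n).indicator fun t => ‖v t‖ ^ (r - 2) • v t
  have hnorm : ∀ t, ‖‖v t‖ ^ (r - 2) • v t‖ = ‖v t‖ ^ (r - 1) := by
    intro t
    rcases eq_or_ne (v t) 0 with h0 | h0
    · rw [h0, smul_zero, norm_zero, Real.zero_rpow (by linarith)]
    · have := norm_pos_iff.2 h0
      rw [norm_smul, Real.norm_of_nonneg (by positivity), ← Real.rpow_add_one this.ne']
      congr 1; ring
  have hu : ∀ n, IsTestControl (u n) := by
    intro n
    refine ⟨?_, ⟨(n : ℝ) ^ (r - 1), fun t => ?_⟩, n, fun t ht => ?_⟩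
    · exact StronglyMeasurable.indicator
        ((hvm.norm.measurable.pow_const _).stronglyMeasurable.smul hvm) (hA n)
    · by_cases ht : t ∈ A n
      · simp only [u, indicator_of_mem ht, hnorm]
        exact Real.rpow_le_rpow (norm_nonneg _) ht.2 (by linarith)
      · simp only [u, indicator_of_notMem ht, norm_zero]
        positivity
    · exact indicator_of_notMem (fun h => not_le.2 ht h.1) _
  let I : ℕ → ℝ≥0∞ := fun n => ∫⁻ t in A n, ‖v t‖ₑ ^ r ∂halfLine
  have hfin : ∀ n, I n ≠ ∞ := by
    intro n
    have hmu : halfLine (A n) < ∞ := by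
      rw [halfLine, Measure.restrict_apply (hA n)]
      refine lt_of_le_of_lt (measure_mono (?_ : _ ⊆ Icc 0 (n : ℝ))) measure_Icc_lt_top
      rintro t ⟨h1, h2⟩
      exact ⟨le_of_lt h2, h1.1⟩
    refine (setLIntegral_lt_top_of_le_nnreal hmu.ne ⟨(n : ℝ≥0) ^ r, fun t ht => ?_⟩).ne
    rw [ENNReal.coe_rpow_of_nonneg _ (by linarith)]
    refine ENNReal.rpow_le_rpow ?_ (by linarith)
    rw [enorm_le_coe]
    exact_mod_cast ht.2
  have hint : ∀ n, ‖∫ t, inner ℂ (w t) (u n t) ∂halfLine‖ₑ = I n := by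
    intro n
    have e1 : ∫ t, inner ℂ (w t) (u n t) ∂halfLine
        = ∫ t, (((A n).indicator (fun t => ‖v t‖ ^ r) t : ℝ) : ℂ) ∂halfLine := by
      refine integral_congr_ae ?_
      filter_upwards [hwv] with t ht
      rw [ht]
      by_cases hA' : t ∈ A n
      · simp only [u, indicator_of_mem hA']
        rw [← Complex.coe_smul, inner_smul_right, inner_self_eq_norm_sq_to_K]
        rcases eq_or_ne (v t) 0 with h0 | h0
        · rw [h0]; simp [Real.zero_rpow (by linarith : r ≠ 0)]
        · have := norm_pos_iff.2 h0
          have e2 : ‖v t‖ ^ (r - 2) * ‖v t‖ ^ 2 = ‖v t‖ ^ r := by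
            rw [← Real.rpow_natCast, ← Real.rpow_add this]; norm_num
          rw [← e2]; push_cast; rfl
      · simp [u, indicator_of_notMem hA']
    have e3 : ∀ t, 0 ≤ (A n).indicator (fun t => ‖v t‖ ^ r) t := fun t =>
      indicator_nonneg (fun t _ => by positivity) t
    rw [e1, integral_complex_ofReal, ← ofReal_norm, Complex.norm_real,
      Real.norm_of_nonneg (integral_nonneg e3), integral_indicator (hA n),
      ofReal_integral_eq_lintegral_ofReal]
    · refine lintegral_congr fun t => ?_
      rw [← ENNReal.ofReal_rpow_of_nonneg (norm_nonneg _) (by linarith), ofReal_norm]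
    · refine ⟨(hvm.norm.measurable.pow_const _).aestronglyMeasurable, ?_⟩
      rw [hasFiniteIntegral_iff_ofReal (Eventually.of_forall fun t => by positivity)]
      refine lt_of_le_of_lt (le_of_eq ?_) (hfin n).lt_top
      refine lintegral_congr fun t => ?_
      rw [← ENNReal.ofReal_rpow_of_nonneg (norm_nonneg _) (by linarith), ofReal_norm]
    · exact Eventually.of_forall fun t => by positivity
  have hun : ∀ n, eLpNorm (u n) p' halfLine = I n ^ (1 / r') := by
    intro n
    rw [eLpNorm_eq_lintegral_rpow_enorm_toReal hp'0 hp't]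
    congr 1
    change _ = ∫⁻ t in A n, ‖v t‖ₑ ^ r ∂halfLine
    rw [← lintegral_indicator (hA n)]
    refine lintegral_congr fun t => ?_
    by_cases hA' : t ∈ A n
    · simp only [u, indicator_of_mem hA']
      rw [← ofReal_norm, hnorm, ← ofReal_norm,
        ENNReal.ofReal_rpow_of_nonneg (by positivity) (by linarith),
        ENNReal.ofReal_rpow_of_nonneg (norm_nonneg _) (by linarith), ← Real.rpow_mul (norm_nonneg _)]
      congr 2
      exact hconj.sub_one_mul_conj
    · simp only [u, indicator_of_notMem hA', enorm_zero]
      exact ENNReal.zero_rpow_of_pos (by linarith)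
  have hI : ∀ n, I n ≤ C ^ r := by
    intro n
    have h1 := h (u n) (hu n)
    rw [hint, hun] at h1
    rcases eq_or_ne (I n) 0 with h0 | h0
    · rw [h0]; exact zero_le
    have h2 : I n ^ (1 / r) ≤ C := by
      have e : I n = I n ^ (1 / r) * I n ^ (1 / r') := by
        rw [← ENNReal.rpow_add _ _ h0 (hfin n)]
        rw [one_div, one_div, hconj.inv_add_inv_eq_one, ENNReal.rpow_one]
      have h3 : I n ^ (1 / r) * I n ^ (1 / r') ≤ C * I n ^ (1 / r') := by rwa [← e]
      have h4 : I n ^ (1 / r') ≠ 0 := by simp [h0, hfin n]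
      have h5 : I n ^ (1 / r') ≠ ∞ := ENNReal.rpow_ne_top_of_nonneg (by positivity) (hfin n)
      exact (ENNReal.mul_le_mul_iff_left h4 h5).1 h3
    calc I n = (I n ^ (1 / r)) ^ r := by
          rw [← ENNReal.rpow_mul, one_div_mul_cancel (by linarith), ENNReal.rpow_one]
      _ ≤ C ^ r := ENNReal.rpow_le_rpow h2 (by linarith)
  have hlim : ∫⁻ t, ‖v t‖ₑ ^ r ∂halfLine ≤ C ^ r := by
    rw [← setLIntegral_univ, ← hAun, setLIntegral_iUnion_of_directed _ hAmono.directed_le]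
    exact iSup_le hI
  rw [eLpNorm_congr_ae hwv, eLpNorm_eq_lintegral_rpow_enorm_toReal (by positivity) hp]
  calc _ ≤ (C ^ r) ^ (1 / r) := ENNReal.rpow_le_rpow hlim (by positivity)
    _ = C := by rw [← ENNReal.rpow_mul, mul_one_div_cancel (by linarith), ENNReal.rpow_one]

end Pairing

/-! ### Operator-valued convolutions with unbounded kernels -/

section Kernel

variable {D Y U : Type*} [AddCommGroup D] [Module ℂ D]
  [NormedAddCommGroup Y] [InnerProductSpace ℂ Y] [CompleteSpace Y]
  [NormedAddCommGroup U] [InnerProductSpace ℂ U] [CompleteSpace U]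

/-- `y(t) = ∫_0^∞ k(t-s)^* v(s) ds` in the weak sense, tested with the vectors `ι x`, `x ∈ D`. The
kernel `k(τ) : D → U` is only defined on the dense subspace `ι D` of `Y`. Causal kernels vanish for
`τ ≤ 0`, so that the integral is one over `(0,t)`. -/
def IsConv (ι : D →ₗ[ℂ] Y) (k : ℝ → D →ₗ[ℂ] U) (v : ℝ → U) (y : ℝ → Y) : Prop :=
  ∀ᵐ t ∂halfLine, ∀ x : D,
    inner ℂ (ι x) (y t) = ∫ s, inner ℂ (k (t - s) x) (v s) ∂halfLine

/-- The convolution with `k` is dominated in `L^r` by the scalar convolution with `m`: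
`∫ ‖k(t-s)x‖ v(s) ds ≤ ‖x‖ (∫ m(t-s) v(s)^r ds)^(1/r)` for all `v ≥ 0`. -/
structure KernelBound (ι : D →ₗ[ℂ] Y) (k : ℝ → D →ₗ[ℂ] U) (r : ℝ) (m : ℝ → ℝ≥0∞) : Prop where
  aestronglyMeasurable : ∀ x, AEStronglyMeasurable (fun τ => k τ x) volume
  measurable : Measurable m
  bound : ∀ (x : D) (v : ℝ → ℝ≥0∞) (t : ℝ), AEMeasurable v halfLine →
    ∫⁻ s, ‖k (t - s) x‖ₑ * v s ∂halfLine
      ≤ ‖ι x‖ₑ * (∫⁻ s, m (t - s) * v s ^ r ∂halfLine) ^ (1 / r)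

variable {ι : D →ₗ[ℂ] Y} {k k₁ k₂ : ℝ → D →ₗ[ℂ] U} {v v₁ v₂ : ℝ → U} {y y₁ y₂ : ℝ → Y}

lemma IsConv.congr (h : IsConv ι k v y) (hv : v =ᵐ[halfLine] v₁) (hy : y =ᵐ[halfLine] y₁) :
    IsConv ι k v₁ y₁ := by
  filter_upwards [h, hy] with t ht hyt x
  rw [← hyt, ht x]
  refine integral_congr_ae ?_
  filter_upwards [hv] with s hs
  rw [hs]

lemma IsConv.unique (hι : DenseRange ι) (h₁ : IsConv ι k v y₁) (h₂ : IsConv ι k v y₂) :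
    y₁ =ᵐ[halfLine] y₂ := by
  filter_upwards [h₁, h₂] with t h1 h2
  exact eq_of_inner_dense hι fun x => by rw [h1, h2]

lemma IsConv.smul (h : IsConv ι k v y) (c : ℂ) : IsConv ι k (c • v) (c • y) := by
  filter_upwards [h] with t ht x
  simp only [Pi.smul_apply, inner_smul_right, ht x, integral_const_mul]

/-- The convolution integrals of `k` and `v` converge absolutely at almost every time. -/
def ConvIntegrable (k : ℝ → D →ₗ[ℂ] U) (v : ℝ → U) : Prop :=
  ∀ᵐ t ∂halfLine, ∀ x : D, Integrable (fun s => inner ℂ (k (t - s) x) (v s)) halfLine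

lemma IsConv.add (h₁ : IsConv ι k v₁ y₁) (h₂ : IsConv ι k v₂ y₂)
    (i₁ : ConvIntegrable k v₁) (i₂ : ConvIntegrable k v₂) :
    IsConv ι k (v₁ + v₂) (y₁ + y₂) := by
  filter_upwards [h₁, h₂, i₁, i₂] with t h1 h2 j1 j2 x
  simp only [Pi.add_apply, inner_add_right, h1 x, h2 x]
  exact (integral_add (j1 x) (j2 x)).symm

lemma IsConv.add_kernel (h₁ : IsConv ι k₁ v y₁) (h₂ : IsConv ι k₂ v y₂)
    (i₁ : ConvIntegrable k₁ v) (i₂ : ConvIntegrable k₂ v) :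
    IsConv ι (k₁ + k₂) v (y₁ + y₂) := by
  filter_upwards [h₁, h₂, i₁, i₂] with t h1 h2 j1 j2 x
  simp only [Pi.add_apply, LinearMap.add_apply, inner_add_right, inner_add_left, h1 x, h2 x]
  exact (integral_add (j1 x) (j2 x)).symm

variable {r : ℝ} {m : ℝ → ℝ≥0∞}

lemma halfLine_le_volume : halfLine ≤ (volume : Measure ℝ) := Measure.restrict_le_self

lemma aestronglyMeasurable_comp_sub {f : ℝ → U} (hf : AEStronglyMeasurable f volume) (t : ℝ) :
    AEStronglyMeasurable (fun s => f (t - s)) halfLine :=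
  (hf.comp_quasiMeasurePreserving
    (quasiMeasurePreserving_sub_left_of_right_invariant volume t)).mono_measure halfLine_le_volume

lemma aestronglyMeasurable_comp_sub_prod {f : ℝ → U} (hf : AEStronglyMeasurable f volume) :
    AEStronglyMeasurable (fun z : ℝ × ℝ => f (z.1 - z.2)) (halfLine.prod halfLine) := by
  have := hf.comp_quasiMeasurePreserving
    (quasiMeasurePreserving_sub_of_right_invariant (volume : Measure ℝ) (volume : Measure ℝ))
  rw [halfLine, Measure.prod_restrict]
  exact this.restrict

namespace KernelBound

lemma lintegral_lintegral_le (hm : Measurable m) {g : ℝ → ℝ≥0∞} (hg : AEMeasurable g halfLine) :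
    ∫⁻ t, ∫⁻ s, m (t - s) * g s ∂halfLine ∂halfLine
      ≤ (∫⁻ τ, m τ) * ∫⁻ s, g s ∂halfLine := by
  rw [lintegral_lintegral_swap]
  · calc ∫⁻ s, ∫⁻ t, m (t - s) * g s ∂halfLine ∂halfLine
        ≤ ∫⁻ s, (∫⁻ τ, m τ) * g s ∂halfLine := by
          refine lintegral_mono fun s => ?_
          have hms : Measurable fun t => m (t - s) := hm.comp (measurable_id.sub_const s)
          rw [lintegral_mul_const _ hms]
          refine mul_le_mul_left ?_ (g s)
          exact (lintegral_mono' halfLine_le_volume le_rfl).trans_eq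
            (lintegral_sub_right_eq_self m s)
      _ = _ := lintegral_const_mul'' _ hg
  · exact (hm.comp (measurable_fst.sub measurable_snd)).aemeasurable.mul hg.comp_snd

variable (h : KernelBound ι k r m)
include h

lemma integrable (hv : AEStronglyMeasurable v halfLine) (hr : 0 < r) {t : ℝ}
    (ht : ∫⁻ s, m (t - s) * ‖v s‖ₑ ^ r ∂halfLine ≠ ∞) (x : D) :
    Integrable (fun s => inner ℂ (k (t - s) x) (v s)) halfLine := by
  refine ⟨(aestronglyMeasurable_comp_sub (h.aestronglyMeasurable x) t).inner hv, ?_⟩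
  calc ∫⁻ s, ‖(inner ℂ (k (t - s) x) (v s) : ℂ)‖ₑ ∂halfLine
      ≤ ∫⁻ s, ‖k (t - s) x‖ₑ * ‖v s‖ₑ ∂halfLine := by
        refine lintegral_mono fun s => ?_
        simp only [enorm_eq_nnnorm]
        exact_mod_cast nnnorm_inner_le_nnnorm (𝕜 := ℂ) (k (t - s) x) (v s)
    _ ≤ _ := h.bound x _ t hv.enorm
    _ < ∞ := ENNReal.mul_lt_top enorm_lt_top
        (ENNReal.rpow_lt_top_of_nonneg (by positivity) ht)

lemma ae_ne_top (hv : AEStronglyMeasurable v halfLine)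
    (hm : ∫⁻ τ, m τ ≠ ∞) (hvr : ∫⁻ s, ‖v s‖ₑ ^ r ∂halfLine ≠ ∞) :
    ∀ᵐ t ∂halfLine, ∫⁻ s, m (t - s) * ‖v s‖ₑ ^ r ∂halfLine ≠ ∞ := by
  have hmeas : AEMeasurable (fun t => ∫⁻ s, m (t - s) * ‖v s‖ₑ ^ r ∂halfLine) halfLine :=
    AEMeasurable.lintegral_prod_right' (f := fun z : ℝ × ℝ => m (z.1 - z.2) * ‖v z.2‖ₑ ^ r)
      ((h.measurable.comp (measurable_fst.sub measurable_snd)).aemeasurable.mul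
        (hv.enorm.pow_const r).comp_snd)
  refine (ae_lt_top' hmeas ?_).mono fun t ht => ht.ne
  exact ne_top_of_le_ne_top (ENNReal.mul_ne_top hm hvr)
    (lintegral_lintegral_le h.measurable (hv.enorm.pow_const r))

lemma convIntegrable (hr : 0 < r) (hv : AEStronglyMeasurable v halfLine)
    (hm : ∫⁻ τ, m τ ≠ ∞) (hvr : ∫⁻ s, ‖v s‖ₑ ^ r ∂halfLine ≠ ∞) :
    ConvIntegrable k v := by
  filter_upwards [h.ae_ne_top hv hm hvr] with t ht x
  exact h.integrable hv hr ht x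

lemma exists_isConv [TopologicalSpace.SeparableSpace Y] (hι : DenseRange ι) (hr : 0 < r)
    (hv : AEStronglyMeasurable v halfLine)
    (hm : ∫⁻ τ, m τ ≠ ∞) (hvr : ∫⁻ s, ‖v s‖ₑ ^ r ∂halfLine ≠ ∞) :
    ∃ y : ℝ → Y, AEStronglyMeasurable y halfLine ∧ IsConv ι k v y ∧
      ∀ᵐ t ∂halfLine, ‖y t‖ₑ ≤ (∫⁻ s, m (t - s) * ‖v s‖ₑ ^ r ∂halfLine) ^ (1 / r) := by
  have key : ∀ t, ∃ y : Y, ∫⁻ s, m (t - s) * ‖v s‖ₑ ^ r ∂halfLine ≠ ∞ →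
      ‖y‖ₑ ≤ (∫⁻ s, m (t - s) * ‖v s‖ₑ ^ r ∂halfLine) ^ (1 / r) ∧
      ∀ x, inner ℂ (ι x) y = ∫ s, inner ℂ (k (t - s) x) (v s) ∂halfLine := by
    intro t
    by_cases ht : ∫⁻ s, m (t - s) * ‖v s‖ₑ ^ r ∂halfLine = ∞
    · exact ⟨0, fun h => absurd ht h⟩
    set φ := ∫⁻ s, m (t - s) * ‖v s‖ₑ ^ r ∂halfLine with hφ
    have hφt : φ ^ (1 / r) ≠ ∞ := ENNReal.rpow_ne_top_of_nonneg (by positivity) ht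
    let ℓ : D →ₗ⋆[ℂ] ℂ :=
      { toFun := fun x => ∫ s, inner ℂ (k (t - s) x) (v s) ∂halfLine
        map_add' := fun a b => by
          simp only [map_add, inner_add_left]
          exact integral_add (h.integrable hv hr ht a) (h.integrable hv hr ht b)
        map_smul' := fun c a => by
          simp only [map_smul, inner_smul_left, integral_const_mul, smul_eq_mul] }
    have hℓ : ∀ x, ‖ℓ x‖ ≤ (φ ^ (1 / r)).toReal * ‖ι x‖ := by
      intro x
      have h1 : ‖ℓ x‖ₑ ≤ ‖ι x‖ₑ * φ ^ (1 / r) := by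
        calc ‖ℓ x‖ₑ ≤ ∫⁻ s, ‖(inner ℂ (k (t - s) x) (v s) : ℂ)‖ₑ ∂halfLine :=
              enorm_integral_le_lintegral_enorm _
          _ ≤ ∫⁻ s, ‖k (t - s) x‖ₑ * ‖v s‖ₑ ∂halfLine := by
              refine lintegral_mono fun s => ?_
              simp only [enorm_eq_nnnorm]
              exact_mod_cast nnnorm_inner_le_nnnorm (𝕜 := ℂ) (k (t - s) x) (v s)
          _ ≤ _ := h.bound x _ t hv.enorm
      have h2 := ENNReal.toReal_mono (ENNReal.mul_ne_top enorm_ne_top hφt) h1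
      rwa [ENNReal.toReal_mul, toReal_enorm, toReal_enorm, mul_comm] at h2
    obtain ⟨y, hy1, hy2⟩ := exists_inner_eq_of_dense hι ℓ _ ENNReal.toReal_nonneg hℓ
    refine ⟨y, fun _ => ⟨?_, hy2⟩⟩
    rw [← ofReal_norm, ← ENNReal.ofReal_toReal hφt]
    exact ENNReal.ofReal_le_ofReal hy1
  choose y hy using key
  have hconv : IsConv ι k v y := by
    filter_upwards [h.ae_ne_top hv hm hvr] with t ht x
    exact (hy t ht).2 x
  refine ⟨y, ?_, hconv, ?_⟩
  · refine aestronglyMeasurable_of_inner_dense hι fun x => ?_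
    have h1 : AEStronglyMeasurable
        (fun t => ∫ s, inner ℂ (k (t - s) x) (v s) ∂halfLine) halfLine :=
      AEStronglyMeasurable.integral_prod_right'
        (f := fun z : ℝ × ℝ => (inner ℂ (k (z.1 - z.2) x) (v z.2) : ℂ))
        ((aestronglyMeasurable_comp_sub_prod (h.aestronglyMeasurable x)).inner hv.comp_snd)
    refine h1.congr ?_
    filter_upwards [hconv] with t ht
    exact (ht x).symm
  · filter_upwards [h.ae_ne_top hv hm hvr] with t ht
    exact (hy t ht).1

omit h in
/-- The convolution with an integrable `m` bounded by `M` maps `L^r` to `L^{r₂}`, `r₂ ≥ r`. For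
`r₂ = r` the bound `M` enters with the exponent `0`, so that `M = ∞` is allowed. -/
lemma lintegral_rpow_le (hm : Measurable m) {r₂ : ℝ} (hr : 0 < r) (hr₂ : r ≤ r₂) {M : ℝ≥0∞}
    (hM : ∀ τ, m τ ≤ M) {g : ℝ → ℝ≥0∞} (hg : AEMeasurable g halfLine) :
    ∫⁻ t, ((∫⁻ s, m (t - s) * g s ^ r ∂halfLine) ^ (1 / r)) ^ r₂ ∂halfLine
      ≤ (M ^ (r₂ / r - 1) * ∫⁻ τ, m τ) * ((∫⁻ s, g s ^ r ∂halfLine) ^ (1 / r)) ^ r₂ := by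
  set E := ∫⁻ s, g s ^ r ∂halfLine with hE
  have ha : 0 ≤ r₂ / r - 1 := by rw [sub_nonneg, one_le_div hr]; exact hr₂
  have e0 : ∀ a : ℝ≥0∞, (a ^ (1 / r)) ^ r₂ = a ^ (r₂ / r - 1) * a := by
    intro a
    conv_rhs => rw [← ENNReal.rpow_one a, ← ENNReal.rpow_mul, one_mul]
    rw [← ENNReal.rpow_add_of_nonneg _ _ ha zero_le_one, ← ENNReal.rpow_mul]
    congr 1; ring
  have hle : ∀ t, ∫⁻ s, m (t - s) * g s ^ r ∂halfLine ≤ M * E := fun t => by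
    rw [hE, ← lintegral_const_mul'' _ (hg.pow_const r)]
    exact lintegral_mono fun s => by gcongr; exact hM _
  have hmeas : AEMeasurable (fun t => ∫⁻ s, m (t - s) * g s ^ r ∂halfLine) halfLine :=
    AEMeasurable.lintegral_prod_right' (f := fun z : ℝ × ℝ => m (z.1 - z.2) * g z.2 ^ r)
      ((hm.comp (measurable_fst.sub measurable_snd)).aemeasurable.mul
        (hg.pow_const r).comp_snd)
  simp only [e0]
  calc ∫⁻ t, (∫⁻ s, m (t - s) * g s ^ r ∂halfLine) ^ (r₂ / r - 1) *
        ∫⁻ s, m (t - s) * g s ^ r ∂halfLine ∂halfLine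
      ≤ ∫⁻ t, (M * E) ^ (r₂ / r - 1) * ∫⁻ s, m (t - s) * g s ^ r ∂halfLine ∂halfLine :=
        lintegral_mono fun t => by gcongr; exact hle t
    _ = (M * E) ^ (r₂ / r - 1) * ∫⁻ t, ∫⁻ s, m (t - s) * g s ^ r ∂halfLine ∂halfLine :=
        lintegral_const_mul'' _ hmeas
    _ ≤ (M * E) ^ (r₂ / r - 1) * ((∫⁻ τ, m τ) * E) := by
        gcongr; exact lintegral_lintegral_le hm (hg.pow_const r)
    _ = _ := by rw [ENNReal.mul_rpow_of_nonneg _ _ ha]; ring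

end KernelBound

end Kernel

/-! ### Convolution operators between Lebesgue spaces -/

section ConvOp

variable {D Y U : Type*} [AddCommGroup D] [Module ℂ D]
  [NormedAddCommGroup Y] [InnerProductSpace ℂ Y] [CompleteSpace Y]
  [NormedAddCommGroup U] [InnerProductSpace ℂ U] [CompleteSpace U]
  {ι : D →ₗ[ℂ] Y} {k k₁ k₂ : ℝ → D →ₗ[ℂ] U}

/-- The convolution with `k` is an absolutely convergent bounded operator from `L^p(0,∞;U)` to
`L^{p₂}(0,∞;Y)`, of norm at most `C`. -/
def HasConv (ι : D →ₗ[ℂ] Y) (k : ℝ → D →ₗ[ℂ] U) (p p₂ : ℝ≥0∞) [Fact (1 ≤ p)] [Fact (1 ≤ p₂)]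
    (C : ℝ) : Prop :=
  ∃ T : Lp U p halfLine →L[ℂ] Lp Y p₂ halfLine,
    (∀ v : Lp U p halfLine, ConvIntegrable k v ∧ IsConv ι k v (T v)) ∧ ‖T‖ ≤ C

open Classical in
/-- The convolution with `k` as an operator from `L^p(0,∞;U)` to `L^{p₂}(0,∞;Y)` (set to `0` if
there is no such bounded operator). -/
def convOp (ι : D →ₗ[ℂ] Y) (k : ℝ → D →ₗ[ℂ] U) (p p₂ : ℝ≥0∞) [Fact (1 ≤ p)] [Fact (1 ≤ p₂)] :
    Lp U p halfLine →L[ℂ] Lp Y p₂ halfLine :=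
  if h : ∃ T : Lp U p halfLine →L[ℂ] Lp Y p₂ halfLine,
    ∀ v : Lp U p halfLine, ConvIntegrable k v ∧ IsConv ι k v (T v) then h.choose else 0

variable {p p₂ p' p₂' : ℝ≥0∞} [Fact (1 ≤ p)] [Fact (1 ≤ p₂)] [Fact (1 ≤ p')] [Fact (1 ≤ p₂')]
  {C C' : ℝ}

namespace HasConv

lemma spec (h : HasConv ι k p p₂ C) (v : Lp U p halfLine) :
    ConvIntegrable k v ∧ IsConv ι k v (convOp ι k p p₂ v) := by
  obtain ⟨T, hT, -⟩ := h
  have h : ∃ T : Lp U p halfLine →L[ℂ] Lp Y p₂ halfLine,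
    ∀ v : Lp U p halfLine, ConvIntegrable k v ∧ IsConv ι k v (T v) := ⟨T, hT⟩
  rw [convOp, dif_pos h]
  exact h.choose_spec v

lemma convIntegrable (h : HasConv ι k p p₂ C) (v : Lp U p halfLine) : ConvIntegrable k v :=
  (h.spec v).1

lemma isConv (h : HasConv ι k p p₂ C) (v : Lp U p halfLine) :
    IsConv ι k v (convOp ι k p p₂ v) :=
  (h.spec v).2

lemma convOp_eq (hι : DenseRange ι) (h : HasConv ι k p p₂ C) {v : Lp U p halfLine}
    {y : Lp Y p₂ halfLine} (hy : IsConv ι k v y) : convOp ι k p p₂ v = y :=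
  Lp.ext ((h.isConv v).unique hι hy)

lemma norm_convOp_le (hι : DenseRange ι) (h : HasConv ι k p p₂ C) : ‖convOp ι k p p₂‖ ≤ C := by
  have h' := h
  obtain ⟨T, hT, hC⟩ := h
  have : convOp ι k p p₂ = T := ContinuousLinearMap.ext fun v => h'.convOp_eq hι (hT v).2
  rwa [this]

lemma add (h₁ : HasConv ι k₁ p p₂ C) (h₂ : HasConv ι k₂ p p₂ C') :
    HasConv ι (k₁ + k₂) p p₂ (C + C') := by
  obtain ⟨T₁, hT₁, hC₁⟩ := h₁
  obtain ⟨T₂, hT₂, hC₂⟩ := h₂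
  refine ⟨T₁ + T₂, fun v => ⟨?_, ?_⟩, (norm_add_le T₁ T₂).trans (add_le_add hC₁ hC₂)⟩
  · filter_upwards [(hT₁ v).1, (hT₂ v).1] with t h1 h2 x
    simp only [Pi.add_apply, LinearMap.add_apply, inner_add_left]
    exact (h1 x).add (h2 x)
  · exact ((hT₁ v).2.add_kernel (hT₂ v).2 (hT₁ v).1 (hT₂ v).1).congr .rfl
      (Lp.coeFn_add _ _).symm

lemma convOp_add (hι : DenseRange ι) (h₁ : HasConv ι k₁ p p₂ C) (h₂ : HasConv ι k₂ p p₂ C') :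
    convOp ι (k₁ + k₂) p p₂ = convOp ι k₁ p p₂ + convOp ι k₂ p p₂ := by
  refine ContinuousLinearMap.ext fun v => (h₁.add h₂).convOp_eq hι ?_
  exact ((h₁.isConv v).add_kernel (h₂.isConv v) (h₁.convIntegrable v) (h₂.convIntegrable v)).congr
    .rfl (Lp.coeFn_add _ _).symm

/-- The bound for the output of a convolution, for functions instead of classes. -/
lemma exists_of_memLp (h : HasConv ι k p p₂ C) {u : ℝ → U} (hu : MemLp u p halfLine) :
    ∃ z : ℝ → Y, IsConv ι k u z ∧ MemLp z p₂ halfLine ∧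
      eLpNorm z p₂ halfLine ≤ ENNReal.ofReal C * eLpNorm u p halfLine := by
  obtain ⟨T, hT, hC⟩ := h
  refine ⟨T (hu.toLp u), (hT _).2.congr hu.coeFn_toLp .rfl, Lp.memLp _, ?_⟩
  have h1 : ‖T (hu.toLp u)‖ ≤ C * ‖hu.toLp u‖ :=
    (T.le_opNorm _).trans (by gcongr)
  have h0 : 0 ≤ C := (norm_nonneg T).trans hC
  rw [← Lp.enorm_def, ← eLpNorm_congr_ae hu.coeFn_toLp, ← Lp.enorm_def, ← ofReal_norm,
    ← ofReal_norm, ← ENNReal.ofReal_mul h0]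
  exact ENNReal.ofReal_le_ofReal h1

end HasConv

lemma lintegral_enorm_rpow_ne_top (hp : p ≠ ∞) (v : Lp U p halfLine) :
    ∫⁻ s, ‖v s‖ₑ ^ p.toReal ∂halfLine ≠ ∞ :=
  (lintegral_rpow_enorm_lt_top_of_eLpNorm_lt_top
    (zero_lt_one.trans_le (Fact.out : 1 ≤ p)).ne' hp (Lp.memLp v).2).ne

lemma KernelBound.hasConv [TopologicalSpace.SeparableSpace Y] (hι : DenseRange ι)
    (hp₂ : p₂ ≠ ∞) (hle : p ≤ p₂) {m : ℝ → ℝ≥0∞}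
    (h : KernelBound ι k p.toReal m) (hm : ∫⁻ τ, m τ ≠ ∞) {M : ℝ≥0∞} (hM : ∀ τ, m τ ≤ M) {C : ℝ≥0}
    (hC : M ^ (p₂.toReal / p.toReal - 1) * ∫⁻ τ, m τ ≤ (C : ℝ≥0∞) ^ p₂.toReal) :
    HasConv ι k p p₂ C := by
  have hp : p ≠ ∞ := ne_top_of_le_ne_top hp₂ hle
  have hp0 : 0 < p.toReal := ENNReal.toReal_pos (zero_lt_one.trans_le (Fact.out : 1 ≤ p)).ne' hp
  have hp₂0 : 0 < p₂.toReal :=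
    ENNReal.toReal_pos (zero_lt_one.trans_le (Fact.out : 1 ≤ p₂)).ne' hp₂
  have hle' : p.toReal ≤ p₂.toReal := ENNReal.toReal_mono hp₂ hle
  have hint : ∀ v : Lp U p halfLine, ConvIntegrable k v := fun v =>
    h.convIntegrable hp0 (Lp.aestronglyMeasurable v) hm (lintegral_enorm_rpow_ne_top hp v)
  have key : ∀ v : Lp U p halfLine, ∃ y : Lp Y p₂ halfLine, IsConv ι k v y ∧ ‖y‖ ≤ C * ‖v‖ := by
    intro v
    obtain ⟨y, hym, hyc, hyb⟩ := h.exists_isConv hι hp0 (Lp.aestronglyMeasurable v) hm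
      (lintegral_enorm_rpow_ne_top hp v)
    have hn : eLpNorm y p₂ halfLine ≤ C * eLpNorm v p halfLine := by
      rw [eLpNorm_eq_lintegral_rpow_enorm_toReal
          (zero_lt_one.trans_le (Fact.out : 1 ≤ p₂)).ne' hp₂,
        eLpNorm_eq_lintegral_rpow_enorm_toReal (zero_lt_one.trans_le (Fact.out : 1 ≤ p)).ne' hp,
        one_div p₂.toReal, ENNReal.rpow_inv_le_iff hp₂0, ENNReal.mul_rpow_of_nonneg _ _ hp₂0.le]
      calc ∫⁻ t, ‖y t‖ₑ ^ p₂.toReal ∂halfLine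
          ≤ ∫⁻ t, ((∫⁻ s, m (t - s) * ‖v s‖ₑ ^ p.toReal ∂halfLine) ^ (1 / p.toReal)) ^ p₂.toReal
              ∂halfLine := by
            refine lintegral_mono_ae ?_
            filter_upwards [hyb] with t ht
            exact ENNReal.rpow_le_rpow ht hp₂0.le
        _ ≤ _ := KernelBound.lintegral_rpow_le h.measurable hp0 hle' hM
            (Lp.aestronglyMeasurable v).enorm
        _ ≤ _ := by gcongr
    have hy : MemLp y p₂ halfLine :=
      ⟨hym, hn.trans_lt (ENNReal.mul_lt_top ENNReal.coe_lt_top (Lp.memLp v).2)⟩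
    refine ⟨hy.toLp y, hyc.congr .rfl hy.coeFn_toLp.symm, ?_⟩
    rw [Lp.norm_toLp, Lp.norm_def]
    have := ENNReal.toReal_mono (ENNReal.mul_ne_top ENNReal.coe_ne_top (Lp.memLp v).2.ne) hn
    rwa [ENNReal.toReal_mul, ENNReal.coe_toReal] at this
  choose T hT hTn using key
  have hadd : ∀ v w, T (v + w) = T v + T w := fun v w => Lp.ext <|
    (hT (v + w)).unique hι <| ((hT v).add (hT w) (hint v) (hint w)).congr
      (Lp.coeFn_add v w).symm (Lp.coeFn_add _ _).symm
  have hsmul : ∀ (c : ℂ) v, T (c • v) = c • T v := fun c v => Lp.ext <|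
    (hT (c • v)).unique hι <| ((hT v).smul c).congr
      (Lp.coeFn_smul c v).symm (Lp.coeFn_smul _ _).symm
  let T' : Lp U p halfLine →ₗ[ℂ] Lp Y p₂ halfLine :=
    { toFun := T, map_add' := hadd, map_smul' := hsmul }
  exact ⟨T'.mkContinuous C hTn, fun v => ⟨hint v, hT v⟩,
    LinearMap.mkContinuous_norm_le _ C.coe_nonneg _⟩

/-! ### Adjoints of convolution operators -/

/-- `w` is the image of `y` under the adjoint of the convolution with `k`, formally
`w(s) = ∫_s^∞ k(t-s) y(t) dt`, in the sense of duality with the test controls. -/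
def IsAdj (ι : D →ₗ[ℂ] Y) (k : ℝ → D →ₗ[ℂ] U) (y : ℝ → Y) (w : ℝ → U) : Prop :=
  (∀ a : ℝ, IntegrableOn w (Ioo 0 a)) ∧
  ∀ (u : ℝ → U) (z : ℝ → Y), IsTestControl u → IsConv ι k u z →
    Integrable (fun t => inner ℂ (y t) (z t)) halfLine ∧
    ∫ t, inner ℂ (w t) (u t) ∂halfLine = ∫ t, inner ℂ (y t) (z t) ∂halfLine

variable {y y₁ y₂ : ℝ → Y} {w w₁ w₂ : ℝ → U}

lemma aestronglyMeasurable_of_integrableOn_Ioo (h : ∀ a : ℝ, IntegrableOn w (Ioo 0 a)) :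
    AEStronglyMeasurable w halfLine := by
  have : Ioi (0 : ℝ) = ⋃ n : ℕ, Ioo 0 (n : ℝ) := by
    ext t
    simp only [mem_Ioi, mem_iUnion, mem_Ioo]
    refine ⟨fun ht => ?_, fun ⟨n, hn⟩ => hn.1⟩
    obtain ⟨n, hn⟩ := exists_nat_gt t
    exact ⟨n, ht, hn⟩
  rw [halfLine, this]
  exact aestronglyMeasurable_iUnion_iff.2 fun n => (h n).aestronglyMeasurable

lemma integrable_inner_testControl (h : ∀ a : ℝ, IntegrableOn w (Ioo 0 a)) {u : ℝ → U}
    (hu : IsTestControl u) : Integrable (fun t => inner ℂ (w t) (u t)) halfLine := by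
  obtain ⟨hm, ⟨c, hc⟩, a, ha⟩ := hu
  have h1 : IntegrableOn (fun t => (inner ℂ (w t) (u t) : ℂ)) (Ioo 0 (a + 1)) := by
    refine Integrable.mono' ((h (a + 1)).norm.mul_const c)
      ((h (a + 1)).aestronglyMeasurable.inner hm.aestronglyMeasurable)
      (Eventually.of_forall fun t => ?_)
    exact (norm_inner_le_norm _ _).trans (by gcongr; exact hc t)
  change IntegrableOn (fun t => (inner ℂ (w t) (u t) : ℂ)) (Ioi 0) volume
  refine h1.of_forall_sdiff_eq_zero measurableSet_Ioi fun t ht => ?_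
  have : a < t := by
    by_contra hta
    exact ht.2 ⟨ht.1, by linarith⟩
  rw [ha t this, inner_zero_right]

lemma integrableOn_Ioo_of_memLp (hp1 : 1 ≤ p) (hw : MemLp w p halfLine) (a : ℝ) :
    IntegrableOn w (Ioo 0 a) := by
  have h1 : MemLp w p (volume.restrict (Ioo 0 a)) :=
    hw.mono_measure (Measure.restrict_mono (fun t ht => ht.1) le_rfl)
  exact h1.integrable hp1

namespace IsAdj

lemma congr (h : IsAdj ι k y w) (hy : y =ᵐ[halfLine] y₁) (hw : w =ᵐ[halfLine] w₁) :
    IsAdj ι k y₁ w₁ := by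
  refine ⟨fun a => ?_, fun u z hu hz => ?_⟩
  · refine (h.1 a).congr ?_
    exact ae_restrict_of_ae_restrict_of_subset (fun t (ht : t ∈ Ioo 0 a) => ht.1) hw
  · obtain ⟨h1, h2⟩ := h.2 u z hu hz
    have e1 : (fun t => (inner ℂ (y t) (z t) : ℂ)) =ᵐ[halfLine] fun t => inner ℂ (y₁ t) (z t) := by
      filter_upwards [hy] with t ht; rw [ht]
    have e2 : (fun t => (inner ℂ (w t) (u t) : ℂ)) =ᵐ[halfLine] fun t => inner ℂ (w₁ t) (u t) := by
      filter_upwards [hw] with t ht; rw [ht]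
    exact ⟨h1.congr e1, by rw [← integral_congr_ae e1, ← integral_congr_ae e2, h2]⟩

lemma add (h₁ : IsAdj ι k y₁ w₁) (h₂ : IsAdj ι k y₂ w₂) : IsAdj ι k (y₁ + y₂) (w₁ + w₂) := by
  refine ⟨fun a => (h₁.1 a).add (h₂.1 a), fun u z hu hz => ?_⟩
  obtain ⟨i1, e1⟩ := h₁.2 u z hu hz
  obtain ⟨i2, e2⟩ := h₂.2 u z hu hz
  simp only [Pi.add_apply, inner_add_left]
  exact ⟨i1.add i2, by
    rw [integral_add (integrable_inner_testControl h₁.1 hu) (integrable_inner_testControl h₂.1 hu),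
      integral_add i1 i2, e1, e2]⟩

lemma smul (h : IsAdj ι k y w) (c : ℂ) : IsAdj ι k (c • y) (c • w) := by
  refine ⟨fun a => (h.1 a).smul c, fun u z hu hz => ?_⟩
  obtain ⟨i1, e1⟩ := h.2 u z hu hz
  simp only [Pi.smul_apply, inner_smul_left]
  exact ⟨i1.const_mul _, by rw [integral_const_mul, integral_const_mul, e1]⟩

lemma sub (h₁ : IsAdj ι k y₁ w₁) (h₂ : IsAdj ι k y₂ w₂) : IsAdj ι k (y₁ - y₂) (w₁ - w₂) := by
  have := h₁.add (h₂.smul (-1))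
  simpa [sub_eq_add_neg] using this

/-- The adjoint of the convolution is bounded between the dual exponents. -/
lemma eLpNorm_le [ENNReal.HolderConjugate p p'] [ENNReal.HolderConjugate p₂ p₂']
    (hp₂1 : 1 < p₂) (hp₂ : p₂ ≠ ∞) (hk : HasConv ι k p₂' p' C)
    (hy : AEStronglyMeasurable y halfLine) (h : IsAdj ι k y w) :
    eLpNorm w p₂ halfLine ≤ ENNReal.ofReal C * eLpNorm y p halfLine := by
  refine eLpNorm_le_of_forall_testControl (p' := p₂') hp₂1 hp₂
    (aestronglyMeasurable_of_integrableOn_Ioo h.1) _ fun u hu => ?_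
  obtain ⟨z, hz, hzm, hzn⟩ := hk.exists_of_memLp (hu.memLp p₂')
  rw [(h.2 u z hu hz).2]
  calc _ ≤ eLpNorm y p halfLine * eLpNorm z p' halfLine := enorm_integral_inner_le hy hzm.1
    _ ≤ eLpNorm y p halfLine * (ENNReal.ofReal C * eLpNorm u p₂' halfLine) := by gcongr
    _ = _ := by ring

lemma unique (hk : HasConv ι k 2 2 C) (h₁ : IsAdj ι k y w₁) (h₂ : IsAdj ι k y w₂) :
    w₁ =ᵐ[halfLine] w₂ := by
  have h := h₁.sub h₂
  rw [sub_self] at h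
  have h0 := h.eLpNorm_le (p := 2) (p' := 2) (p₂ := 2) (p₂' := 2) (by norm_num) (by norm_num) hk
    (aestronglyMeasurable_zero : AEStronglyMeasurable (0 : ℝ → Y) halfLine)
  rw [eLpNorm_zero, mul_zero] at h0
  have h3 := (eLpNorm_eq_zero_iff (aestronglyMeasurable_of_integrableOn_Ioo h.1)
    (by norm_num)).1 (le_antisymm h0 zero_le)
  filter_upwards [h3] with t ht
  exact sub_eq_zero.1 ht

lemma add_kernel (h₁ : IsAdj ι k₁ y w₁) (h₂ : IsAdj ι k₂ y w₂) (hι : DenseRange ι)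
    (hk₁ : HasConv ι k₁ 2 2 C) (hk₂ : HasConv ι k₂ 2 2 C') :
    IsAdj ι (k₁ + k₂) y (w₁ + w₂) := by
  refine ⟨fun a => (h₁.1 a).add (h₂.1 a), fun u z hu hz => ?_⟩
  have hu2 := hu.memLp 2
  have c₁ := (hk₁.isConv (hu2.toLp u)).congr hu2.coeFn_toLp .rfl
  have c₂ := (hk₂.isConv (hu2.toLp u)).congr hu2.coeFn_toLp .rfl
  obtain ⟨i1, e1⟩ := h₁.2 u _ hu c₁
  obtain ⟨i2, e2⟩ := h₂.2 u _ hu c₂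
  have hz' := (hk₁.add hk₂).isConv (hu2.toLp u)
  rw [HasConv.convOp_add hι hk₁ hk₂] at hz'
  have hz2 := hz.unique hι (hz'.congr hu2.coeFn_toLp (Lp.coeFn_add _ _))
  have e3 : (fun t => (inner ℂ (y t) (z t) : ℂ)) =ᵐ[halfLine] fun t =>
      inner ℂ (y t) (convOp ι k₁ 2 2 (hu2.toLp u) t)
        + inner ℂ (y t) (convOp ι k₂ 2 2 (hu2.toLp u) t) := by
    filter_upwards [hz2] with t ht
    rw [ht, Pi.add_apply, inner_add_right]
    rfl
  refine ⟨(i1.add i2).congr e3.symm, ?_⟩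
  rw [integral_congr_ae e3, integral_add i1 i2, ← e1, ← e2,
    ← integral_add (integrable_inner_testControl h₁.1 hu) (integrable_inner_testControl h₂.1 hu)]
  simp only [Pi.add_apply, inner_add_left]

end IsAdj

end ConvOp

section AdjOp

variable {D Y U : Type*} [AddCommGroup D] [Module ℂ D]
  [NormedAddCommGroup Y] [InnerProductSpace ℂ Y] [CompleteSpace Y]
  [NormedAddCommGroup U] [InnerProductSpace ℂ U] [CompleteSpace U]
  {ι : D →ₗ[ℂ] Y} {k k₁ k₂ : ℝ → D →ₗ[ℂ] U}
  {p p₂ p' p₂' : ℝ≥0∞} [Fact (1 ≤ p)] [Fact (1 ≤ p₂)] [Fact (1 ≤ p')] [Fact (1 ≤ p₂')]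
  {C C' C₂ C₂' : ℝ}

/-- The adjoint of the convolution with `k` is a bounded operator from `L^p(0,∞;Y)` to
`L^{p₂}(0,∞;U)`, of norm at most `C`. -/
def HasAdj (ι : D →ₗ[ℂ] Y) (k : ℝ → D →ₗ[ℂ] U) (p p₂ : ℝ≥0∞) [Fact (1 ≤ p)] [Fact (1 ≤ p₂)]
    (C : ℝ) : Prop :=
  ∃ T : Lp Y p halfLine →L[ℂ] Lp U p₂ halfLine,
    (∀ y : Lp Y p halfLine, IsAdj ι k y (T y)) ∧ ‖T‖ ≤ C

open Classical in
/-- The adjoint of the convolution with `k` as an operator from `L^p(0,∞;Y)` to `L^{p₂}(0,∞;U)`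
(set to `0` if there is no such bounded operator). -/
def adjConvOp (ι : D →ₗ[ℂ] Y) (k : ℝ → D →ₗ[ℂ] U) (p p₂ : ℝ≥0∞) [Fact (1 ≤ p)] [Fact (1 ≤ p₂)] :
    Lp Y p halfLine →L[ℂ] Lp U p₂ halfLine :=
  if h : ∃ T : Lp Y p halfLine →L[ℂ] Lp U p₂ halfLine,
    ∀ y : Lp Y p halfLine, IsAdj ι k y (T y) then h.choose else 0

namespace HasAdj

lemma isAdj (h : HasAdj ι k p p₂ C) (y : Lp Y p halfLine) :
    IsAdj ι k y (adjConvOp ι k p p₂ y) := by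
  obtain ⟨T, hT, -⟩ := h
  have h : ∃ T : Lp Y p halfLine →L[ℂ] Lp U p₂ halfLine,
    ∀ y : Lp Y p halfLine, IsAdj ι k y (T y) := ⟨T, hT⟩
  rw [adjConvOp, dif_pos h]
  exact h.choose_spec y

lemma adjConvOp_eq (hk : HasConv ι k 2 2 C₂) (h : HasAdj ι k p p₂ C) {y : Lp Y p halfLine}
    {w : Lp U p₂ halfLine} (hw : IsAdj ι k y w) : adjConvOp ι k p p₂ y = w :=
  Lp.ext ((h.isAdj y).unique hk hw)

lemma norm_adjConvOp_le (hk : HasConv ι k 2 2 C₂) (h : HasAdj ι k p p₂ C) :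
    ‖adjConvOp ι k p p₂‖ ≤ C := by
  have h' := h
  obtain ⟨T, hT, hC⟩ := h
  have : adjConvOp ι k p p₂ = T := ContinuousLinearMap.ext fun v => h'.adjConvOp_eq hk (hT v)
  rwa [this]

lemma add (hι : DenseRange ι) (hk₁ : HasConv ι k₁ 2 2 C₂) (hk₂ : HasConv ι k₂ 2 2 C₂')
    (h₁ : HasAdj ι k₁ p p₂ C) (h₂ : HasAdj ι k₂ p p₂ C') :
    HasAdj ι (k₁ + k₂) p p₂ (C + C') := by
  obtain ⟨T₁, hT₁, hC₁⟩ := h₁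
  obtain ⟨T₂, hT₂, hC₂⟩ := h₂
  exact ⟨T₁ + T₂, fun v => ((hT₁ v).add_kernel (hT₂ v) hι hk₁ hk₂).congr .rfl
    (Lp.coeFn_add _ _).symm, (norm_add_le T₁ T₂).trans (add_le_add hC₁ hC₂)⟩

lemma adjConvOp_add (hι : DenseRange ι) (hk₁ : HasConv ι k₁ 2 2 C₂) (hk₂ : HasConv ι k₂ 2 2 C₂')
    (h₁ : HasAdj ι k₁ p p₂ C) (h₂ : HasAdj ι k₂ p p₂ C') :
    adjConvOp ι (k₁ + k₂) p p₂ = adjConvOp ι k₁ p p₂ + adjConvOp ι k₂ p p₂ := by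
  refine ContinuousLinearMap.ext fun v =>
    (h₁.add hι hk₁ hk₂ h₂).adjConvOp_eq (hk₁.add hk₂) ?_
  exact ((h₁.isAdj v).add_kernel (h₂.isAdj v) hι hk₁ hk₂).congr .rfl (Lp.coeFn_add _ _).symm

end HasAdj

/-- In `L^2` the Hilbert space adjoint of the convolution is the adjoint in the sense of duality. -/
lemma IsAdj.of_adjoint (hι : DenseRange ι) (hk : HasConv ι k 2 2 C₂) (y : Lp Y 2 halfLine) :
    IsAdj ι k y ((convOp ι k 2 2).adjoint y) := by
  refine ⟨fun a => integrableOn_Ioo_of_memLp one_le_two (Lp.memLp _) a, fun u z hu hz => ?_⟩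
  have hu2 := hu.memLp 2
  have hz2 := hz.unique hι ((hk.isConv (hu2.toLp u)).congr hu2.coeFn_toLp .rfl)
  have e1 : (fun t => (inner ℂ (y t) (convOp ι k 2 2 (hu2.toLp u) t) : ℂ))
      =ᵐ[halfLine] fun t => inner ℂ (y t) (z t) := by
    filter_upwards [hz2] with t ht; rw [ht]
  have e2 : (fun t => (inner ℂ ((convOp ι k 2 2).adjoint y t) (hu2.toLp u t) : ℂ))
      =ᵐ[halfLine] fun t => inner ℂ ((convOp ι k 2 2).adjoint y t) (u t) := by
    filter_upwards [hu2.coeFn_toLp] with t ht; rw [ht]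
  refine ⟨(integrable_inner_of_memLp (p := 2) (p' := 2) (Lp.memLp _) (Lp.memLp _)).congr e1, ?_⟩
  rw [← integral_congr_ae e1, ← integral_congr_ae e2, ← L2.inner_def, ← L2.inner_def,
    ContinuousLinearMap.adjoint_inner_left]

lemma adjConvOp_two (hι : DenseRange ι) (hk : HasConv ι k 2 2 C₂) (h : HasAdj ι k 2 2 C) :
    adjConvOp ι k 2 2 = (convOp ι k 2 2).adjoint :=
  ContinuousLinearMap.ext fun y => h.adjConvOp_eq hk (IsAdj.of_adjoint hι hk y)

lemma norm_le_of_isAdj [ENNReal.HolderConjugate p p'] [ENNReal.HolderConjugate p₂ p₂']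
    (hp₂1 : 1 < p₂) (hp₂ : p₂ ≠ ∞) (hk : HasConv ι k p₂' p' C) (hC : 0 ≤ C)
    {y : Lp Y p halfLine} {w : Lp U p₂ halfLine} (h : IsAdj ι k y w) : ‖w‖ ≤ C * ‖y‖ := by
  have h1 := h.eLpNorm_le (p := p) (p' := p') (p₂' := p₂') hp₂1 hp₂ hk (Lp.aestronglyMeasurable y)
  have h2 := ENNReal.toReal_mono (ENNReal.mul_ne_top ENNReal.ofReal_ne_top (Lp.memLp y).2.ne) h1
  rwa [ENNReal.toReal_mul, ENNReal.toReal_ofReal hC, ← Lp.norm_def, ← Lp.norm_def] at h2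

lemma tendsto_integral_inner {α X : Type*} {mα : MeasurableSpace α} {μ : Measure α}
    [NormedAddCommGroup X] [InnerProductSpace ℂ X] {a a' : ℝ≥0∞} [Fact (1 ≤ a)]
    [ENNReal.HolderConjugate a a'] {f : ℕ → Lp X a μ} {f₀ : Lp X a μ} {g : α → X}
    (hg : MemLp g a' μ) (hf : Tendsto f atTop (𝓝 f₀)) :
    Tendsto (fun n => ∫ t, inner ℂ (f n t) (g t) ∂μ) atTop
      (𝓝 (∫ t, inner ℂ (f₀ t) (g t) ∂μ)) := by
  rw [tendsto_iff_edist_tendsto_0] at hf ⊢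
  have h0 : Tendsto (fun n => edist (f n) f₀ * eLpNorm g a' μ) atTop (𝓝 0) := by
    have := ENNReal.Tendsto.mul_const hf (Or.inr hg.2.ne)
    rwa [zero_mul] at this
  refine tendsto_of_tendsto_of_tendsto_of_le_of_le tendsto_const_nhds h0
    (fun n => zero_le) fun n => ?_
  have i1 := integrable_inner_of_memLp (p := a) (p' := a') (Lp.memLp (f n)) hg
  have i2 := integrable_inner_of_memLp (p := a) (p' := a') (Lp.memLp f₀) hg
  rw [edist_eq_enorm_sub, ← integral_sub i1 i2, Lp.edist_def]
  simp only [← inner_sub_left]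
  exact enorm_integral_inner_le ((Lp.memLp (f n)).sub (Lp.memLp f₀)).1 hg.1

/-- If the convolution with `k` is bounded from `L^{p₂'}` to `L^{p'}` and in `L^2`, its adjoint is
bounded from `L^p` to `L^{p₂}`. On simple functions the adjoint is the one of `L^2`, and testing
bounds its norm; all of `L^p` is reached by density. -/
lemma HasConv.hasAdj [ENNReal.HolderConjugate p p'] [ENNReal.HolderConjugate p₂ p₂']
    (hι : DenseRange ι) (hp : p ≠ ∞) (hp₂1 : 1 < p₂) (hp₂ : p₂ ≠ ∞)
    (hk : HasConv ι k p₂' p' C) (hk₂ : HasConv ι k 2 2 C₂) : HasAdj ι k p p₂ C := by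
  have hC : 0 ≤ C := by
    obtain ⟨T, -, hT⟩ := hk
    exact (norm_nonneg T).trans hT
  have key : ∀ y : Lp Y p halfLine, ∃ w : Lp U p₂ halfLine, IsAdj ι k y w := by
    refine Lp.induction hp _ ?_ ?_ ?_
    · intro c s hs hμs
      have hp1 : MemLp (s.indicator fun _ => c) p halfLine :=
        memLp_indicator_const p hs c (Or.inr hμs.ne)
      have h2 : MemLp (s.indicator fun _ => c) 2 halfLine :=
        memLp_indicator_const 2 hs c (Or.inr hμs.ne)
      have hadj := (IsAdj.of_adjoint hι hk₂ (h2.toLp _)).congr h2.coeFn_toLp .rfl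
      have hn := hadj.eLpNorm_le (p := p) (p' := p') (p₂' := p₂') hp₂1 hp₂ hk hp1.1
      have hw : MemLp ((convOp ι k 2 2).adjoint (h2.toLp _)) p₂ halfLine :=
        ⟨Lp.aestronglyMeasurable _,
          hn.trans_lt (ENNReal.mul_lt_top ENNReal.ofReal_lt_top hp1.2)⟩
      refine ⟨hw.toLp _, hadj.congr ?_ hw.coeFn_toLp.symm⟩
      exact (indicatorConstLp_coeFn (p := p) (hs := hs) (hμs := hμs.ne) (c := c)).symm
    · rintro f g hf hg - ⟨w₁, h₁⟩ ⟨w₂, h₂⟩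
      exact ⟨w₁ + w₂, (h₁.add h₂).congr (Lp.coeFn_add _ _).symm (Lp.coeFn_add _ _).symm⟩
    · refine IsSeqClosed.isClosed fun y y₀ hy hlim => ?_
      choose w hw using hy
      have hcau : CauchySeq w := by
        rw [Metric.cauchySeq_iff]
        intro e he
        obtain ⟨N, hN⟩ := Metric.cauchySeq_iff.1 hlim.cauchySeq (e / (C + 1)) (by positivity)
        refine ⟨N, fun m hm n hn => ?_⟩
        have h1 := hN m hm n hn
        have h2 : IsAdj ι k (y m - y n : Lp Y p halfLine) (w m - w n : Lp U p₂ halfLine) :=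
          ((hw m).sub (hw n)).congr (Lp.coeFn_sub _ _).symm (Lp.coeFn_sub _ _).symm
        have h3 := norm_le_of_isAdj (p' := p') (p₂' := p₂') hp₂1 hp₂ hk hC h2
        rw [dist_eq_norm] at h1 ⊢
        rw [lt_div_iff₀ (by positivity)] at h1
        nlinarith [norm_nonneg (y m - y n)]
      obtain ⟨w₀, hw₀⟩ := cauchySeq_tendsto_of_complete hcau
      refine ⟨w₀, fun a => integrableOn_Ioo_of_memLp Fact.out (Lp.memLp _) a, fun u z hu hz => ?_⟩
      have hup := hu.memLp p₂'
      obtain ⟨z', hz', hzm', -⟩ := hk.exists_of_memLp hup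
      have hzm : MemLp z p' halfLine := hzm'.ae_eq (hz'.unique hι hz)
      refine ⟨integrable_inner_of_memLp (p := p) (p' := p') (Lp.memLp y₀) hzm, ?_⟩
      refine tendsto_nhds_unique (tendsto_integral_inner hup hw₀) ?_
      refine (tendsto_integral_inner hzm hlim).congr fun n => ?_
      exact ((hw n).2 u z hu hz).2.symm
  choose T hT using key
  have hadd : ∀ v w, T (v + w) = T v + T w := fun v w => Lp.ext <|
    (hT (v + w)).unique hk₂ <| ((hT v).add (hT w)).congr
      (Lp.coeFn_add v w).symm (Lp.coeFn_add _ _).symm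
  have hsmul : ∀ (c : ℂ) v, T (c • v) = c • T v := fun c v => Lp.ext <|
    (hT (c • v)).unique hk₂ <| ((hT v).smul c).congr
      (Lp.coeFn_smul c v).symm (Lp.coeFn_smul _ _).symm
  let T' : Lp Y p halfLine →ₗ[ℂ] Lp U p₂ halfLine :=
    { toFun := T, map_add' := hadd, map_smul' := hsmul }
  exact ⟨T'.mkContinuous C fun y =>
      norm_le_of_isAdj (p' := p') (p₂' := p₂') hp₂1 hp₂ hk hC (hT y),
    hT, LinearMap.mkContinuous_norm_le _ hC _⟩

end AdjOp

/-! ### Exponential weights -/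

section Weight

/-- The function `t ↦ e^{θt} f(t)`. -/
def expMul {X : Type*} [NormedAddCommGroup X] [InnerProductSpace ℂ X] (θ : ℝ) (f : ℝ → X) :
    ℝ → X :=
  fun t => Real.exp (θ * t) • f t

variable {D Y U : Type*} [AddCommGroup D] [Module ℂ D]
  [NormedAddCommGroup Y] [InnerProductSpace ℂ Y] [CompleteSpace Y]
  [NormedAddCommGroup U] [InnerProductSpace ℂ U] [CompleteSpace U]
  {X : Type*} [NormedAddCommGroup X] [InnerProductSpace ℂ X]

/-- The kernel `τ ↦ e^{θτ} k(τ)`. -/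
def expKernel (θ : ℝ) (k : ℝ → D →ₗ[ℂ] U) : ℝ → D →ₗ[ℂ] U :=
  fun τ => ((Real.exp (θ * τ) : ℝ) : ℂ) • k τ

lemma expMul_expMul (θ σ : ℝ) (f : ℝ → X) : expMul θ (expMul σ f) = expMul (θ + σ) f := by
  funext t
  simp only [expMul, smul_smul, ← Real.exp_add, add_mul]

lemma expMul_zero (f : ℝ → X) : expMul 0 f = f := by
  funext t; simp [expMul]

lemma expMul_congr {μ : Measure ℝ} (θ : ℝ) {f g : ℝ → X} (h : f =ᵐ[μ] g) :
    expMul θ f =ᵐ[μ] expMul θ g := by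
  filter_upwards [h] with t ht
  simp only [expMul, ht]

lemma expMul_cancel {μ : Measure ℝ} (θ : ℝ) {f g : ℝ → X} (h : expMul θ f =ᵐ[μ] expMul θ g) :
    f =ᵐ[μ] g := by
  have := expMul_congr (-θ) h
  rwa [expMul_expMul, expMul_expMul, neg_add_cancel, expMul_zero, expMul_zero] at this

lemma expKernel_zero (k : ℝ → D →ₗ[ℂ] U) : expKernel 0 k = k := by
  funext τ; simp [expKernel]

lemma expKernel_add (θ : ℝ) (k₁ k₂ : ℝ → D →ₗ[ℂ] U) :
    expKernel θ (k₁ + k₂) = expKernel θ k₁ + expKernel θ k₂ := by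
  funext τ; simp [expKernel]

lemma continuous_exp_mul (θ : ℝ) : Continuous fun t : ℝ => Real.exp (θ * t) := by fun_prop

lemma aestronglyMeasurable_expMul {μ : Measure ℝ} (θ : ℝ) {f : ℝ → X}
    (hf : AEStronglyMeasurable f μ) : AEStronglyMeasurable (expMul θ f) μ :=
  (continuous_exp_mul θ).aestronglyMeasurable.smul hf

lemma inner_real_smul_right (c : ℝ) (x y : X) : inner ℂ x (c • y) = (c : ℂ) * inner ℂ x y := by
  rw [← Complex.coe_smul, inner_smul_right]

lemma inner_real_smul_left (c : ℝ) (x y : X) : inner ℂ (c • x) y = (c : ℂ) * inner ℂ x y := by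
  rw [← Complex.coe_smul, inner_smul_left, Complex.conj_ofReal]

lemma inner_expKernel (θ τ : ℝ) (k : ℝ → D →ₗ[ℂ] U) (x : D) (u : U) :
    inner ℂ (expKernel θ k τ x) u = ((Real.exp (θ * τ) : ℝ) : ℂ) * inner ℂ (k τ x) u := by
  rw [expKernel, LinearMap.smul_apply, inner_smul_left, Complex.conj_ofReal]

variable {ι : D →ₗ[ℂ] Y} {k : ℝ → D →ₗ[ℂ] U}

lemma isConv_expKernel (θ : ℝ) {v : ℝ → U} {y : ℝ → Y} :
    IsConv ι (expKernel θ k) v y ↔ IsConv ι k (expMul (-θ) v) (expMul (-θ) y) := by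
  refine eventually_congr (Eventually.of_forall fun t => forall_congr' fun x => ?_)
  have e1 : ∀ s, (inner ℂ (expKernel θ k (t - s) x) (v s) : ℂ)
      = ((Real.exp (θ * t) : ℝ) : ℂ) * inner ℂ (k (t - s) x) (expMul (-θ) v s) := by
    intro s
    rw [inner_expKernel, expMul, inner_real_smul_right, ← mul_assoc, ← Complex.ofReal_mul,
      ← Real.exp_add]
    congr 4; ring
  have e2 : (inner ℂ (ι x) (y t) : ℂ)
      = ((Real.exp (θ * t) : ℝ) : ℂ) * inner ℂ (ι x) (expMul (-θ) y t) := by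
    rw [expMul, inner_real_smul_right, ← mul_assoc, ← Complex.ofReal_mul, ← Real.exp_add]
    simp
  simp only [e1, integral_const_mul]
  rw [e2]
  have h0 : ((Real.exp (θ * t) : ℝ) : ℂ) ≠ 0 := Complex.ofReal_ne_zero.2 (Real.exp_pos _).ne'
  exact mul_right_inj' h0

lemma isAdj_expMul (θ : ℝ) {y : ℝ → Y} {w : ℝ → U} (h : IsAdj ι (expKernel (-θ) k) y w) :
    IsAdj ι k (expMul (-θ) y) (expMul (-θ) w) := by
  refine ⟨fun a => ?_, fun u z hu hz => ?_⟩
  · have h1 : IntegrableOn w (Icc 0 a) := by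
      rw [integrableOn_Icc_iff_integrableOn_Ioo]; exact h.1 a
    have h2 := h1.continuousOn_smul (f := fun t => Real.exp (-θ * t))
      (continuous_exp_mul (-θ)).continuousOn isCompact_Icc
    exact h2.mono_set Ioo_subset_Icc_self
  · -- the factor `e^{-θt}` is moved to the test control, which is cut off for `t ≤ 0`
    let u' : ℝ → U := (Ioi 0).indicator (expMul (-θ) u)
    have hu' : IsTestControl u' := by
      obtain ⟨hm, ⟨c, hc⟩, a, ha⟩ := hu
      refine ⟨?_, ⟨Real.exp (|θ| * |a|) * c, fun t => ?_⟩, a, fun t ht => ?_⟩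
      · exact ((continuous_exp_mul (-θ)).stronglyMeasurable.smul hm).indicator measurableSet_Ioi
      · have hc0 : 0 ≤ c := (norm_nonneg _).trans (hc 0)
        by_cases ht : t ∈ Ioi (0 : ℝ)
        · simp only [u', indicator_of_mem ht, expMul, norm_smul, Real.norm_eq_abs, Real.abs_exp]
          by_cases hta : a < t
          · rw [ha t hta, norm_zero, mul_zero]; positivity
          · have h1 : -θ * t ≤ |θ| * |a| := by
              have h2 : -θ ≤ |θ| := neg_le_abs θ
              have h3 : t ≤ |a| := (not_lt.1 hta).trans (le_abs_self a)
              have h4 : (0 : ℝ) < t := ht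
              calc -θ * t ≤ |θ| * t := by gcongr
                _ ≤ _ := by gcongr
            gcongr
            exact hc t
        · simp only [u', indicator_of_notMem ht, norm_zero]; positivity
      · by_cases ht' : t ∈ Ioi (0 : ℝ)
        · simp only [u', indicator_of_mem ht', expMul, ha t ht, smul_zero]
        · exact indicator_of_notMem ht' _
    have hae : u' =ᵐ[halfLine] expMul (-θ) u := by
      filter_upwards [ae_restrict_mem measurableSet_Ioi] with t ht
      exact indicator_of_mem ht _
    have hz' : IsConv ι (expKernel (-θ) k) u' (expMul (-θ) z) := by
      rw [isConv_expKernel, expMul_expMul, neg_neg, add_neg_cancel, expMul_zero]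
      refine hz.congr ?_ .rfl
      have := expMul_congr θ hae
      rw [expMul_expMul, add_neg_cancel, expMul_zero] at this
      exact this.symm
    obtain ⟨h1, h2⟩ := h.2 u' _ hu' hz'
    have e1 : ∀ t, (inner ℂ (expMul (-θ) y t) (z t) : ℂ) = inner ℂ (y t) (expMul (-θ) z t) := by
      intro t
      simp only [expMul, inner_real_smul_left, inner_real_smul_right]
    have e2 : (fun t => (inner ℂ (w t) (u' t) : ℂ))
        =ᵐ[halfLine] fun t => inner ℂ (expMul (-θ) w t) (u t) := by
      filter_upwards [hae] with t ht
      simp only [ht, expMul, inner_real_smul_left, inner_real_smul_right]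
    simp only [e1]
    exact ⟨h1, by rw [← integral_congr_ae e2, h2]⟩

end Weight

/-! ### The operator `Λ` on weighted spaces -/

section Lam

variable {D Y U : Type*} [AddCommGroup D] [Module ℂ D]
  [NormedAddCommGroup Y] [InnerProductSpace ℂ Y] [CompleteSpace Y]
  [NormedAddCommGroup U] [InnerProductSpace ℂ U] [CompleteSpace U]

/-- `h = (I + L* Q L) f`, where `L` is the convolution with `k`. -/
def IsLam (ι : D →ₗ[ℂ] Y) (k : ℝ → D →ₗ[ℂ] U) (Q : Y →L[ℂ] Y) (f h : ℝ → U) : Prop :=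
  ∃ (y : ℝ → Y) (w : ℝ → U), IsConv ι k f y ∧ IsAdj ι k (fun t => Q (y t)) w ∧
    ∀ᵐ t ∂halfLine, h t = f t + w t

/-- The operator `L* Q L` in `L^p` with the weight `e^{θt}`, transported to `L^p` without weight.
Conjugation with `e^{θt}` turns the kernel of `L` into `e^{θτ} k(τ)` and the one of `L*` into
`e^{-θτ} k(τ)`. -/
def quadOp (ι : D →ₗ[ℂ] Y) (k : ℝ → D →ₗ[ℂ] U) (Q : Y →L[ℂ] Y) (p : ℝ≥0∞) [Fact (1 ≤ p)]
    (θ : ℝ) : Lp U p halfLine →L[ℂ] Lp U p halfLine :=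
  adjConvOp ι (expKernel (-θ) k) p p ∘L Q.compLpL p halfLine ∘L convOp ι (expKernel θ k) p p

variable {ι : D →ₗ[ℂ] Y} {k : ℝ → D →ₗ[ℂ] U} {Q : Y →L[ℂ] Y}

lemma IsLam.congr {f f₁ h h₁ : ℝ → U} (H : IsLam ι k Q f h) (hf : f =ᵐ[halfLine] f₁)
    (hh : h =ᵐ[halfLine] h₁) : IsLam ι k Q f₁ h₁ := by
  obtain ⟨y, w, hy, hw, hs⟩ := H
  refine ⟨y, w, hy.congr hf .rfl, hw, ?_⟩
  filter_upwards [hs, hf, hh] with t h1 h2 h3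
  rw [← h2, ← h3, h1]

lemma IsLam.unique (hι : DenseRange ι) {C : ℝ} (hk : HasConv ι k 2 2 C) {f h₁ h₂ : ℝ → U}
    (H₁ : IsLam ι k Q f h₁) (H₂ : IsLam ι k Q f h₂) : h₁ =ᵐ[halfLine] h₂ := by
  obtain ⟨y₁, w₁, hy₁, hw₁, hs₁⟩ := H₁
  obtain ⟨y₂, w₂, hy₂, hw₂, hs₂⟩ := H₂
  have hy := hy₁.unique hι hy₂
  have hw := (hw₁.congr (y₁ := fun t => Q (y₂ t)) (by
    filter_upwards [hy] with t ht; rw [ht]) .rfl).unique hk hw₂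
  filter_upwards [hs₁, hs₂, hw] with t h1 h2 h3
  rw [h1, h2, h3]

variable {p p₂ : ℝ≥0∞} [Fact (1 ≤ p)] [Fact (1 ≤ p₂)] {θ θ₂ C C' C₂ C₂' C₀ : ℝ}

lemma isLam_expMul (hL : HasConv ι (expKernel θ k) p p C)
    (hA : HasAdj ι (expKernel (-θ) k) p p C') (f : Lp U p halfLine) :
    IsLam ι k Q (expMul (-θ) f) (expMul (-θ) ((1 + quadOp ι k Q p θ) f : Lp U p halfLine)) := by
  let y := convOp ι (expKernel θ k) p p f
  let w := quadOp ι k Q p θ f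
  refine ⟨expMul (-θ) y, expMul (-θ) w, (isConv_expKernel θ).1 (hL.isConv f), ?_, ?_⟩
  · have h1 : IsAdj ι (expKernel (-θ) k) (Q.compLpL p halfLine y : Lp Y p halfLine) w :=
      hA.isAdj _
    have h2 := isAdj_expMul θ h1
    refine h2.congr ?_ .rfl
    filter_upwards [Q.coeFn_compLpL (p := p) (μ := halfLine) y] with t ht
    simp only [expMul, ht]
    exact (Q.map_smul_of_tower _ _).symm
  · have e : (1 + quadOp ι k Q p θ) f = f + w := rfl
    rw [e]
    filter_upwards [Lp.coeFn_add f w] with t ht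
    simp only [expMul, ht, Pi.add_apply, smul_add]

lemma isLam_expMul_iff (hι : DenseRange ι) (hk : HasConv ι k 2 2 C₀)
    (hL : HasConv ι (expKernel θ k) p p C)
    (hA : HasAdj ι (expKernel (-θ) k) p p C') (f h : Lp U p halfLine) :
    (1 + quadOp ι k Q p θ) f = h ↔ IsLam ι k Q (expMul (-θ) f) (expMul (-θ) h) := by
  have h0 := isLam_expMul (Q := Q) hL hA f
  refine ⟨fun e => e ▸ h0, fun H => Lp.ext (expMul_cancel (-θ) (h0.unique hι hk H))⟩

/-- `I + L* Q L` acts consistently on the different weighted spaces. -/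
lemma lam_consistent (hι : DenseRange ι) (hk : HasConv ι k 2 2 C₀)
    (hL : HasConv ι (expKernel θ k) p p C) (hA : HasAdj ι (expKernel (-θ) k) p p C')
    (hL₂ : HasConv ι (expKernel θ₂ k) p₂ p₂ C₂) (hA₂ : HasAdj ι (expKernel (-θ₂) k) p₂ p₂ C₂')
    {f : Lp U p halfLine} {f₂ : Lp U p₂ halfLine}
    (hf : expMul (-θ) f =ᵐ[halfLine] expMul (-θ₂) f₂) :
    expMul (-θ) ((1 + quadOp ι k Q p θ) f : Lp U p halfLine)
      =ᵐ[halfLine] expMul (-θ₂) ((1 + quadOp ι k Q p₂ θ₂) f₂ : Lp U p₂ halfLine) :=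
  ((isLam_expMul (Q := Q) hL hA f).congr hf .rfl).unique hι hk (isLam_expMul hL₂ hA₂ f₂)

end Lam

/-! ### Bounded operators between weighted spaces -/

section Weighted

variable {X : Type*} [NormedAddCommGroup X] [InnerProductSpace ℂ X] {p : ℝ≥0∞} [Fact (1 ≤ p)]

/-- Multiplication with `e^{δt}` identifies `L^p_δ(0,∞;X)` with `L^p(0,∞;X)`. -/
def weightedEquiv (p : ℝ≥0∞) (δ : ℝ) : WeightedLp X p δ ≃ₗ[ℂ] Lp X p halfLine where
  toFun f := MemLp.toLp (expMul δ (f : ℝ →ₘ[halfLine] X)) f.2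
  map_add' f g := by
    refine Lp.ext ?_
    refine (MemLp.coeFn_toLp _).trans (.trans ?_ (Lp.coeFn_add _ _).symm)
    filter_upwards [MemLp.coeFn_toLp f.2, MemLp.coeFn_toLp g.2,
      AEEqFun.coeFn_add (f : ℝ →ₘ[halfLine] X) g] with t h1 h2 h3
    simp only [Pi.add_apply] at h3 ⊢
    change _ = MemLp.toLp _ f.2 t + MemLp.toLp _ g.2 t
    rw [h1, h2, expMul, Submodule.coe_add, h3, smul_add]
  map_smul' c f := by
    refine Lp.ext ?_
    refine (MemLp.coeFn_toLp _).trans (.trans ?_ (Lp.coeFn_smul _ _).symm)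
    filter_upwards [MemLp.coeFn_toLp f.2,
      AEEqFun.coeFn_smul c (f : ℝ →ₘ[halfLine] X)] with t h1 h3
    simp only [Pi.smul_apply, RingHom.id_apply] at h3 ⊢
    change _ = c • MemLp.toLp _ f.2 t
    rw [h1, expMul, Submodule.coe_smul, h3, smul_comm]
  invFun g := ⟨AEEqFun.mk (expMul (-δ) g) (aestronglyMeasurable_expMul _ (Lp.aestronglyMeasurable g)),
    by
      refine (Lp.memLp g).ae_eq ?_
      have := expMul_congr δ (AEEqFun.coeFn_mk (expMul (-δ) g)
        (aestronglyMeasurable_expMul _ (Lp.aestronglyMeasurable g)))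
      rw [expMul_expMul, add_neg_cancel, expMul_zero] at this
      exact this.symm⟩
  left_inv f := by
    refine Subtype.ext (AEEqFun.ext ?_)
    refine (AEEqFun.coeFn_mk _ _).trans ?_
    have := expMul_congr (-δ) (MemLp.coeFn_toLp f.2)
    refine this.trans ?_
    change expMul (-δ) (expMul δ _) =ᵐ[halfLine] _
    rw [expMul_expMul, neg_add_cancel, expMul_zero]
  right_inv g := by
    refine Lp.ext ((MemLp.coeFn_toLp _).trans ?_)
    have := expMul_congr δ (AEEqFun.coeFn_mk (expMul (-δ) g)
      (aestronglyMeasurable_expMul _ (Lp.aestronglyMeasurable g)))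
    rwa [expMul_expMul, add_neg_cancel, expMul_zero] at this

lemma weightedEquiv_ae (δ : ℝ) (f : WeightedLp X p δ) :
    expMul (-δ) (weightedEquiv p δ f) =ᵐ[halfLine] (f : ℝ →ₘ[halfLine] X) := by
  have := expMul_congr (-δ) (MemLp.coeFn_toLp f.2)
  refine this.trans ?_
  change expMul (-δ) (expMul δ _) =ᵐ[halfLine] _
  rw [expMul_expMul, neg_add_cancel, expMul_zero]

lemma weightedNorm_eq (δ : ℝ) (f : WeightedLp X p δ) :
    weightedNorm p δ (f : ℝ →ₘ[halfLine] X) = ‖weightedEquiv p δ f‖ₑ := by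
  rw [Lp.enorm_def]
  exact (eLpNorm_congr_ae (MemLp.coeFn_toLp f.2)).symm

lemma isBoundedOperator_of_clm {K : (ℝ → X) → (ℝ → X) → Prop}
    (hK : ∀ f f₁ g g₁ : ℝ → X, f =ᵐ[halfLine] f₁ → g =ᵐ[halfLine] g₁ → K f g → K f₁ g₁)
    {δ θ : ℝ} (T : Lp X p halfLine →L[ℂ] Lp X p halfLine)
    (hT : ∀ f g : Lp X p halfLine, T f = g ↔ K (expMul (-δ) f) (expMul (-θ) g)) :
    IsBoundedOperator K p δ θ := by
  refine ⟨(weightedEquiv p θ).symm.toLinearMap ∘ₗ T.toLinearMap ∘ₗ (weightedEquiv p δ).toLinearMap,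
    fun f g => ?_, ‖T‖₊, fun f => ?_⟩
  · have h1 : (weightedEquiv p θ).symm (T (weightedEquiv p δ f)) = g
        ↔ T (weightedEquiv p δ f) = weightedEquiv p θ g := (weightedEquiv p θ).symm_apply_eq
    refine h1.trans ((hT _ _).trans ⟨?_, ?_⟩)
    · exact hK _ _ _ _ (weightedEquiv_ae δ f) (weightedEquiv_ae θ g)
    · exact hK _ _ _ _ (weightedEquiv_ae δ f).symm (weightedEquiv_ae θ g).symm
  · rw [weightedNorm_eq, weightedNorm_eq]
    change ‖weightedEquiv p θ ((weightedEquiv p θ).symm (T (weightedEquiv p δ f)))‖ₑ ≤ _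
    rw [LinearEquiv.apply_symm_apply]
    exact T.le_opENorm _

end Weighted

/-! ### Inversion of `Λ` -/

section Decay

variable {X : Type*} [NormedAddCommGroup X] [InnerProductSpace ℂ X]

lemma memLp_exp_neg {σ : ℝ} (hσ : 0 < σ) (r : ℝ≥0∞) :
    MemLp (fun t : ℝ => ((Real.exp (-σ * t) : ℝ) : ℂ)) r halfLine := by
  have hc : Continuous fun t : ℝ => ((Real.exp (-σ * t) : ℝ) : ℂ) := by fun_prop
  rcases eq_or_ne r ∞ with rfl | hr
  · refine memLp_top_of_bound hc.aestronglyMeasurable 1 ?_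
    filter_upwards [ae_restrict_mem measurableSet_Ioi] with t ht
    have : (0 : ℝ) < t := ht
    rw [Complex.norm_real, Real.norm_eq_abs, Real.abs_exp, Real.exp_le_one_iff]
    nlinarith
  rcases eq_or_ne r 0 with rfl | hr0
  · exact memLp_zero_iff_aestronglyMeasurable.2 hc.aestronglyMeasurable
  · rw [← integrable_norm_rpow_iff hc.aestronglyMeasurable hr0 hr]
    have h0 : 0 < σ * r.toReal := mul_pos hσ (ENNReal.toReal_pos hr0 hr)
    refine (exp_neg_integrableOn_Ioi 0 h0).congr (Eventually.of_forall fun t => ?_)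
    simp only [Complex.norm_real, Real.norm_eq_abs, Real.abs_exp]
    rw [← Real.exp_mul]
    congr 1; ring

/-- Multiplication with `e^{-σt}`, `σ > 0`, maps `L^p(0,∞)` to `L^{p₂}(0,∞)` for `p₂ ≤ p`. -/
lemma exists_clm_expMul (X : Type*) [NormedAddCommGroup X] [InnerProductSpace ℂ X]
    {σ : ℝ} (hσ : 0 < σ) (r p p₂ : ℝ≥0∞) [Fact (1 ≤ r)] [Fact (1 ≤ p)]
    [Fact (1 ≤ p₂)] [ENNReal.HolderTriple r p p₂] :
    ∃ M : Lp X p halfLine →L[ℂ] Lp X p₂ halfLine,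
      ∀ f : Lp X p halfLine, M f =ᵐ[halfLine] expMul (-σ) f := by
  refine ⟨(ContinuousLinearMap.lsmul ℂ ℂ).holderL halfLine r p p₂ ((memLp_exp_neg hσ r).toLp _),
    fun f => ?_⟩
  refine ((ContinuousLinearMap.lsmul ℂ ℂ).coeFn_holder
    ((memLp_exp_neg hσ r).toLp _) f (r := p₂)).trans ?_
  filter_upwards [(memLp_exp_neg hσ r).coeFn_toLp] with t ht
  rw [ht, ContinuousLinearMap.lsmul_apply, expMul, Complex.coe_smul]

end Decay

section Inversion

variable {D Y U : Type*} [AddCommGroup D] [Module ℂ D]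
  [NormedAddCommGroup Y] [InnerProductSpace ℂ Y] [CompleteSpace Y]
  [NormedAddCommGroup U] [InnerProductSpace ℂ U] [CompleteSpace U]

/-- The kernels `ks` and `kb` split the kernel of an input-to-state map into a part of small norm
in `L^q`, `L^{q'}` and `L^2`, and a part which raises the integrability from `q` to `2` and from
`2` to `q'`. All bounds are uniform in the exponential weights `e^{θt}`, `|θ| ≤ θ₀`. The unweighted
operator is the limit in the operator norm of the weighted ones as `θ → 0`. -/
structure Splitting (ι : D →ₗ[ℂ] Y) (ks kb : ℝ → D →ₗ[ℂ] U) (q q' : ℝ≥0∞) [Fact (1 ≤ q)]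
    [Fact (1 ≤ q')] (θ₀ c C : ℝ) : Prop where
  dense : DenseRange ι
  pos : 0 < θ₀
  small_q : ∀ θ, |θ| ≤ θ₀ → HasConv ι (expKernel θ ks) q q c
  small_q' : ∀ θ, |θ| ≤ θ₀ → HasConv ι (expKernel θ ks) q' q' c
  small_two : ∀ θ, |θ| ≤ θ₀ → HasConv ι (expKernel θ ks) 2 2 c
  reg_q : ∀ θ, |θ| ≤ θ₀ → HasConv ι (expKernel θ kb) q q C
  reg_q' : ∀ θ, |θ| ≤ θ₀ → HasConv ι (expKernel θ kb) q' q' C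
  reg_two : ∀ θ, |θ| ≤ θ₀ → HasConv ι (expKernel θ kb) 2 2 C
  reg_q_two : ∀ θ, |θ| ≤ θ₀ → HasConv ι (expKernel θ kb) q 2 C
  reg_two_q' : ∀ θ, |θ| ≤ θ₀ → HasConv ι (expKernel θ kb) 2 q' C
  continuous_zero : ∀ e > 0, ∃ θ₁ > 0, ∀ θ, |θ| ≤ θ₁ →
    HasConv ι (expKernel θ (ks + kb) - (ks + kb)) 2 2 e

variable {ι : D →ₗ[ℂ] Y} {k ks kb : ℝ → D →ₗ[ℂ] U} {Q : Y →L[ℂ] Y}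
  {p q q' : ℝ≥0∞} [Fact (1 ≤ p)] [Fact (1 ≤ q)] [Fact (1 ≤ q')]
  {θ θ₀ c C C' C₀ : ℝ}

lemma norm_quadOp_le (hι : DenseRange ι) (hL : HasConv ι (expKernel θ k) p p C)
    (hA₂ : HasConv ι (expKernel (-θ) k) 2 2 C₀)
    (hA : HasAdj ι (expKernel (-θ) k) p p C') : ‖quadOp ι k Q p θ‖ ≤ C' * (‖Q‖ * C) := by
  have h1 := hL.norm_convOp_le hι
  have h2 := hA.norm_adjConvOp_le hA₂
  have h3 : ‖Q.compLpL p (halfLine)‖ ≤ ‖Q‖ := Q.norm_compLpL_le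
  have hC' : 0 ≤ C' := (norm_nonneg (adjConvOp ι (expKernel (-θ) k) p p)).trans h2
  calc ‖quadOp ι k Q p θ‖
      ≤ ‖adjConvOp ι (expKernel (-θ) k) p p‖
          * (‖Q.compLpL p halfLine‖ * ‖convOp ι (expKernel θ k) p p‖) :=
        (ContinuousLinearMap.opNorm_comp_le _ _).trans
          (mul_le_mul_of_nonneg_left (ContinuousLinearMap.opNorm_comp_le _ _) (norm_nonneg _))
    _ ≤ _ := by gcongr

lemma isUnit_one_add_of_norm_lt_one {E : Type*} [NormedAddCommGroup E] [NormedSpace ℂ E]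
    [CompleteSpace E] {a : E →L[ℂ] E} (h : ‖a‖ < 1) : IsUnit (1 + a) := by
  have := isUnit_one_sub_of_norm_lt_one (x := -a) (by rwa [norm_neg])
  rwa [sub_neg_eq_add] at this

/-- `lam_consistent` in a form that compares the weights `θ` and `θ₂` directly. -/
lemma lam_expMul {p₂ : ℝ≥0∞} [Fact (1 ≤ p₂)] {θ₂ C₂ C₂' : ℝ} (hι : DenseRange ι)
    (hk : HasConv ι k 2 2 C₀)
    (hL : HasConv ι (expKernel θ k) p p C) (hA : HasAdj ι (expKernel (-θ) k) p p C')
    (hL₂ : HasConv ι (expKernel θ₂ k) p₂ p₂ C₂) (hA₂ : HasAdj ι (expKernel (-θ₂) k) p₂ p₂ C₂')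
    {f : Lp U p halfLine} {f₂ : Lp U p₂ halfLine} (hf : f₂ =ᵐ[halfLine] expMul (-(θ - θ₂)) f) :
    ((1 + quadOp ι k Q p₂ θ₂) f₂ : Lp U p₂ halfLine)
      =ᵐ[halfLine] expMul (-(θ - θ₂)) ((1 + quadOp ι k Q p θ) f : Lp U p halfLine) := by
  have e : ∀ g : ℝ → U, expMul (-θ₂) (expMul (-(θ - θ₂)) g) = expMul (-θ) g := fun g => by
    rw [expMul_expMul]; congr 1; ring
  refine expMul_cancel (-θ₂) ?_
  rw [e]
  refine (lam_consistent hι hk hL hA hL₂ hA₂ ?_).symm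
  rw [← e]
  exact (expMul_congr _ hf).symm

namespace Splitting

variable (h : Splitting ι ks kb q q' θ₀ c C)
include h

lemma conv_q (hθ : |θ| ≤ θ₀) : HasConv ι (expKernel θ (ks + kb)) q q (c + C) := by
  rw [expKernel_add]; exact (h.small_q θ hθ).add (h.reg_q θ hθ)

lemma conv_q' (hθ : |θ| ≤ θ₀) : HasConv ι (expKernel θ (ks + kb)) q' q' (c + C) := by
  rw [expKernel_add]; exact (h.small_q' θ hθ).add (h.reg_q' θ hθ)

lemma conv_two (hθ : |θ| ≤ θ₀) : HasConv ι (expKernel θ (ks + kb)) 2 2 (c + C) := by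
  rw [expKernel_add]; exact (h.small_two θ hθ).add (h.reg_two θ hθ)

lemma abs_zero_le : |(0 : ℝ)| ≤ θ₀ := by rw [abs_zero]; exact h.pos.le

lemma conv_two_zero : HasConv ι (ks + kb) 2 2 (c + C) := by
  have := h.conv_two h.abs_zero_le
  rwa [expKernel_zero] at this

lemma small_two_zero : HasConv ι ks 2 2 c := by
  have := h.small_two 0 h.abs_zero_le
  rwa [expKernel_zero] at this

lemma adj_two (hθ : |θ| ≤ θ₀) : HasAdj ι (expKernel (-θ) (ks + kb)) 2 2 (c + C) :=
  have h' := h.conv_two (θ := -θ) (by rwa [abs_neg])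
  h'.hasAdj (p' := 2) (p₂' := 2) h.dense (by norm_num) (by norm_num) (by norm_num) h'

lemma small_adj_two (hθ : |θ| ≤ θ₀) : HasAdj ι (expKernel (-θ) ks) 2 2 c :=
  have h' := h.small_two (-θ) (by rwa [abs_neg])
  h'.hasAdj (p' := 2) (p₂' := 2) h.dense (by norm_num) (by norm_num) (by norm_num) h'

variable [ENNReal.HolderConjugate q q']

section

variable (hq1 : 1 < q) (hq : q ≠ ∞)
include hq1 hq

lemma adj_q (hθ : |θ| ≤ θ₀) : HasAdj ι (expKernel (-θ) (ks + kb)) q q (c + C) :=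
  (h.conv_q' (θ := -θ) (by rwa [abs_neg])).hasAdj (p' := q') (p₂' := q') h.dense hq hq1 hq
    (h.conv_two (by rwa [abs_neg]))

lemma small_adj_q (hθ : |θ| ≤ θ₀) : HasAdj ι (expKernel (-θ) ks) q q c :=
  (h.small_q' (-θ) (by rwa [abs_neg])).hasAdj (p' := q') (p₂' := q') h.dense hq hq1 hq
    (h.small_two _ (by rwa [abs_neg]))

lemma reg_adj_q (hθ : |θ| ≤ θ₀) : HasAdj ι (expKernel (-θ) kb) q q C :=
  (h.reg_q' (-θ) (by rwa [abs_neg])).hasAdj (p' := q') (p₂' := q') h.dense hq hq1 hq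
    (h.reg_two _ (by rwa [abs_neg]))

omit hq1 in
lemma reg_adj_q_two (hθ : |θ| ≤ θ₀) : HasAdj ι (expKernel (-θ) kb) q 2 C :=
  (h.reg_two_q' (-θ) (by rwa [abs_neg])).hasAdj (p' := q') (p₂' := 2) h.dense hq (by norm_num)
    (by norm_num) (h.reg_two _ (by rwa [abs_neg]))

lemma isUnit_small_q (hc : c * (‖Q‖ * c) < 1) (hθ : |θ| ≤ θ₀) :
    IsUnit (1 + quadOp ι ks Q q θ) :=
  isUnit_one_add_of_norm_lt_one <| (norm_quadOp_le h.dense (h.small_q θ hθ)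
    (h.small_two (-θ) (by rwa [abs_neg])) (h.small_adj_q hq1 hq hθ)).trans_lt hc

end

omit [ENNReal.HolderConjugate q q'] in
lemma isUnit_small_two (hc : c * (‖Q‖ * c) < 1) (hθ : |θ| ≤ θ₀) :
    IsUnit (1 + quadOp ι ks Q 2 θ) :=
  isUnit_one_add_of_norm_lt_one <| (norm_quadOp_le h.dense (h.small_two θ hθ)
    (h.small_two (-θ) (by rwa [abs_neg])) (h.small_adj_two hθ)).trans_lt hc

/-- Up to the part with the small kernel, `L* Q L` raises the integrability from `q` to `2`: write
`L = L_s + L_b`, so that `L* Q L = L_s* Q L_s + L_b* Q L + L_s* Q L_b`. -/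
lemma exists_regular_part (hq1 : 1 < q) (hq : q ≠ ∞) (Q : Y →L[ℂ] Y) (hθ : |θ| ≤ θ₀) :
    ∃ N : Lp U q halfLine →L[ℂ] Lp U 2 halfLine, ∀ g : Lp U q halfLine,
      ((1 + quadOp ι (ks + kb) Q q θ) g : Lp U q halfLine)
        =ᵐ[halfLine] ((1 + quadOp ι ks Q q θ) g : Lp U q halfLine) + (N g : ℝ → U) := by
  have hθ' : |-θ| ≤ θ₀ := by rwa [abs_neg]
  refine ⟨adjConvOp ι (expKernel (-θ) kb) q 2 ∘L Q.compLpL q halfLine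
        ∘L convOp ι (expKernel θ (ks + kb)) q q
      + adjConvOp ι (expKernel (-θ) ks) 2 2 ∘L Q.compLpL 2 halfLine
        ∘L convOp ι (expKernel θ kb) q 2, fun g => ?_⟩
  set y : Lp Y q halfLine := convOp ι (expKernel θ (ks + kb)) q q g with hy
  set ys : Lp Y q halfLine := convOp ι (expKernel θ ks) q q g with hys
  set yb : Lp Y q halfLine := convOp ι (expKernel θ kb) q q g with hyb
  set yb2 : Lp Y 2 halfLine := convOp ι (expKernel θ kb) q 2 g with hyb2
  have e1 : y = ys + yb := by
    rw [hy, expKernel_add, HasConv.convOp_add h.dense (h.small_q θ hθ) (h.reg_q θ hθ)]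
    rfl
  have e2 : yb =ᵐ[halfLine] yb2 :=
    ((h.reg_q θ hθ).isConv g).unique h.dense ((h.reg_q_two θ hθ).isConv g)
  have e2' : Q.compLpL q halfLine yb =ᵐ[halfLine] Q.compLpL 2 halfLine yb2 := by
    filter_upwards [Q.coeFn_compLpL (p := q) (μ := halfLine) yb,
      Q.coeFn_compLpL (p := 2) (μ := halfLine) yb2, e2] with t h1 h2 h3
    rw [h1, h2, h3]
  -- the two realizations of each operator agree
  have e3 : adjConvOp ι (expKernel (-θ) kb) q q (Q.compLpL q halfLine y)
      =ᵐ[halfLine] adjConvOp ι (expKernel (-θ) kb) q 2 (Q.compLpL q halfLine y) :=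
    ((h.reg_adj_q hq1 hq hθ).isAdj _).unique (h.reg_two _ hθ') ((h.reg_adj_q_two hq hθ).isAdj _)
  have e4 : adjConvOp ι (expKernel (-θ) ks) q q (Q.compLpL q halfLine yb)
      =ᵐ[halfLine] adjConvOp ι (expKernel (-θ) ks) 2 2 (Q.compLpL 2 halfLine yb2) :=
    (((h.small_adj_q hq1 hq hθ).isAdj _).congr e2' .rfl).unique (h.small_two _ hθ')
      ((h.small_adj_two hθ).isAdj _)
  have e5 : (1 + quadOp ι (ks + kb) Q q θ) g = (1 + quadOp ι ks Q q θ) g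
      + (adjConvOp ι (expKernel (-θ) ks) q q (Q.compLpL q halfLine yb)
        + adjConvOp ι (expKernel (-θ) kb) q q (Q.compLpL q halfLine y)) := by
    change g + adjConvOp ι (expKernel (-θ) (ks + kb)) q q (Q.compLpL q halfLine y)
      = (g + adjConvOp ι (expKernel (-θ) ks) q q (Q.compLpL q halfLine ys)) + _
    have e6 : adjConvOp ι (expKernel (-θ) (ks + kb)) q q (Q.compLpL q halfLine y)
        = adjConvOp ι (expKernel (-θ) ks) q q (Q.compLpL q halfLine y)
          + adjConvOp ι (expKernel (-θ) kb) q q (Q.compLpL q halfLine y) := by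
      rw [expKernel_add, HasAdj.adjConvOp_add h.dense (h.small_two _ hθ') (h.reg_two _ hθ')
        (h.small_adj_q hq1 hq hθ) (h.reg_adj_q hq1 hq hθ)]
      rfl
    have e7 : adjConvOp ι (expKernel (-θ) ks) q q (Q.compLpL q halfLine y)
        = adjConvOp ι (expKernel (-θ) ks) q q (Q.compLpL q halfLine ys)
          + adjConvOp ι (expKernel (-θ) ks) q q (Q.compLpL q halfLine yb) := by
      rw [← map_add, ← map_add, ← e1]
    rw [e6, e7]
    abel
  rw [e5]
  refine (Lp.coeFn_add _ _).trans ?_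
  have e8 : (adjConvOp ι (expKernel (-θ) ks) q q (Q.compLpL q halfLine yb)
      + adjConvOp ι (expKernel (-θ) kb) q q (Q.compLpL q halfLine y) : Lp U q halfLine)
      =ᵐ[halfLine] (adjConvOp ι (expKernel (-θ) kb) q 2 (Q.compLpL q halfLine y)
        + adjConvOp ι (expKernel (-θ) ks) 2 2 (Q.compLpL 2 halfLine yb2) : Lp U 2 halfLine) := by
    refine (Lp.coeFn_add _ _).trans (.trans ?_ (Lp.coeFn_add _ _).symm)
    filter_upwards [e3, e4] with t h1 h2
    rw [Pi.add_apply, Pi.add_apply, h1, h2, add_comm]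
  filter_upwards [e8] with t ht
  rw [Pi.add_apply, Pi.add_apply, ht]
  rfl

end Splitting

end Inversion

section Inverse

lemma isUnit_one_add_of_isPositive {E : Type*} [NormedAddCommGroup E] [InnerProductSpace ℂ E]
    [CompleteSpace E] {P : E →L[ℂ] E} (hP : P.IsPositive) : IsUnit (1 + P) := by
  have h0 : 0 ≤ P := (ContinuousLinearMap.nonneg_iff_isPositive P).2 hP
  have h1 : (-1 : ℝ) ∉ spectrum ℝ P := fun h => by
    have := spectrum_nonneg_of_nonneg h0 h
    linarith
  rw [spectrum.notMem_iff] at h1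
  have h2 := h1.neg
  convert h2 using 1
  rw [map_neg, map_one]
  abel

variable {D Y U Z : Type*} [AddCommGroup D] [Module ℂ D]
  [NormedAddCommGroup Y] [InnerProductSpace ℂ Y] [CompleteSpace Y]
  [NormedAddCommGroup U] [InnerProductSpace ℂ U] [CompleteSpace U]
  [NormedAddCommGroup Z] [InnerProductSpace ℂ Z] [CompleteSpace Z]
  {ι : D →ₗ[ℂ] Y} {k ks kb : ℝ → D →ₗ[ℂ] U} {R : Y →L[ℂ] Z}
  {q q' : ℝ≥0∞} [Fact (1 ≤ q)] [Fact (1 ≤ q')] {θ θ₀ c C C' C₀ : ℝ}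

lemma compLpL_adjoint_comp_self (R : Y →L[ℂ] Z) :
    (R.adjoint ∘L R).compLpL 2 halfLine
      = (R.compLpL 2 halfLine).adjoint ∘L R.compLpL 2 halfLine := by
  have h1 : R.adjoint.compLpL 2 halfLine = (R.compLpL 2 halfLine).adjoint := by
    rw [ContinuousLinearMap.eq_adjoint_iff]
    intro z y
    rw [L2.inner_def, L2.inner_def]
    refine integral_congr_ae ?_
    filter_upwards [R.adjoint.coeFn_compLpL (p := 2) (μ := halfLine) z,
      R.coeFn_compLpL (p := 2) (μ := halfLine) y] with t h1 h2
    rw [h1, h2, ContinuousLinearMap.adjoint_inner_left]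
  rw [← h1]
  refine ContinuousLinearMap.ext fun y => Lp.ext ?_
  filter_upwards [(R.adjoint ∘L R).coeFn_compLpL (p := 2) (μ := halfLine) y,
    R.adjoint.coeFn_compLpL (p := 2) (μ := halfLine) (R.compLpL 2 halfLine y),
    R.coeFn_compLpL (p := 2) (μ := halfLine) y] with t h1 h2 h3
  rw [h3] at h2
  exact h1.trans h2.symm

/-- Without weight, `L* R* R L` is the positive operator `(RL)* (RL)` of `L^2`. -/
lemma isPositive_quadOp (hι : DenseRange ι) (hk : HasConv ι k 2 2 C) :
    (quadOp ι k (R.adjoint ∘L R) 2 0).IsPositive := by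
  have h1 : quadOp ι k (R.adjoint ∘L R) 2 0
      = (R.compLpL 2 halfLine ∘L convOp ι k 2 2).adjoint
        ∘L (R.compLpL 2 halfLine ∘L convOp ι k 2 2) := by
    rw [quadOp, neg_zero, expKernel_zero, adjConvOp_two hι hk
      (hk.hasAdj (p' := 2) (p₂' := 2) hι (by norm_num) (by norm_num) (by norm_num) hk),
      compLpL_adjoint_comp_self, ContinuousLinearMap.adjoint_comp]
    rfl
  rw [h1]
  exact ContinuousLinearMap.isPositive_adjoint_comp_self _

namespace Splitting

variable (h : Splitting ι ks kb q q' θ₀ c C)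
include h

lemma isUnit_zero : IsUnit (1 + quadOp ι (ks + kb) (R.adjoint ∘L R) 2 0) :=
  isUnit_one_add_of_isPositive (isPositive_quadOp h.dense h.conv_two_zero)

/-- `Λ` is invertible in `L^2` with a small exponential weight: the invertible operators form an
open set, and the operators with weight tend to the one without weight. -/
lemma exists_isUnit_two : ∃ θ₁ > 0, ∀ θ, |θ| ≤ θ₁ →
    IsUnit (1 + quadOp ι (ks + kb) (R.adjoint ∘L R) 2 θ) := by
  set Q := R.adjoint ∘L R with hQ
  obtain ⟨ρ, hρ, hball⟩ := Metric.isOpen_iff.1 (Units.isOpen (R := Lp U 2 halfLine →L[ℂ] _))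
    (1 + quadOp ι (ks + kb) Q 2 0) h.isUnit_zero
  have hK := h.conv_two_zero
  have hC0 : 0 ≤ c + C := (norm_nonneg (convOp ι (ks + kb) 2 2)).trans (hK.norm_convOp_le h.dense)
  have hKA : HasAdj ι (ks + kb) 2 2 (c + C) :=
    hK.hasAdj (p' := 2) (p₂' := 2) h.dense (by norm_num) (by norm_num) (by norm_num) hK
  set a := c + C with ha
  let e : ℝ := min 1 (ρ / (‖Q‖ * (2 * a + 1) + 1))
  have he : 0 < e := lt_min one_pos (by positivity)
  have he1 : e ≤ 1 := min_le_left _ _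
  have he2 : e * (‖Q‖ * (2 * a + 1)) < ρ := by
    have h1 : e * (‖Q‖ * (2 * a + 1) + 1) ≤ ρ := by
      rw [← le_div_iff₀ (by positivity)]; exact min_le_right _ _
    linarith
  obtain ⟨θ₁, hθ₁, hcont⟩ := h.continuous_zero e he
  refine ⟨θ₁, hθ₁, fun θ hθ => hball ?_⟩
  set K := ks + kb with hKdef
  set d := expKernel θ K - K with hd
  set d' := expKernel (-θ) K - K with hd'
  have hdc : HasConv ι d 2 2 e := hcont θ hθ
  have hdc' : HasConv ι d' 2 2 e := hcont (-θ) (by rwa [abs_neg])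
  have hda' : HasAdj ι d' 2 2 e :=
    hdc'.hasAdj (p' := 2) (p₂' := 2) h.dense (by norm_num) (by norm_num) (by norm_num) hdc'
  have e1 : convOp ι (expKernel θ K) 2 2 = convOp ι K 2 2 + convOp ι d 2 2 := by
    rw [← HasConv.convOp_add h.dense hK hdc, hd, add_sub_cancel]
  have e2 : adjConvOp ι (expKernel (-θ) K) 2 2 = adjConvOp ι K 2 2 + adjConvOp ι d' 2 2 := by
    rw [← HasAdj.adjConvOp_add h.dense hK hdc' hKA hda', hd', add_sub_cancel]
  set L := convOp ι K 2 2
  set A := adjConvOp ι K 2 2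
  set l := convOp ι d 2 2
  set b := adjConvOp ι d' 2 2
  set Qh := Q.compLpL 2 halfLine
  have nL : ‖L‖ ≤ a := hK.norm_convOp_le h.dense
  have nA : ‖A‖ ≤ a := hKA.norm_adjConvOp_le hK
  have nl : ‖l‖ ≤ e := hdc.norm_convOp_le h.dense
  have nb : ‖b‖ ≤ e := hda'.norm_adjConvOp_le hdc'
  have nQ : ‖Qh‖ ≤ ‖Q‖ := Q.norm_compLpL_le
  have e3 : quadOp ι K Q 2 θ - quadOp ι K Q 2 0 = b ∘L (Qh ∘L (L + l)) + A ∘L (Qh ∘L l) := by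
    rw [quadOp, quadOp, neg_zero, expKernel_zero, e1, e2]
    simp only [ContinuousLinearMap.add_comp, ContinuousLinearMap.comp_add]
    abel
  rw [Metric.mem_ball, dist_eq_norm, add_sub_add_left_eq_sub, e3]
  have n1 : ‖b ∘L (Qh ∘L (L + l))‖ ≤ e * (‖Q‖ * (a + e)) :=
    (ContinuousLinearMap.opNorm_comp_le _ _).trans <| mul_le_mul nb
      ((ContinuousLinearMap.opNorm_comp_le _ _).trans <| mul_le_mul nQ
        ((norm_add_le L l).trans (add_le_add nL nl)) (norm_nonneg _) (norm_nonneg _))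
      (norm_nonneg _) he.le
  have n2 : ‖A ∘L (Qh ∘L l)‖ ≤ a * (‖Q‖ * e) :=
    (ContinuousLinearMap.opNorm_comp_le _ _).trans <| mul_le_mul nA
      ((ContinuousLinearMap.opNorm_comp_le _ _).trans <| mul_le_mul nQ nl
        (norm_nonneg _) (norm_nonneg _)) (norm_nonneg _) hC0
  calc _ ≤ ‖b ∘L (Qh ∘L (L + l))‖ + ‖A ∘L (Qh ∘L l)‖ := norm_add_le _ _
    _ ≤ e * (‖Q‖ * (a + e)) + a * (‖Q‖ * e) := add_le_add n1 n2
    _ ≤ e * (‖Q‖ * (2 * a + 1)) := by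
        have : e * (‖Q‖ * (a + e)) ≤ e * (‖Q‖ * (a + 1)) := by gcongr
        linarith
    _ < ρ := he2

variable [ENNReal.HolderConjugate q q'] {Q : Y →L[ℂ] Y}

/-- `Λ` is injective in `L^q` with a weight `e^{δt}`, `δ > 0`, for which it is injective in `L^2`:
an element `g` of its kernel solves `(1 + L_s* Q L_s) g ∈ L^2` and therefore agrees with the
solution `g₂ ∈ L^2` of the same equation. Both are compared in `L^q` without weight, which contains
`e^{-δt} L^q` and `e^{-δt} L^2`. -/
lemma injective_q (r : ℝ≥0∞) [Fact (1 ≤ r)] [ENNReal.HolderTriple r 2 q]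
    (hq1 : 1 < q) (hq : q ≠ ∞) (hc : c * (‖Q‖ * c) < 1) {δ : ℝ} (hδ : 0 < δ)
    (hδ₀ : δ ≤ θ₀) (h2 : IsUnit (1 + quadOp ι (ks + kb) Q 2 δ)) {g : Lp U q halfLine}
    (hg : (1 + quadOp ι (ks + kb) Q q δ) g = 0) : g = 0 := by
  have hδa : |δ| ≤ θ₀ := by rwa [abs_of_pos hδ]
  have h0a := h.abs_zero_le
  obtain ⟨N, hN⟩ := h.exists_regular_part hq1 hq Q hδa
  obtain ⟨g₂, hg₂⟩ := ((ContinuousLinearMap.isUnit_iff_bijective).1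
    (h.isUnit_small_two (Q := Q) hc hδa)).2 (-(N g))
  have e1 : ((1 + quadOp ι ks Q q δ) g : Lp U q halfLine) =ᵐ[halfLine]
      ((1 + quadOp ι ks Q 2 δ) g₂ : Lp U 2 halfLine) := by
    rw [hg₂]
    have h1 := hN g
    rw [hg] at h1
    filter_upwards [h1, Lp.coeFn_zero (E := U) (p := q) (μ := halfLine),
      Lp.coeFn_neg (N g)] with t h1 h2 h3
    rw [h3, Pi.neg_apply, eq_neg_iff_add_eq_zero]
    rw [h2] at h1
    exact h1.symm
  obtain ⟨M, hM⟩ := exists_clm_expMul U hδ ∞ q q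
  obtain ⟨E, hE⟩ := exists_clm_expMul U hδ r 2 q
  have e2 : M g = E g₂ := by
    have hinj := ((ContinuousLinearMap.isUnit_iff_bijective).1
      (h.isUnit_small_q (Q := Q) hq1 hq hc h0a)).1
    refine hinj (Lp.ext ?_)
    have i1 := lam_expMul (Q := Q) h.dense h.small_two_zero (h.small_q δ hδa)
      (h.small_adj_q hq1 hq hδa) (h.small_q 0 h0a) (h.small_adj_q hq1 hq h0a)
      (f := g) (f₂ := M g) (by rw [sub_zero]; exact hM g)
    have i2 := lam_expMul (Q := Q) h.dense h.small_two_zero (h.small_two δ hδa)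
      (h.small_adj_two hδa) (h.small_q 0 h0a) (h.small_adj_q hq1 hq h0a)
      (f := g₂) (f₂ := E g₂) (by rw [sub_zero]; exact hE g₂)
    exact i1.trans ((expMul_congr _ e1).trans i2.symm)
  have e3 : g =ᵐ[halfLine] g₂ := by
    refine expMul_cancel (-δ) ((hM g).symm.trans (.trans ?_ (hE g₂)))
    rw [e2]
  have e4 : (1 + quadOp ι (ks + kb) Q 2 δ) g₂ = 0 := by
    refine Lp.ext ?_
    have i1 := lam_expMul (Q := Q) h.dense h.conv_two_zero (h.conv_q hδa)
      (h.adj_q hq1 hq hδa) (h.conv_two hδa) (h.adj_two hδa)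
      (f := g) (f₂ := g₂) (by rw [sub_self, neg_zero, expMul_zero]; exact e3.symm)
    rw [sub_self, neg_zero, expMul_zero, hg] at i1
    exact i1.trans ((Lp.coeFn_zero _ _ _).trans (Lp.coeFn_zero _ _ _).symm)
  have e5 : g₂ = 0 :=
    ((ContinuousLinearMap.isUnit_iff_bijective).1 h2).1 (e4.trans (map_zero _).symm)
  refine Lp.ext (e3.trans ?_)
  rw [e5]
  exact (Lp.coeFn_zero _ _ _).trans (Lp.coeFn_zero _ _ _).symm

/-- The inverse of `Λ` from `L^q_δ` to `L^q_{δ'}`. The solution of `Λ g = f` is the sum of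
`(1 + L_s* Q L_s)⁻¹ f` and a correction which solves an equation with right-hand side in `L^2`. -/
lemma exists_inverse (r : ℝ≥0∞) [Fact (1 ≤ r)] [ENNReal.HolderTriple r 2 q]
    (hq1 : 1 < q) (hq : q ≠ ∞) (hc : c * (‖R.adjoint ∘L R‖ * c) < 1) {δ : ℝ}
    (hδ : 0 < δ) (hδ₀ : δ ≤ θ₀) :
    ∃ δ', 0 < δ' ∧ δ' < δ ∧ ∃ T : Lp U q halfLine →L[ℂ] Lp U q halfLine,
      ∀ f g : Lp U q halfLine, T f = g ↔
        IsLam ι (ks + kb) (R.adjoint ∘L R) (expMul (-δ') g) (expMul (-δ) f) := by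
  obtain ⟨θ₁, hθ₁, hunit⟩ := h.exists_isUnit_two (R := R)
  set Q := R.adjoint ∘L R with hQ
  obtain ⟨θ, hθ, hθθ₁, hθδ⟩ : ∃ θ, 0 < θ ∧ θ ≤ θ₁ ∧ θ < δ :=
    ⟨min θ₁ (δ / 2), lt_min hθ₁ (by linarith), min_le_left _ _,
      (min_le_right _ _).trans_lt (by linarith)⟩
  set δ' := θ / 2 with hδ'
  have hδ'0 : 0 < δ' := by positivity
  have hδ'δ : δ' < δ := by rw [hδ']; linarith
  have aδ : |δ| ≤ θ₀ := by rwa [abs_of_pos hδ]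
  have aθ : |θ| ≤ θ₀ := by rw [abs_of_pos hθ]; linarith
  have aδ' : |δ'| ≤ θ₀ := by rw [abs_of_pos hδ'0]; linarith
  obtain ⟨N, hN⟩ := h.exists_regular_part hq1 hq Q aδ
  obtain ⟨us, hus⟩ := h.isUnit_small_q (Q := Q) hq1 hq hc aδ
  obtain ⟨ut, hut⟩ := hunit θ (by rwa [abs_of_pos hθ])
  obtain ⟨M, hM⟩ := exists_clm_expMul U (sub_pos.2 hδ'δ) ∞ q q
  obtain ⟨M₂, hM₂⟩ := exists_clm_expMul U (sub_pos.2 hθδ) ∞ 2 2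
  have hθδ' : 0 < θ - δ' := by rw [hδ']; linarith
  obtain ⟨E, hE⟩ := exists_clm_expMul U hθδ' r 2 q
  let S : Lp U q halfLine →L[ℂ] Lp U q halfLine := ↑us⁻¹
  let V : Lp U 2 halfLine →L[ℂ] Lp U 2 halfLine := ↑ut⁻¹
  have hS : ∀ f, (1 + quadOp ι ks Q q δ) (S f) = f := fun f => by
    rw [← hus]
    exact congrArg (fun A : Lp U q halfLine →L[ℂ] Lp U q halfLine => A f) us.mul_inv
  have hV : ∀ f, (1 + quadOp ι (ks + kb) Q 2 θ) (V f) = f := fun f => by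
    rw [← hut]
    exact congrArg (fun A : Lp U 2 halfLine →L[ℂ] Lp U 2 halfLine => A f) ut.mul_inv
  let T : Lp U q halfLine →L[ℂ] Lp U q halfLine :=
    M ∘L S - E ∘L V ∘L M₂ ∘L N ∘L S
  have hT : ∀ f, (1 + quadOp ι (ks + kb) Q q δ') (T f) = M f := by
    intro f
    set g₁ := S f with hg₁
    set g₂ := V (M₂ (N g₁)) with hg₂
    have e0 : T f = M g₁ - E g₂ := rfl
    have i1 := lam_expMul (Q := Q) h.dense h.conv_two_zero (h.conv_q aδ)
      (h.adj_q hq1 hq aδ) (h.conv_q aδ') (h.adj_q hq1 hq aδ') (f := g₁) (f₂ := M g₁) (hM g₁)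
    have i2 := lam_expMul (Q := Q) h.dense h.conv_two_zero (h.conv_two aθ)
      (h.adj_two aθ) (h.conv_q aδ') (h.adj_q hq1 hq aδ') (f := g₂) (f₂ := E g₂) (hE g₂)
    rw [hg₂, hV, ← hg₂] at i2
    have i3 := expMul_congr (-(θ - δ')) (hM₂ (N g₁))
    rw [expMul_expMul, show -(θ - δ') + -(δ - θ) = -(δ - δ') by ring] at i3
    have i4 := expMul_congr (-(δ - δ')) (hN g₁)
    rw [hg₁, hS, ← hg₁] at i4
    rw [e0, map_sub]
    refine Lp.ext ((Lp.coeFn_sub _ _).trans ?_)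
    filter_upwards [i1, i2, i3, i4, hM f] with t h1 h2 h3 h4 h5
    rw [Pi.sub_apply, h1, h2, h3, h4, h5]
    simp only [expMul, Pi.add_apply, smul_add, add_sub_cancel_right]
  refine ⟨δ', hδ'0, hδ'δ, T, fun f g => ?_⟩
  have hcongr : expMul (-δ') (M f) =ᵐ[halfLine] expMul (-δ) f := by
    have := expMul_congr (-δ') (hM f)
    rwa [expMul_expMul, show -δ' + -(δ - δ') = -δ by ring] at this
  have hiff := isLam_expMul_iff (Q := Q) h.dense h.conv_two_zero (h.conv_q aδ')
    (h.adj_q hq1 hq aδ') g (M f)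
  have hinj : Function.Injective ⇑(1 + quadOp ι (ks + kb) Q q δ') := by
    rw [injective_iff_map_eq_zero]
    exact fun g hg => h.injective_q r hq1 hq hc hδ'0 (by linarith)
      (hunit δ' (by rw [abs_of_pos hδ'0]; linarith)) hg
  calc T f = g ↔ (1 + quadOp ι (ks + kb) Q q δ') g = M f := by
        rw [← hT f]
        exact ⟨fun e => by rw [e], fun e => (hinj e).symm⟩
    _ ↔ _ := hiff
    _ ↔ _ := ⟨fun H => H.congr .rfl hcongr, fun H => H.congr .rfl hcongr.symm⟩

end Splitting

end Inverse

/-! ### The adjoint semigroup and the kernel of the input-to-state map -/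

section Semigroup

variable {Y U : Type*}
  [NormedAddCommGroup Y] [InnerProductSpace ℂ Y] [CompleteSpace Y]
  [NormedAddCommGroup U] [InnerProductSpace ℂ U] [CompleteSpace U]

/-- The inclusion `D(A*) → Y`. -/
def domIncl (S : C0Semigroup Y) : DomAdj S →ₗ[ℂ] Y :=
  LinearMap.fst ℂ Y Y ∘ₗ Submodule.subtype _

@[simp]
lemma domIncl_apply (S : C0Semigroup Y) (x : DomAdj S) : domIncl S x = x.1.1 := rfl

lemma hasDerivWithinAt_op (S : C0Semigroup Y) {a b : Y} (hab : (a, b) ∈ generatorGraph S) {s : ℝ}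
    (hs : 0 ≤ s) : HasDerivWithinAt (fun t => S.op t a) (S.op s b) (Ioi s) s := by
  rw [hasDerivWithinAt_iff_tendsto_slope' self_notMem_Ioi]
  have h1 : Tendsto (fun t : ℝ => t⁻¹ • (S.op t (S.op s a) - S.op s a)) (𝓝[>] 0) (𝓝 (S.op s b)) :=
    generatorGraph_op S hs hab
  have h2 : Tendsto (fun t : ℝ => t - s) (𝓝[>] s) (𝓝[>] 0) := by
    refine tendsto_nhdsWithin_iff.2 ⟨?_, ?_⟩
    · have : Tendsto (fun t : ℝ => t - s) (𝓝 s) (𝓝 (s - s)) :=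
        (continuous_id.sub continuous_const).tendsto s
      rw [sub_self] at this
      exact this.mono_left nhdsWithin_le_nhds
    · filter_upwards [self_mem_nhdsWithin] with t ht
      exact mem_Ioi.2 (sub_pos.2 (mem_Ioi.1 ht))
  refine (h1.comp h2).congr' ?_
  filter_upwards [self_mem_nhdsWithin] with t ht
  have hts : s < t := ht
  have e := S.op_add (t - s) s (sub_pos.2 hts).le hs
  rw [sub_add_cancel] at e
  simp only [Function.comp_apply, slope, vsub_eq_sub, e, ContinuousLinearMap.comp_apply]

lemma continuousOn_op (S : C0Semigroup Y) (a : Y) {h : ℝ} (hh : 0 ≤ h) :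
    ContinuousOn (fun s => S.op s a) (uIcc 0 h) := by
  rw [uIcc_of_le hh]
  exact (S.strong_cont a).mono Icc_subset_Ici_self

lemma integral_op_eq_sub (S : C0Semigroup Y) {a b : Y} (hab : (a, b) ∈ generatorGraph S) {h : ℝ}
    (hh : 0 ≤ h) : ∫ s in (0 : ℝ)..h, S.op s b = S.op h a - a := by
  have := intervalIntegral.integral_eq_sub_of_hasDeriv_right (continuousOn_op S a hh)
    (f' := fun s => S.op s b)
    (fun s hs => hasDerivWithinAt_op S hab (by
      rw [min_eq_left hh] at hs; exact hs.1.le))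
    (continuousOn_op S b hh).intervalIntegrable
  rw [this, S.op_zero]
  rfl

/-- The operator `a ↦ ∫_0^h e^{As} a ds`. -/
def opAverage (S : C0Semigroup Y) {M : ℝ} (hM : ∀ t, 0 ≤ t → ‖S.op t‖ ≤ M) {h : ℝ} (hh : 0 ≤ h) :
    Y →L[ℂ] Y :=
  LinearMap.mkContinuous
    { toFun := fun a => ∫ s in (0 : ℝ)..h, S.op s a
      map_add' := fun a b => by
        simp only [map_add]
        exact intervalIntegral.integral_add (continuousOn_op S a hh).intervalIntegrable
          (continuousOn_op S b hh).intervalIntegrable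
      map_smul' := fun c a => by
        simp only [map_smul, RingHom.id_apply]
        exact intervalIntegral.integral_smul c _ }
    (M * h) fun a => by
      have := intervalIntegral.norm_integral_le_of_norm_le_const (a := 0) (b := h)
        (f := fun s => S.op s a) (C := M * ‖a‖) fun s hs => by
          rw [uIoc_of_le hh] at hs
          exact ((S.op s).le_opNorm a).trans (by gcongr; exact hM s hs.1.le)
      rw [sub_zero, abs_of_nonneg hh] at this
      exact this.trans_eq (by ring)

lemma opAverage_apply (S : C0Semigroup Y) {M : ℝ} (hM : ∀ t, 0 ≤ t → ‖S.op t‖ ≤ M) {h : ℝ}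
    (hh : 0 ≤ h) (a : Y) : opAverage S hM hh a = ∫ s in (0 : ℝ)..h, S.op s a := rfl

lemma opAverage_adjoint_mem (S : C0Semigroup Y) {M : ℝ} (hM : ∀ t, 0 ≤ t → ‖S.op t‖ ≤ M) {h : ℝ}
    (hh : 0 ≤ h) (x : Y) :
    ((opAverage S hM hh).adjoint x, (S.op h).adjoint x - x) ∈ (generatorGraph S).adjoint := by
  rw [Submodule.mem_adjoint_iff]
  intro a b hab
  simp only [ContinuousLinearMap.adjoint_inner_right, inner_sub_right, opAverage_apply,
    integral_op_eq_sub S hab hh, inner_sub_left]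
  ring

/-- `D(A*)` is dense: a vector orthogonal to the averages `∫_0^h e^{A*s} x ds` has vanishing
averages `∫_0^h e^{As} z ds`. -/
lemma denseRange_domIncl (S : C0Semigroup Y) {M : ℝ} (hM : ∀ t, 0 ≤ t → ‖S.op t‖ ≤ M) :
    DenseRange (domIncl S) := by
  have h1 : (LinearMap.range (domIncl S)).topologicalClosure = ⊤ := by
    rw [Submodule.topologicalClosure_eq_top_iff, Submodule.eq_bot_iff]
    intro z hz
    rw [Submodule.mem_orthogonal] at hz
    have h0 : ∀ h : ℝ, 0 ≤ h → ∫ s in (0 : ℝ)..h, S.op s z = 0 := by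
      intro h hh
      refine ext_inner_left ℂ fun x => ?_
      have := hz _ ⟨⟨_, opAverage_adjoint_mem S hM hh x⟩, rfl⟩
      rw [domIncl_apply] at this
      rw [inner_zero_right, ← opAverage_apply S hM hh, ← ContinuousLinearMap.adjoint_inner_left]
      exact this
    have hcw : ContinuousWithinAt (fun s => S.op s z) (Ioi 0) 0 :=
      ((S.strong_cont z) 0 self_mem_Ici).mono Ioi_subset_Ici_self
    have hsm : StronglyMeasurableAtFilter (fun s => S.op s z) (𝓝[>] (0 : ℝ)) volume :=
      ⟨Ioi 0, self_mem_nhdsWithin, ((S.strong_cont z).mono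
        Ioi_subset_Ici_self).aestronglyMeasurable measurableSet_Ioi⟩
    have hd := intervalIntegral.integral_hasDerivWithinAt_right (a := (0 : ℝ)) (b := 0)
      (f := fun s => S.op s z) (s := Ici 0) (t := Ioi 0) (by simp) hsm hcw
    have hd0 : HasDerivWithinAt (fun u => ∫ s in (0 : ℝ)..u, S.op s z) 0 (Ici 0) 0 :=
      (hasDerivWithinAt_const (0 : ℝ) (Ici 0) (0 : Y)).congr (fun u hu => h0 u hu) (h0 0 le_rfl)
    have e := (uniqueDiffOn_Ici (0 : ℝ) 0 self_mem_Ici).eq_deriv _ hd hd0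
    simpa [S.op_zero] using e
  intro y
  have : y ∈ (LinearMap.range (domIncl S)).topologicalClosure := h1 ▸ Submodule.mem_top
  rwa [← SetLike.mem_coe, Submodule.topologicalClosure_coe] at this

lemma adjOpDom_of_nonneg (S : C0Semigroup Y) {t : ℝ} (ht : 0 ≤ t) (x : DomAdj S) :
    (adjOpDom S t x).1 = (adjOp S t x.1.1, adjOp S t x.1.2) := by
  rw [adjOpDom, dif_pos ht]

/-- `adjOpDom` as a linear map. -/
def adjOpDomₗ (S : C0Semigroup Y) (t : ℝ) : DomAdj S →ₗ[ℂ] DomAdj S where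
  toFun := adjOpDom S t
  map_add' x y := by
    by_cases ht : 0 ≤ t
    · refine Subtype.ext ?_
      rw [Submodule.coe_add]
      simp [adjOpDom_of_nonneg S ht]
    · simp [adjOpDom, ht]
  map_smul' c x := by
    by_cases ht : 0 ≤ t
    · refine Subtype.ext ?_
      rw [Submodule.coe_smul]
      simp [adjOpDom_of_nonneg S ht]
    · simp [adjOpDom, ht]

lemma adjOpDom_add (S : C0Semigroup Y) {s t : ℝ} (hs : 0 ≤ s) (ht : 0 ≤ t) (x : DomAdj S) :
    adjOpDom S (t + s) x = adjOpDom S t (adjOpDom S s x) := by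
  have e : ∀ y, adjOp S (t + s) y = adjOp S t (adjOp S s y) := fun y => by
    rw [adjOp, add_comm, S.op_add s t hs ht, ContinuousLinearMap.adjoint_comp]
    rfl
  refine Subtype.ext ?_
  rw [adjOpDom_of_nonneg S (add_nonneg ht hs), adjOpDom_of_nonneg S ht,
    adjOpDom_of_nonneg S hs, e, e]

variable (S : C0Semigroup Y) (B : U →L[ℂ] Extrapolation S)

lemma inner_controlAdj (x : DomAdj S) (u : U) : inner ℂ (controlAdj S B x) u = B u x := by
  have : controlAdj S B x = (InnerProductSpace.toDual ℂ U).symm (B.flip x) := rfl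
  rw [this, InnerProductSpace.toDual_symm_apply]
  rfl

/-- The kernel `τ ↦ B* e^{A*τ}` of the input-to-state map, extended by `0` to `τ ≤ 0`. -/
def sysKernel (τ : ℝ) : DomAdj S →ₗ[ℂ] U :=
  if 0 < τ then (controlAdj S B).toLinearMap ∘ₗ adjOpDomₗ S τ else 0

variable {S B}

lemma sysKernel_of_pos {τ : ℝ} (hτ : 0 < τ) (x : DomAdj S) :
    sysKernel S B τ x = controlAdj S B (adjOpDom S τ x) := by
  rw [sysKernel, if_pos hτ]; rfl

lemma sysKernel_of_nonpos {τ : ℝ} (hτ : τ ≤ 0) : sysKernel S B τ = 0 := by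
  rw [sysKernel, if_neg (not_lt.2 hτ)]

lemma sysKernel_add {s τ : ℝ} (hs : 0 ≤ s) (hτ : 0 < τ) (x : DomAdj S) :
    sysKernel S B (τ + s) x = sysKernel S B τ (adjOpDom S s x) := by
  rw [sysKernel_of_pos (by linarith), sysKernel_of_pos hτ, adjOpDom_add S hs hτ.le]

/-- The functionals on `D(A*)` extend to `Y × Y`, so that `e^{A*τ} x` is weakly continuous in
`D(A*)`. -/
lemma aestronglyMeasurable_sysKernel [TopologicalSpace.SeparableSpace U] (x : DomAdj S) :
    AEStronglyMeasurable (fun τ => sysKernel S B τ x) volume := by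
  have hind : (fun τ => sysKernel S B τ x)
      = (Ioi 0).indicator fun τ => controlAdj S B (adjOpDom S τ x) := by
    funext τ
    by_cases hτ : 0 < τ
    · rw [indicator_of_mem (mem_Ioi.2 hτ), sysKernel_of_pos hτ]
    · rw [indicator_of_notMem (by simpa using hτ), sysKernel_of_nonpos (not_lt.1 hτ)]; rfl
  rw [hind, aestronglyMeasurable_indicator_iff measurableSet_Ioi]
  refine aestronglyMeasurable_of_inner_dense (ι := (LinearMap.id : U →ₗ[ℂ] U))
    Function.surjective_id.denseRange fun u => ?_
  let φ : StrongDual ℂ (generatorGraph S).adjoint := (innerSL ℂ u) ∘L controlAdj S B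
  obtain ⟨g, hg, -⟩ := exists_extension_norm_eq (generatorGraph S).adjoint φ
  have hcont : ∀ (f : StrongDual ℂ Y) (y : Y), ContinuousOn (fun τ => f (adjOp S τ y)) (Ici 0) := by
    intro f y
    have e : ∀ τ, f (adjOp S τ y) = inner ℂ (S.op τ ((InnerProductSpace.toDual ℂ Y).symm f)) y := by
      intro τ
      rw [← InnerProductSpace.toDual_symm_apply, adjOp, ContinuousLinearMap.adjoint_inner_right]
    simp only [e]
    exact (S.strong_cont _).inner continuousOn_const
  have hc : ContinuousOn (fun τ => inner ℂ u (controlAdj S B (adjOpDom S τ x))) (Ici 0) := by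
    refine ((hcont (g ∘L ContinuousLinearMap.inl ℂ Y Y) x.1.1).add
      (hcont (g ∘L ContinuousLinearMap.inr ℂ Y Y) x.1.2)).congr fun τ hτ => ?_
    have h1 := hg (adjOpDom S τ x)
    rw [adjOpDom_of_nonneg S hτ] at h1
    refine (Eq.trans ?_ h1.symm).trans ?_
    · rfl
    · change _ = g (ContinuousLinearMap.inl ℂ Y Y _) + g (ContinuousLinearMap.inr ℂ Y Y _)
      rw [← map_add]
      simp
  exact (hc.mono Ioi_subset_Ici_self).aestronglyMeasurable measurableSet_Ioi

lemma isInputToState_iff {v : ℝ → U} {y : ℝ → Y} :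
    IsInputToState S B v y ↔ IsConv (domIncl S) (sysKernel S B) v y := by
  refine eventually_congr (Eventually.of_forall fun t => forall_congr' fun x => ?_)
  have e : ∫ s in Ioo 0 t, B (v s) (adjOpDom S (t - s) x)
      = ∫ s, inner ℂ (sysKernel S B (t - s) x) (v s) ∂halfLine := by
    rw [halfLine, setIntegral_eq_of_subset_of_forall_sdiff_eq_zero measurableSet_Ioi
      (Ioo_subset_Ioi_self : Ioo 0 t ⊆ Ioi 0)]
    · refine setIntegral_congr_fun measurableSet_Ioo fun s hs => ?_
      simp only [sysKernel_of_pos (sub_pos.2 hs.2), inner_controlAdj]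
    · intro s hs
      have : t ≤ s := by
        by_contra hts
        exact hs.2 ⟨hs.1, not_le.1 hts⟩
      rw [sysKernel_of_nonpos (by linarith)]
      simp
  rw [e, domIncl_apply]

lemma isAdjInputToState_iff {y : ℝ → Y} {w : ℝ → U} :
    IsAdjInputToState S B y w ↔ IsAdj (domIncl S) (sysKernel S B) y w := by
  simp only [IsAdjInputToState, IsAdj, isInputToState_iff]

lemma isLambda_iff {Z : Type*} [NormedAddCommGroup Z] [InnerProductSpace ℂ Z] [CompleteSpace Z]
    {R : Y →L[ℂ] Z} {g h : ℝ → U} :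
    IsLambda S B R g h ↔ IsLam (domIncl S) (sysKernel S B) (R.adjoint ∘L R) g h := by
  simp only [IsLambda, IsLam, isInputToState_iff, isAdjInputToState_iff,
    ContinuousLinearMap.comp_apply]

end Semigroup

/-! ### Estimates for kernels -/

section KernelBounds

variable {D Y U : Type*} [AddCommGroup D] [Module ℂ D]
  [NormedAddCommGroup Y] [InnerProductSpace ℂ Y] [CompleteSpace Y]
  [NormedAddCommGroup U] [InnerProductSpace ℂ U] [CompleteSpace U]
  {ι : D →ₗ[ℂ] Y} {k k' : ℝ → D →ₗ[ℂ] U} {r r' : ℝ} {m : ℝ → ℝ≥0∞}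

/-- Hölder's inequality: a kernel with `‖k(τ)x‖ ≤ ψ_x(τ) φ(τ)` and `‖ψ_x‖_{r'} ≤ A^(1/r') ‖x‖` is
dominated in `L^r` by a multiple of `φ^r`. -/
lemma KernelBound.of_holder (hr : r.HolderConjugate r')
    (hk : ∀ x, AEStronglyMeasurable (fun τ => k τ x) volume)
    {φ : ℝ → ℝ≥0∞} (hφ : Measurable φ) {ψ : D → ℝ → ℝ≥0∞} (hψ : ∀ x, AEMeasurable (ψ x) volume)
    {A : ℝ≥0∞} (hle : ∀ x τ, ‖k τ x‖ₑ ≤ ψ x τ * φ τ)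
    (hA : ∀ x, ∫⁻ τ, ψ x τ ^ r' ≤ A * ‖ι x‖ₑ ^ r') :
    KernelBound ι k r (fun τ => A ^ (r / r') * φ τ ^ r) where
  aestronglyMeasurable := hk
  measurable := (hφ.pow_const r).const_mul _
  bound x v t hv := by
    have hr0 : 0 < r := hr.pos
    have hr'0 : 0 < r' := hr.symm.pos
    have hψt : AEMeasurable (fun s => ψ x (t - s)) halfLine :=
      ((hψ x).comp_quasiMeasurePreserving
        (quasiMeasurePreserving_sub_left_of_right_invariant volume t)).mono_measure
          halfLine_le_volume
    have hφt : Measurable fun s => φ (t - s) := hφ.comp (measurable_const.sub measurable_id)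
    have h1 : ∫⁻ s, ψ x (t - s) ^ r' ∂halfLine ≤ A * ‖ι x‖ₑ ^ r' :=
      (lintegral_mono' halfLine_le_volume le_rfl).trans
        ((lintegral_sub_left_eq_self (fun τ => ψ x τ ^ r') t).trans_le (hA x))
    calc ∫⁻ s, ‖k (t - s) x‖ₑ * v s ∂halfLine
        ≤ ∫⁻ s, ((fun s => ψ x (t - s)) * fun s => φ (t - s) * v s) s ∂halfLine := by
          refine lintegral_mono fun s => ?_
          rw [Pi.mul_apply, ← mul_assoc]
          gcongr
          exact hle x (t - s)
      _ ≤ (∫⁻ s, ψ x (t - s) ^ r' ∂halfLine) ^ (1 / r')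
            * (∫⁻ s, (φ (t - s) * v s) ^ r ∂halfLine) ^ (1 / r) :=
          ENNReal.lintegral_mul_le_Lp_mul_Lq halfLine hr.symm hψt (hφt.aemeasurable.mul hv)
      _ ≤ (A * ‖ι x‖ₑ ^ r') ^ (1 / r')
            * (∫⁻ s, (φ (t - s) * v s) ^ r ∂halfLine) ^ (1 / r) := by gcongr
      _ = ‖ι x‖ₑ * (A ^ (r / r') * ∫⁻ s, (φ (t - s) * v s) ^ r ∂halfLine) ^ (1 / r) := by
          rw [ENNReal.mul_rpow_of_nonneg _ _ (by positivity),
            ENNReal.mul_rpow_of_nonneg _ _ (by positivity), ← ENNReal.rpow_mul, ← ENNReal.rpow_mul,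
            mul_one_div_cancel hr'0.ne', ENNReal.rpow_one,
            show r / r' * (1 / r) = 1 / r' by field_simp]
          ring
      _ = _ := by
          congr 2
          have hm : AEMeasurable (fun s => (φ (t - s) * v s) ^ r) halfLine :=
            (hφt.aemeasurable.mul hv).pow_const r
          rw [← lintegral_const_mul'' _ hm]
          refine lintegral_congr fun s => ?_
          rw [ENNReal.mul_rpow_of_nonneg _ _ hr0.le, mul_assoc]

lemma KernelBound.of_le (h : KernelBound ι k' r m) (hr : 0 < r)
    (hk : ∀ x, AEStronglyMeasurable (fun τ => k τ x) volume) (a : ℝ≥0)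
    (hle : ∀ x τ, ‖k τ x‖ₑ ≤ a * ‖k' τ x‖ₑ) :
    KernelBound ι k r (fun τ => (a : ℝ≥0∞) ^ r * m τ) where
  aestronglyMeasurable := hk
  measurable := h.measurable.const_mul _
  bound x v t hv := by
    have hne : (a : ℝ≥0∞) ^ r ≠ ∞ := ENNReal.rpow_ne_top_of_nonneg hr.le ENNReal.coe_ne_top
    calc ∫⁻ s, ‖k (t - s) x‖ₑ * v s ∂halfLine
        ≤ ∫⁻ s, a * (‖k' (t - s) x‖ₑ * v s) ∂halfLine := by
          refine lintegral_mono fun s => ?_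
          rw [← mul_assoc]
          gcongr
          exact hle x (t - s)
      _ = a * ∫⁻ s, ‖k' (t - s) x‖ₑ * v s ∂halfLine :=
          lintegral_const_mul' _ _ ENNReal.coe_ne_top
      _ ≤ a * (‖ι x‖ₑ * (∫⁻ s, m (t - s) * v s ^ r ∂halfLine) ^ (1 / r)) := by
          gcongr; exact h.bound x v t hv
      _ = ‖ι x‖ₑ * ((a : ℝ≥0∞) ^ r * ∫⁻ s, m (t - s) * v s ^ r ∂halfLine) ^ (1 / r) := by
          rw [ENNReal.mul_rpow_of_nonneg _ _ (by positivity), ← ENNReal.rpow_mul,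
            mul_one_div_cancel hr.ne', ENNReal.rpow_one]
          ring
      _ = _ := by
          rw [← lintegral_const_mul' _ _ hne]
          simp only [mul_assoc]

lemma aestronglyMeasurable_expKernel (θ : ℝ) {x : D}
    (hk : AEStronglyMeasurable (fun τ => k τ x) volume) :
    AEStronglyMeasurable (fun τ => expKernel θ k τ x) volume := by
  have hc : Continuous fun τ : ℝ => ((Real.exp (θ * τ) : ℝ) : ℂ) := by fun_prop
  exact hc.aestronglyMeasurable.smul hk

lemma enorm_expKernel (θ τ : ℝ) (x : D) :
    ‖expKernel θ k τ x‖ₑ = ENNReal.ofReal (Real.exp (θ * τ)) * ‖k τ x‖ₑ := by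
  rw [expKernel, LinearMap.smul_apply, enorm_smul, ← ofReal_norm (((Real.exp (θ * τ) : ℝ) : ℂ)),
    Complex.norm_real, Real.norm_eq_abs, Real.abs_exp]

lemma enorm_expKernel_le (hk : ∀ τ ≤ 0, k τ = 0) {θ θ₀ : ℝ} (hθ : |θ| ≤ θ₀) (x : D) (τ : ℝ) :
    ‖expKernel θ k τ x‖ₑ ≤ (1 : ℝ≥0) * ‖expKernel θ₀ k τ x‖ₑ := by
  rw [enorm_expKernel, enorm_expKernel, ENNReal.coe_one, one_mul]
  rcases le_or_gt τ 0 with hτ | hτ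
  · simp [hk τ hτ]
  · gcongr
    exact (le_abs_self θ).trans hθ

lemma enorm_expKernel_sub_le (hk : ∀ τ ≤ 0, k τ = 0) {θ θ₀ : ℝ} (h0 : 0 < θ₀)
    (hθ : |θ| ≤ θ₀ / 2) (x : D) (τ : ℝ) :
    ‖(expKernel θ k - k) τ x‖ₑ ≤ (2 * |θ| / θ₀).toNNReal * ‖expKernel θ₀ k τ x‖ₑ := by
  rcases le_or_gt τ 0 with hτ | hτ
  · simp [hk τ hτ, expKernel]
  have e : (expKernel θ k - k) τ x = ((Real.exp (θ * τ) - 1 : ℝ) : ℂ) • k τ x := by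
    simp only [Pi.sub_apply, LinearMap.sub_apply, expKernel, LinearMap.smul_apply]
    push_cast
    rw [sub_smul, one_smul]
  have key : |Real.exp (θ * τ) - 1| ≤ 2 * |θ| / θ₀ * Real.exp (θ₀ * τ) := by
    -- `|e^z - 1| ≤ |z| e^{|z|}` and `z ≤ e^z`
    have h1 : |Real.exp (θ * τ) - 1| ≤ |θ * τ| * Real.exp |θ * τ| := by
      have a1 := Real.add_one_le_exp (θ * τ)
      have a2 := Real.add_one_le_exp (-(θ * τ))
      have a3 : Real.exp (θ * τ) * Real.exp (-(θ * τ)) = 1 := by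
        rw [← Real.exp_add, add_neg_cancel, Real.exp_zero]
      have a4 := Real.exp_pos (θ * τ)
      rcases le_or_gt 0 (θ * τ) with hz | hz
      · rw [abs_of_nonneg hz, abs_of_nonneg (by linarith)]
        nlinarith
      · rw [abs_of_neg hz, abs_of_nonpos (by rw [sub_nonpos, Real.exp_le_one_iff]; exact hz.le)]
        have a5 := Real.add_one_le_exp (θ * τ)
        have a6 : 1 ≤ Real.exp (-(θ * τ)) := by linarith
        nlinarith
    have h2 : |θ * τ| = |θ| * τ := by rw [abs_mul, abs_of_pos hτ]
    have h3 : θ₀ / 2 * τ ≤ Real.exp (θ₀ / 2 * τ) := by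
      linarith [Real.add_one_le_exp (θ₀ / 2 * τ)]
    have h4 : τ ≤ 2 / θ₀ * Real.exp (θ₀ / 2 * τ) := by
      rw [div_mul_eq_mul_div, le_div_iff₀ h0]; linarith
    calc |Real.exp (θ * τ) - 1| ≤ |θ| * τ * Real.exp (|θ| * τ) := by rwa [h2] at h1
      _ ≤ |θ| * (2 / θ₀ * Real.exp (θ₀ / 2 * τ)) * Real.exp (θ₀ / 2 * τ) := by gcongr
      _ = 2 * |θ| / θ₀ * (Real.exp (θ₀ / 2 * τ) * Real.exp (θ₀ / 2 * τ)) := by ring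
      _ = _ := by rw [← Real.exp_add]; congr 2; ring
  rw [e, enorm_smul, enorm_expKernel, ← mul_assoc]
  gcongr
  rw [← ofReal_norm, Complex.norm_real, Real.norm_eq_abs]
  calc _ ≤ ENNReal.ofReal (2 * |θ| / θ₀ * Real.exp (θ₀ * τ)) := ENNReal.ofReal_le_ofReal key
    _ = _ := by rw [ENNReal.ofReal_mul (by positivity)]; rfl

variable {p p₂ : ℝ≥0∞} [Fact (1 ≤ p)] [Fact (1 ≤ p₂)]

lemma HasConv.mono {C C' : ℝ} (h : HasConv ι k p p₂ C) (hC : C ≤ C') : HasConv ι k p p₂ C' := by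
  obtain ⟨T, hT, hn⟩ := h
  exact ⟨T, hT, hn.trans hC⟩

/-- A kernel bounded by `a k'` inherits from `k'` the bound for the convolution operator, with the
factor `a`. -/
lemma KernelBound.hasConv_of_le [TopologicalSpace.SeparableSpace Y] (hι : DenseRange ι)
    (hp₂ : p₂ ≠ ∞) (hle : p ≤ p₂) (h : KernelBound ι k' p.toReal m) (hm : ∫⁻ τ, m τ ≠ ∞)
    {M : ℝ≥0∞} (hM : ∀ τ, m τ ≤ M) {C : ℝ≥0}
    (hC : M ^ (p₂.toReal / p.toReal - 1) * ∫⁻ τ, m τ ≤ (C : ℝ≥0∞) ^ p₂.toReal) (a : ℝ≥0)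
    (hk : ∀ x, AEStronglyMeasurable (fun τ => k τ x) volume)
    (hka : ∀ x τ, ‖k τ x‖ₑ ≤ a * ‖k' τ x‖ₑ) : HasConv ι k p p₂ (a * C) := by
  have hp : p ≠ ∞ := ne_top_of_le_ne_top hp₂ hle
  have hp0 : 0 < p.toReal := ENNReal.toReal_pos (zero_lt_one.trans_le (Fact.out : 1 ≤ p)).ne' hp
  have hp₂0 : 0 < p₂.toReal :=
    ENNReal.toReal_pos (zero_lt_one.trans_le (Fact.out : 1 ≤ p₂)).ne' hp₂
  have hexp : 0 ≤ p₂.toReal / p.toReal - 1 := by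
    rw [sub_nonneg, one_le_div hp0]; exact ENNReal.toReal_mono hp₂ hle
  have hne : (a : ℝ≥0∞) ^ p.toReal ≠ ∞ :=
    ENNReal.rpow_ne_top_of_nonneg hp0.le ENNReal.coe_ne_top
  have h' := h.of_le hp0 hk a hka
  have e := lintegral_const_mul (μ := volume) ((a : ℝ≥0∞) ^ p.toReal) h.measurable
  have := h'.hasConv hι (p₂ := p₂) hp₂ hle (by rw [e]; exact ENNReal.mul_ne_top hne hm)
    (M := (a : ℝ≥0∞) ^ p.toReal * M) (fun τ => mul_le_mul_right (hM τ) _) (C := a * C) (by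
      rw [e, ENNReal.mul_rpow_of_nonneg _ _ hexp, ENNReal.coe_mul,
        ENNReal.mul_rpow_of_nonneg _ _ hp₂0.le]
      have e2 : ((a : ℝ≥0∞) ^ p.toReal) ^ (p₂.toReal / p.toReal - 1) * (a : ℝ≥0∞) ^ p.toReal
          = (a : ℝ≥0∞) ^ p₂.toReal := by
        conv_lhs =>
          arg 2
          rw [← ENNReal.rpow_one ((a : ℝ≥0∞) ^ p.toReal)]
        rw [← ENNReal.rpow_add_of_nonneg _ _ hexp zero_le_one, ← ENNReal.rpow_mul]
        congr 1
        field_simp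
        ring
      calc _ = (((a : ℝ≥0∞) ^ p.toReal) ^ (p₂.toReal / p.toReal - 1) * (a : ℝ≥0∞) ^ p.toReal)
            * (M ^ (p₂.toReal / p.toReal - 1) * ∫⁻ τ, m τ) := by ring
        _ ≤ _ := by rw [e2]; gcongr)
  exact_mod_cast this

end KernelBounds

/-! ### Splitting of the kernel `B* e^{A*τ}` -/

section System

variable {Y U : Type*}
  [NormedAddCommGroup Y] [InnerProductSpace ℂ Y] [CompleteSpace Y]
  [NormedAddCommGroup U] [InnerProductSpace ℂ U] [CompleteSpace U]
  (S : C0Semigroup Y) (B : U →L[ℂ] Extrapolation S) (F : ℝ → Y →L[ℂ] U)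

/-- The singular part `F(τ)` of the kernel for `0 < τ < κ`. The norm of the convolution
with it tends to `0` with `κ`. -/
def smallKernel (κ τ : ℝ) : DomAdj S →ₗ[ℂ] U :=
  if τ ∈ Ioo 0 κ then (F τ).toLinearMap ∘ₗ domIncl S else 0

/-- The remaining part of the kernel: `G(τ)` for `0 < τ < κ` and `B* e^{A*τ}` for `τ ≥ κ`. -/
def regKernel (κ τ : ℝ) : DomAdj S →ₗ[ℂ] U :=
  sysKernel S B τ - smallKernel S F κ τ

lemma smallKernel_add_regKernel (κ : ℝ) :
    smallKernel S F κ + regKernel S B F κ = sysKernel S B := by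
  funext τ; simp [regKernel]

variable {S B F} {κ : ℝ}

lemma smallKernel_of_mem {τ : ℝ} (h : τ ∈ Ioo 0 κ) (x : DomAdj S) :
    smallKernel S F κ τ x = F τ x.1.1 := by
  rw [smallKernel, if_pos h]; rfl

lemma smallKernel_of_notMem {τ : ℝ} (h : τ ∉ Ioo 0 κ) : smallKernel S F κ τ = 0 := by
  rw [smallKernel, if_neg h]

lemma smallKernel_of_nonpos : ∀ τ ≤ 0, smallKernel S F κ τ = 0 :=
  fun _ hτ => smallKernel_of_notMem fun h => not_lt.2 hτ h.1

lemma regKernel_of_nonpos : ∀ τ ≤ 0, regKernel S B F κ τ = 0 := fun τ hτ => by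
  rw [regKernel, smallKernel_of_nonpos τ hτ, sysKernel_of_nonpos hτ, sub_zero]

lemma regKernel_of_ge {τ : ℝ} (hτ : κ ≤ τ) :
    regKernel S B F κ τ = sysKernel S B τ := by
  rw [regKernel, smallKernel_of_notMem fun h => not_lt.2 hτ h.2, sub_zero]

variable {G : ℝ → DomAdj S →L[ℂ] U}

lemma regKernel_of_mem
    (hdec : ∀ t : ℝ, 0 < t → ∀ x : DomAdj S, controlAdj S B (adjOpDom S t x) = F t x.1.1 + G t x)
    {τ : ℝ} (h : τ ∈ Ioo 0 κ) (x : DomAdj S) : regKernel S B F κ τ x = G τ x := by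
  rw [regKernel, LinearMap.sub_apply, smallKernel_of_mem h, sysKernel_of_pos h.1, hdec τ h.1,
    add_sub_cancel_left]

lemma aestronglyMeasurable_smallKernel [TopologicalSpace.SeparableSpace U]
    (hdec : ∀ t : ℝ, 0 < t → ∀ x : DomAdj S, controlAdj S B (adjOpDom S t x) = F t x.1.1 + G t x)
    {x : DomAdj S} (hG : AEStronglyMeasurable (fun t => G t x) (volume.restrict (Ioo 0 κ))) :
    AEStronglyMeasurable (fun τ => smallKernel S F κ τ x) volume := by
  have e : (fun τ => smallKernel S F κ τ x)
      = (Ioo 0 κ).indicator fun τ => sysKernel S B τ x - G τ x := by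
    funext τ
    by_cases h : τ ∈ Ioo 0 κ
    · rw [indicator_of_mem h, smallKernel_of_mem h, sysKernel_of_pos h.1, hdec τ h.1,
        add_sub_cancel_right]
    · rw [indicator_of_notMem h, smallKernel_of_notMem h]; rfl
  rw [e, aestronglyMeasurable_indicator_iff measurableSet_Ioo]
  exact (aestronglyMeasurable_sysKernel x).restrict.sub hG

/-- The kernel away from `0`: the singularity of `F` is not met. -/
lemma exists_lintegral_sysKernel_le
    (hdec : ∀ t : ℝ, 0 < t → ∀ x : DomAdj S, controlAdj S B (adjOpDom S t x) = F t x.1.1 + G t x)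
    {a T p N : ℝ} (hp : 1 ≤ p) (hF : ∀ t ∈ Ico a T, ‖F t‖ ≤ N) (ha : 0 < a) {C : ℝ≥0∞} (hC : C ≠ ∞)
    (hG : ∀ x : DomAdj S, ∫⁻ t in Ioo 0 T, ‖G t x‖ₑ ^ p ≤ C * ‖x.1.1‖ₑ ^ p) :
    ∃ C' : ℝ≥0∞, C' ≠ ∞ ∧ ∀ x : DomAdj S,
      ∫⁻ t in Ico a T, ‖sysKernel S B t x‖ₑ ^ p ≤ C' * ‖x.1.1‖ₑ ^ p := by
  have hp0 : 0 < p := by linarith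
  refine ⟨2 ^ (p - 1) * (ENNReal.ofReal N ^ p * volume (Ico a T) + C), ?_, fun x => ?_⟩
  · refine ENNReal.mul_ne_top (ENNReal.rpow_ne_top_of_nonneg (by linarith) (by simp))
      (ENNReal.add_ne_top.2 ⟨ENNReal.mul_ne_top
        (ENNReal.rpow_ne_top_of_nonneg hp0.le ENNReal.ofReal_ne_top) ?_, hC⟩)
    exact measure_Ico_lt_top.ne
  · have h2 : (2 : ℝ≥0∞) ^ (p - 1) ≠ ∞ := ENNReal.rpow_ne_top_of_nonneg (by linarith) (by simp)
    calc ∫⁻ t in Ico a T, ‖sysKernel S B t x‖ₑ ^ p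
        ≤ ∫⁻ t in Ico a T, 2 ^ (p - 1) * ((ENNReal.ofReal N * ‖x.1.1‖ₑ) ^ p + ‖G t x‖ₑ ^ p) := by
          refine setLIntegral_mono' measurableSet_Ico fun t ht => ?_
          rw [sysKernel_of_pos (ha.trans_le ht.1), hdec t (ha.trans_le ht.1)]
          have h1 : ‖F t x.1.1‖ₑ ≤ ENNReal.ofReal N * ‖x.1.1‖ₑ := by
            refine ((F t).le_opENorm _).trans ?_
            gcongr
            rw [← ofReal_norm]
            exact ENNReal.ofReal_le_ofReal (hF t ht)
          calc _ ≤ (ENNReal.ofReal N * ‖x.1.1‖ₑ + ‖G t x‖ₑ) ^ p :=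
                ENNReal.rpow_le_rpow ((enorm_add_le _ _).trans (by gcongr)) hp0.le
            _ ≤ _ := ENNReal.rpow_add_le_mul_rpow_add_rpow _ _ hp
      _ = 2 ^ (p - 1) * ((ENNReal.ofReal N * ‖x.1.1‖ₑ) ^ p * volume (Ico a T)
            + ∫⁻ t in Ico a T, ‖G t x‖ₑ ^ p) := by
          rw [lintegral_const_mul' _ _ h2, lintegral_add_left measurable_const, setLIntegral_const]
      _ ≤ 2 ^ (p - 1) * ((ENNReal.ofReal N * ‖x.1.1‖ₑ) ^ p * volume (Ico a T)
            + C * ‖x.1.1‖ₑ ^ p) := by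
          gcongr
          exact (lintegral_mono_set fun t (ht : t ∈ Ico a T) =>
            (⟨ha.trans_le ht.1, ht.2⟩ : t ∈ Ioo 0 T)).trans (hG x)
      _ = _ := by rw [ENNReal.mul_rpow_of_nonneg _ _ hp0.le]; ring

/-- The kernel on `[κ,∞)` with a weight `e^{bτ}`, `b < ω`. The half-line is covered by translates
of `[κ/2, 3κ/2)`, and `B* e^{A*(τ+a)} = B* e^{A*τ} e^{A*a}`. -/
lemma exists_lintegral_tail_le {κ p b ω M : ℝ} (hκ : 0 < κ) (hp : 1 ≤ p) (hb : 0 ≤ b) (hbω : b < ω)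
    (hM : 0 ≤ M) (hS : ∀ t : ℝ, 0 ≤ t → ‖S.op t‖ ≤ M * Real.exp (-ω * t)) {C : ℝ≥0∞} (hC : C ≠ ∞)
    (hloc : ∀ x : DomAdj S, ∫⁻ t in Ico (κ / 2) (3 * κ / 2), ‖sysKernel S B t x‖ₑ ^ p
      ≤ C * ‖x.1.1‖ₑ ^ p) :
    ∃ C' : ℝ≥0∞, C' ≠ ∞ ∧ ∀ x : DomAdj S,
      ∫⁻ t in Ici κ, (ENNReal.ofReal (Real.exp (b * t)) * ‖sysKernel S B t x‖ₑ) ^ p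
        ≤ C' * ‖x.1.1‖ₑ ^ p := by
  have hp0 : 0 < p := by linarith
  set ρ : ℝ≥0∞ := ENNReal.ofReal (Real.exp (-(ω - b) * κ)) ^ p with hρ
  set A : ℝ≥0∞ := C * ENNReal.ofReal (M * Real.exp (2 * b * κ - ω * κ / 2)) ^ p with hA
  have hA' : A ≠ ∞ := ENNReal.mul_ne_top hC
    (ENNReal.rpow_ne_top_of_nonneg hp0.le ENNReal.ofReal_ne_top)
  have hρ1 : ρ < 1 := by
    refine ENNReal.rpow_lt_one ?_ hp0
    rw [ENNReal.ofReal_lt_one, Real.exp_lt_one_iff]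
    nlinarith
  have hcover : Ici κ ⊆ ⋃ n : ℕ, Ico ((n + 1) * κ) ((n + 2) * κ) := by
    intro t ht
    have ht1 : 1 ≤ t / κ := by rw [one_le_div hκ]; exact ht
    have h1 := Nat.floor_le (a := t / κ - 1) (by linarith)
    have h2 := Nat.lt_floor_add_one (t / κ - 1)
    refine mem_iUnion.2 ⟨⌊t / κ - 1⌋₊, ?_, ?_⟩
    · rw [← le_div_iff₀ hκ]; linarith
    · rw [← div_lt_iff₀ hκ]; linarith
  have hpiece : ∀ (x : DomAdj S) (n : ℕ), ∫⁻ t in Ico ((n + 1) * κ) ((n + 2) * κ),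
      (ENNReal.ofReal (Real.exp (b * t)) * ‖sysKernel S B t x‖ₑ) ^ p
        ≤ A * ‖x.1.1‖ₑ ^ p * ρ ^ n := by
    intro x n
    -- the shift by `a` takes `[κ/2, 3κ/2)` to the `n`-th interval of the cover
    set a : ℝ := (n + 1 / 2) * κ with ha
    have ha0 : 0 ≤ a := by positivity
    have hpre : (fun t : ℝ => t + a) ⁻¹' Ico ((n + 1) * κ) ((n + 2) * κ)
        = Ico (κ / 2) (3 * κ / 2) := by
      ext t
      simp only [mem_preimage, mem_Ico, ha]
      constructor
      · rintro ⟨h1, h2⟩; constructor <;> linarith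
      · rintro ⟨h1, h2⟩; constructor <;> linarith
    rw [← (measurePreserving_add_right volume a).setLIntegral_comp_preimage_emb
      (measurableEmbedding_addRight a), hpre]
    set w : ℝ≥0∞ := ENNReal.ofReal (Real.exp (b * ((n + 2) * κ))) with hw
    have hwt : w ^ p ≠ ∞ := ENNReal.rpow_ne_top_of_nonneg hp0.le ENNReal.ofReal_ne_top
    have hx : ‖(adjOpDom S a x).1.1‖ₑ ≤ ENNReal.ofReal (M * Real.exp (-ω * a)) * ‖x.1.1‖ₑ := by
      rw [adjOpDom_of_nonneg S ha0]
      refine ((adjOp S a).le_opENorm _).trans ?_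
      gcongr
      rw [← ofReal_norm, adjOp, LinearIsometryEquiv.norm_map]
      exact ENNReal.ofReal_le_ofReal (hS a ha0)
    have hfac : w * ENNReal.ofReal (M * Real.exp (-ω * a))
        = ENNReal.ofReal (M * Real.exp (2 * b * κ - ω * κ / 2))
          * ENNReal.ofReal (Real.exp (-(ω - b) * κ)) ^ n := by
      rw [hw, ← ENNReal.ofReal_pow (Real.exp_nonneg _), ← ENNReal.ofReal_mul (Real.exp_nonneg _),
        ← ENNReal.ofReal_mul (by positivity)]
      congr 1
      rw [← Real.exp_nat_mul, mul_left_comm, ← Real.exp_add, mul_assoc, ← Real.exp_add]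
      congr 2
      rw [ha]; ring
    calc ∫⁻ t in Ico (κ / 2) (3 * κ / 2),
          (ENNReal.ofReal (Real.exp (b * (t + a))) * ‖sysKernel S B (t + a) x‖ₑ) ^ p
        ≤ ∫⁻ t in Ico (κ / 2) (3 * κ / 2), w ^ p * ‖sysKernel S B t (adjOpDom S a x)‖ₑ ^ p := by
          refine setLIntegral_mono' measurableSet_Ico fun t ht => ?_
          rw [sysKernel_add ha0 (by linarith [ht.1]), ← ENNReal.mul_rpow_of_nonneg _ _ hp0.le]
          gcongr
          rw [hw]
          gcongr
          have := ht.2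
          rw [ha]; linarith
      _ = w ^ p * ∫⁻ t in Ico (κ / 2) (3 * κ / 2), ‖sysKernel S B t (adjOpDom S a x)‖ₑ ^ p :=
          lintegral_const_mul' _ _ hwt
      _ ≤ w ^ p * (C * (ENNReal.ofReal (M * Real.exp (-ω * a)) * ‖x.1.1‖ₑ) ^ p) := by
          gcongr
          exact (hloc _).trans (by gcongr)
      _ = C * (w * ENNReal.ofReal (M * Real.exp (-ω * a))) ^ p * ‖x.1.1‖ₑ ^ p := by
          rw [ENNReal.mul_rpow_of_nonneg _ _ hp0.le, ENNReal.mul_rpow_of_nonneg _ _ hp0.le]; ring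
      _ = A * ‖x.1.1‖ₑ ^ p * ρ ^ n := by
          rw [hfac, ENNReal.mul_rpow_of_nonneg _ _ hp0.le, hA, hρ, ← ENNReal.rpow_natCast,
            ← ENNReal.rpow_natCast, ← ENNReal.rpow_mul, ← ENNReal.rpow_mul, mul_comm (n : ℝ) p]
          ring
  refine ⟨A * (1 - ρ)⁻¹, ENNReal.mul_ne_top hA' (ENNReal.inv_ne_top.2 (tsub_pos_of_lt hρ1).ne'),
    fun x => ?_⟩
  calc _ ≤ ∫⁻ t in ⋃ n : ℕ, Ico ((n + 1) * κ) ((n + 2) * κ),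
          (ENNReal.ofReal (Real.exp (b * t)) * ‖sysKernel S B t x‖ₑ) ^ p :=
        lintegral_mono_set hcover
    _ ≤ ∑' n : ℕ, ∫⁻ t in Ico ((n + 1) * κ) ((n + 2) * κ),
          (ENNReal.ofReal (Real.exp (b * t)) * ‖sysKernel S B t x‖ₑ) ^ p :=
        lintegral_iUnion_le _ _
    _ ≤ ∑' n : ℕ, A * ‖x.1.1‖ₑ ^ p * ρ ^ n := ENNReal.tsum_le_tsum (hpiece x)
    _ = A * (1 - ρ)⁻¹ * ‖x.1.1‖ₑ ^ p := by
        rw [ENNReal.tsum_mul_left, ENNReal.tsum_geometric]; ring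

/-- The regular part of the kernel, with a weight `e^{bτ}`, `b < ω`, is bounded from `Y` to
`L^p(0,∞;U)`. -/
lemma exists_lintegral_regKernel_le
    (hdec : ∀ t : ℝ, 0 < t → ∀ x : DomAdj S, controlAdj S B (adjOpDom S t x) = F t x.1.1 + G t x)
    {κ T p b : ℝ} (hκT : κ ≤ T) (hp : 1 ≤ p) (hb : 0 ≤ b) {C₁ C₂ : ℝ≥0∞}
    (hC₁ : C₁ ≠ ∞) (hC₂ : C₂ ≠ ∞)
    (hG : ∀ x : DomAdj S, ∫⁻ t in Ioo 0 T, ‖G t x‖ₑ ^ p ≤ C₁ * ‖x.1.1‖ₑ ^ p)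
    (htail : ∀ x : DomAdj S,
      ∫⁻ t in Ici κ, (ENNReal.ofReal (Real.exp (b * t)) * ‖sysKernel S B t x‖ₑ) ^ p
        ≤ C₂ * ‖x.1.1‖ₑ ^ p) :
    ∃ C : ℝ≥0∞, C ≠ ∞ ∧ ∀ x : DomAdj S,
      ∫⁻ t, (ENNReal.ofReal (Real.exp (b * t)) * ‖regKernel S B F κ t x‖ₑ) ^ p
        ≤ C * ‖x.1.1‖ₑ ^ p := by
  have hp0 : 0 < p := by linarith
  set w : ℝ≥0∞ := ENNReal.ofReal (Real.exp (b * κ)) ^ p with hw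
  have hwt : w ≠ ∞ := ENNReal.rpow_ne_top_of_nonneg hp0.le ENNReal.ofReal_ne_top
  refine ⟨w * C₁ + C₂, ENNReal.add_ne_top.2 ⟨ENNReal.mul_ne_top hwt hC₁, hC₂⟩, fun x => ?_⟩
  set f : ℝ → ℝ≥0∞ :=
    fun t => (ENNReal.ofReal (Real.exp (b * t)) * ‖regKernel S B F κ t x‖ₑ) ^ p with hf
  have h1 : ∫⁻ t in Iic 0, f t = 0 := by
    refine (setLIntegral_congr_fun measurableSet_Iic fun t ht => ?_).trans lintegral_zero
    simp only [hf, regKernel_of_nonpos t ht, LinearMap.zero_apply, enorm_zero, mul_zero]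
    exact ENNReal.zero_rpow_of_pos hp0
  have h2 : ∫⁻ t in Ioo 0 κ, f t ≤ w * C₁ * ‖x.1.1‖ₑ ^ p := by
    calc ∫⁻ t in Ioo 0 κ, f t ≤ ∫⁻ t in Ioo 0 κ, w * ‖G t x‖ₑ ^ p := by
          refine setLIntegral_mono' measurableSet_Ioo fun t ht => ?_
          simp only [hf, regKernel_of_mem hdec ht]
          rw [ENNReal.mul_rpow_of_nonneg _ _ hp0.le, hw]
          gcongr
          exact ht.2.le
      _ = w * ∫⁻ t in Ioo 0 κ, ‖G t x‖ₑ ^ p := lintegral_const_mul' _ _ hwt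
      _ ≤ w * (C₁ * ‖x.1.1‖ₑ ^ p) := by
          gcongr
          exact (lintegral_mono_set (Ioo_subset_Ioo_right hκT)).trans (hG x)
      _ = _ := by ring
  have h3 : ∫⁻ t in Ici κ, f t ≤ C₂ * ‖x.1.1‖ₑ ^ p := by
    refine (setLIntegral_congr_fun measurableSet_Ici fun t ht => ?_).trans_le (htail x)
    simp only [hf, regKernel_of_ge ht]
  have hcov : (univ : Set ℝ) ⊆ Iic 0 ∪ (Ioo 0 κ ∪ Ici κ) := by
    intro t _
    rcases le_or_gt t 0 with ht | ht
    · exact Or.inl ht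
    · rcases lt_or_ge t κ with ht' | ht'
      · exact Or.inr (Or.inl ⟨ht, ht'⟩)
      · exact Or.inr (Or.inr ht')
  calc ∫⁻ t, f t = ∫⁻ t in univ, f t := setLIntegral_univ f |>.symm
    _ ≤ ∫⁻ t in Iic 0 ∪ (Ioo 0 κ ∪ Ici κ), f t := lintegral_mono_set hcov
    _ ≤ (∫⁻ t in Iic 0, f t) + ((∫⁻ t in Ioo 0 κ, f t) + ∫⁻ t in Ici κ, f t) :=
        (lintegral_union_le f _ _).trans (by gcongr; exact lintegral_union_le f _ _)
    _ ≤ 0 + (w * C₁ * ‖x.1.1‖ₑ ^ p + C₂ * ‖x.1.1‖ₑ ^ p) := by rw [h1]; gcongr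
    _ = _ := by ring

end System

/-! ### From kernel bounds to a splitting -/

section Bounds

variable {D Y U : Type*} [AddCommGroup D] [Module ℂ D]
  [NormedAddCommGroup Y] [InnerProductSpace ℂ Y] [CompleteSpace Y]
  [TopologicalSpace.SeparableSpace Y]
  [NormedAddCommGroup U] [InnerProductSpace ℂ U] [CompleteSpace U]
  {ι : D →ₗ[ℂ] Y} {k ks kb : ℝ → D →ₗ[ℂ] U} {p p₂ q q' : ℝ≥0∞} [Fact (1 ≤ p)] [Fact (1 ≤ p₂)]
  [Fact (1 ≤ q)] [Fact (1 ≤ q')]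

/-- Young's inequality for a kernel with an integrable operator norm. -/
lemma hasConv_of_norm_le (hι : DenseRange ι) (hp1 : 1 < p) (hp : p ≠ ∞)
    (hk : ∀ x, AEStronglyMeasurable (fun τ => k τ x) volume) {φ : ℝ → ℝ≥0∞} (hφ : Measurable φ)
    (hle : ∀ x τ, ‖k τ x‖ₑ ≤ φ τ * ‖ι x‖ₑ) {c : ℝ≥0} (hc : ∫⁻ τ, φ τ ≤ c) :
    HasConv ι k p p c := by
  set r := p.toReal with hr
  have hr1 : 1 < r := by
    rw [hr, ← ENNReal.toReal_one]; exact (ENNReal.toReal_lt_toReal (by simp) hp).2 hp1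
  have hconj : r.HolderConjugate (r / (r - 1)) := Real.HolderConjugate.conjExponent hr1
  set r' := r / (r - 1)
  have hr0 : 0 < r := hconj.pos
  have hr'0 : 0 < r' := hconj.symm.pos
  set A : ℝ≥0∞ := ∫⁻ τ, φ τ with hA
  have hA' : A ≠ ∞ := ne_top_of_le_ne_top ENNReal.coe_ne_top hc
  have hφr : ∀ τ, (φ τ ^ (1 / r)) ^ r = φ τ := fun τ => by
    rw [← ENNReal.rpow_mul, one_div_mul_cancel hr0.ne', ENNReal.rpow_one]
  have hφr' : ∀ τ, (φ τ ^ (1 / r')) ^ r' = φ τ := fun τ => by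
    rw [← ENNReal.rpow_mul, one_div_mul_cancel hr'0.ne', ENNReal.rpow_one]
  have hsum : 1 / r' + 1 / r = 1 := by
    rw [one_div, one_div, add_comm]; exact hconj.inv_add_inv_eq_one
  have hb := KernelBound.of_holder (ι := ι) hconj hk (φ := fun τ => φ τ ^ (1 / r)) (hφ.pow_const _)
    (ψ := fun x τ => φ τ ^ (1 / r') * ‖ι x‖ₑ) (fun x => ((hφ.pow_const _).mul_const _).aemeasurable)
    (A := A) (fun x τ => by
      refine (hle x τ).trans_eq ?_
      rw [mul_right_comm, ← ENNReal.rpow_add_of_nonneg _ _ (by positivity) (by positivity), hsum,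
        ENNReal.rpow_one])
    (fun x => by
      simp only [ENNReal.mul_rpow_of_nonneg _ _ hr'0.le, hφr']
      rw [lintegral_mul_const _ hφ])
  simp only [hφr] at hb
  have hint : ∫⁻ τ, A ^ (r / r') * φ τ = A ^ r := by
    rw [lintegral_const_mul _ hφ, ← hA]
    nth_rewrite 2 [← ENNReal.rpow_one A]
    rw [← ENNReal.rpow_add_of_nonneg _ _ (by positivity) zero_le_one]
    congr 1
    have : r * (1 / r' + 1 / r) = r * 1 := by rw [hsum]
    rw [mul_add, mul_one_div_cancel hr0.ne', mul_one, mul_one_div] at this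
    exact this
  -- the supremum of the dominating function enters with the exponent `0`
  refine hb.hasConv hι hp le_rfl (M := ∞)
    (by rw [hint]; exact ENNReal.rpow_ne_top_of_nonneg hr0.le hA') (fun _ => le_top) ?_
  rw [hint, div_self hr0.ne', sub_self, ENNReal.rpow_zero, one_mul]
  gcongr

/-- A kernel whose product with `e^{(θ₀+b)τ}`, `b > 0`, is bounded from `Y` to every
`L^r(0,∞;U)`, `r < ∞`, defines a convolution from `L^p` to `L^{p₂}`, `p ≤ p₂`. -/
lemma exists_hasConv_of_lintegral_le (hι : DenseRange ι) (hp1 : 1 < p) (hp₂ : p₂ ≠ ∞) (hle : p ≤ p₂)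
    (hk : ∀ x, AEStronglyMeasurable (fun τ => k τ x) volume) (hk0 : ∀ τ ≤ 0, k τ = 0)
    {θ₀ b : ℝ} (hb : 0 < b)
    (hint : ∀ r : ℝ, 1 ≤ r → ∃ A : ℝ≥0∞, A ≠ ∞ ∧ ∀ x,
      ∫⁻ t, (ENNReal.ofReal (Real.exp ((θ₀ + b) * t)) * ‖k t x‖ₑ) ^ r ≤ A * ‖ι x‖ₑ ^ r) :
    ∃ C : ℝ≥0, ∀ (a : ℝ≥0) (k' : ℝ → D →ₗ[ℂ] U),
      (∀ x, AEStronglyMeasurable (fun τ => k' τ x) volume) →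
      (∀ x τ, ‖k' τ x‖ₑ ≤ a * ‖expKernel θ₀ k τ x‖ₑ) → HasConv ι k' p p₂ (a * C) := by
  have hp : p ≠ ∞ := ne_top_of_le_ne_top hp₂ hle
  have hp₂0 : 0 < p₂.toReal :=
    ENNReal.toReal_pos (zero_lt_one.trans_le (Fact.out : 1 ≤ p₂)).ne' hp₂
  set r := p.toReal with hr
  have hr1 : 1 < r := by
    rw [hr, ← ENNReal.toReal_one]; exact (ENNReal.toReal_lt_toReal (by simp) hp).2 hp1
  have hconj : r.HolderConjugate (r / (r - 1)) := Real.HolderConjugate.conjExponent hr1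
  set r' := r / (r - 1)
  have hr0 : 0 < r := hconj.pos
  have hr'0 : 0 < r' := hconj.symm.pos
  obtain ⟨A, hA, hAx⟩ := hint r' hconj.symm.lt.le
  -- the surplus weight `e^{bτ}` makes `φ`, and with it the dominating function, integrable
  set φ : ℝ → ℝ≥0∞ := (Ioi 0).indicator fun τ => ENNReal.ofReal (Real.exp (-b * τ)) with hφ
  have hφm : Measurable φ := by
    have : Continuous fun τ : ℝ => Real.exp (-b * τ) := by fun_prop
    exact (this.measurable.ennreal_ofReal).indicator measurableSet_Ioi
  have hφ1 : ∀ τ, φ τ ^ r ≤ 1 := fun τ => by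
    refine ENNReal.rpow_le_one ?_ hr0.le
    by_cases h : τ ∈ Ioi (0 : ℝ)
    · rw [hφ, indicator_of_mem h, ENNReal.ofReal_le_one, Real.exp_le_one_iff]
      have : (0 : ℝ) < τ := h
      nlinarith
    · rw [hφ, indicator_of_notMem h]; exact zero_le
  have hφi : ∫⁻ τ, φ τ ^ r ≠ ∞ := by
    have e : (fun τ => φ τ ^ r)
        = (Ioi 0).indicator fun τ => ENNReal.ofReal (Real.exp (-(b * r) * τ)) := by
      funext τ
      by_cases h : τ ∈ Ioi (0 : ℝ)
      · rw [hφ, indicator_of_mem h, indicator_of_mem h,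
          ENNReal.ofReal_rpow_of_pos (Real.exp_pos _), ← Real.exp_mul]
        congr 2; ring
      · rw [hφ, indicator_of_notMem h, indicator_of_notMem h, ENNReal.zero_rpow_of_pos hr0]
    rw [e, lintegral_indicator measurableSet_Ioi]
    exact (exp_neg_integrableOn_Ioi 0 (by positivity : 0 < b * r)).lintegral_lt_top.ne
  have hAr : A ^ (r / r') ≠ ∞ := ENNReal.rpow_ne_top_of_nonneg (by positivity) hA
  have hbound := KernelBound.of_holder (ι := ι) (k := expKernel θ₀ k) hconj
    (fun x => aestronglyMeasurable_expKernel θ₀ (hk x)) hφm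
    (ψ := fun x τ => ENNReal.ofReal (Real.exp ((θ₀ + b) * τ)) * ‖k τ x‖ₑ)
    (fun x => by
      have : Continuous fun τ : ℝ => Real.exp ((θ₀ + b) * τ) := by fun_prop
      exact this.measurable.ennreal_ofReal.aemeasurable.mul (hk x).enorm)
    (A := A) (fun x τ => by
      rw [enorm_expKernel]
      by_cases h : τ ∈ Ioi (0 : ℝ)
      · rw [hφ, indicator_of_mem h, mul_right_comm, ← ENNReal.ofReal_mul (Real.exp_nonneg _),
          ← Real.exp_add]
        refine le_of_eq ?_
        congr 3; ring
      · simp [hk0 τ (not_lt.1 h)])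
    hAx
  have hmi : ∫⁻ τ, A ^ (r / r') * φ τ ^ r ≠ ∞ := by
    rw [lintegral_const_mul' _ _ hAr]; exact ENNReal.mul_ne_top hAr hφi
  have hexp : 0 ≤ p₂.toReal / r - 1 := by
    rw [sub_nonneg, one_le_div hr0]; exact ENNReal.toReal_mono hp₂ hle
  set J : ℝ≥0∞ := (A ^ (r / r')) ^ (p₂.toReal / r - 1) * ∫⁻ τ, A ^ (r / r') * φ τ ^ r with hJ
  have hJt : J ≠ ∞ := ENNReal.mul_ne_top (ENNReal.rpow_ne_top_of_nonneg hexp hAr) hmi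
  have hJt' : J ^ (1 / p₂.toReal) ≠ ∞ := ENNReal.rpow_ne_top_of_nonneg (by positivity) hJt
  refine ⟨(J ^ (1 / p₂.toReal)).toNNReal, fun a k' hk' hka => ?_⟩
  refine hbound.hasConv_of_le hι hp₂ hle hmi (M := A ^ (r / r'))
    (fun τ => mul_le_of_le_one_right' (hφ1 τ)) ?_ a hk' hka
  change J ≤ _
  rw [ENNReal.coe_toNNReal hJt', ← ENNReal.rpow_mul, one_div_mul_cancel hp₂0.ne', ENNReal.rpow_one]

/-- The bounds which make two kernels a splitting. -/
lemma exists_splitting (hι : DenseRange ι) (hq1 : 1 < q) (hq2 : q ≤ 2) (hq' : 2 ≤ q')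
    (hq't : q' ≠ ∞) {θ₀ b : ℝ} (hθ₀ : 0 < θ₀) (hb : 0 < b)
    (hs : ∀ x, AEStronglyMeasurable (fun τ => ks τ x) volume) (hs0 : ∀ τ ≤ 0, ks τ = 0)
    {φ : ℝ → ℝ≥0∞} (hφ : Measurable φ)
    (hle : ∀ x τ, ‖expKernel θ₀ ks τ x‖ₑ ≤ φ τ * ‖ι x‖ₑ) {c : ℝ≥0} (hc : ∫⁻ τ, φ τ ≤ c)
    (hk : ∀ x, AEStronglyMeasurable (fun τ => kb τ x) volume) (hk0 : ∀ τ ≤ 0, kb τ = 0)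
    (hint : ∀ r : ℝ, 1 ≤ r → ∃ A : ℝ≥0∞, A ≠ ∞ ∧ ∀ x,
      ∫⁻ t, (ENNReal.ofReal (Real.exp ((θ₀ + b) * t)) * ‖kb t x‖ₑ) ^ r ≤ A * ‖ι x‖ₑ ^ r) :
    ∃ C : ℝ, Splitting ι ks kb q q' θ₀ c C := by
  have h12 : (1 : ℝ≥0∞) < 2 := by norm_num
  have h2t : (2 : ℝ≥0∞) ≠ ∞ := by norm_num
  have hqt : q ≠ ∞ := ne_top_of_le_ne_top h2t hq2
  obtain ⟨C₁, h₁⟩ := exists_hasConv_of_lintegral_le (p := q) (p₂ := q) hι hq1 hqt le_rfl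
    hk hk0 hb hint
  obtain ⟨C₂, h₂⟩ := exists_hasConv_of_lintegral_le (p := q') (p₂ := q') hι (h12.trans_le hq') hq't
    le_rfl hk hk0 hb hint
  obtain ⟨C₃, h₃⟩ := exists_hasConv_of_lintegral_le (p := 2) (p₂ := 2) hι h12 h2t le_rfl
    hk hk0 hb hint
  obtain ⟨C₄, h₄⟩ := exists_hasConv_of_lintegral_le (p := q) (p₂ := 2) hι hq1 h2t hq2
    hk hk0 hb hint
  obtain ⟨C₅, h₅⟩ := exists_hasConv_of_lintegral_le (p := 2) (p₂ := q') hι h12 hq't hq'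
    hk hk0 hb hint
  have small : ∀ {p : ℝ≥0∞} [Fact (1 ≤ p)], 1 < p → p ≠ ∞ → ∀ (a : ℝ≥0) (k' : ℝ → D →ₗ[ℂ] U),
      (∀ x, AEStronglyMeasurable (fun τ => k' τ x) volume) →
      (∀ x τ, ‖k' τ x‖ₑ ≤ a * ‖expKernel θ₀ ks τ x‖ₑ) → HasConv ι k' p p (a * c) := by
    intro p _ hp1 hp a k' hk' hka
    have := hasConv_of_norm_le (c := a * c) hι hp1 hp hk' (hφ.const_mul (a : ℝ≥0∞))
      (fun x τ => (hka x τ).trans (by rw [mul_assoc]; gcongr; exact hle x τ))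
      (by rw [lintegral_const_mul _ hφ, ENNReal.coe_mul]; gcongr)
    exact_mod_cast this
  have hs1 : ∀ {p : ℝ≥0∞} [Fact (1 ≤ p)], 1 < p → p ≠ ∞ → ∀ θ, |θ| ≤ θ₀ →
      HasConv ι (expKernel θ ks) p p c := fun hp1 hp θ hθ => by
    simpa using small hp1 hp 1 _ (fun x => aestronglyMeasurable_expKernel θ (hs x))
      (enorm_expKernel_le hs0 hθ)
  set C : ℝ := C₁ + C₂ + C₃ + C₄ + C₅ with hC
  have n₁ : (0 : ℝ) ≤ C₁ := C₁.2
  have n₂ : (0 : ℝ) ≤ C₂ := C₂.2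
  have n₃ : (0 : ℝ) ≤ C₃ := C₃.2
  have n₄ : (0 : ℝ) ≤ C₄ := C₄.2
  have n₅ : (0 : ℝ) ≤ C₅ := C₅.2
  refine ⟨C, hι, hθ₀, hs1 hq1 hqt, hs1 (h12.trans_le hq') hq't, hs1 h12 h2t, ?_, ?_, ?_, ?_, ?_, ?_⟩
  · intro θ hθ
    exact (h₁ 1 _ (fun x => aestronglyMeasurable_expKernel θ (hk x))
      (enorm_expKernel_le hk0 hθ)).mono (by push_cast; linarith)
  · intro θ hθ
    exact (h₂ 1 _ (fun x => aestronglyMeasurable_expKernel θ (hk x))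
      (enorm_expKernel_le hk0 hθ)).mono (by push_cast; linarith)
  · intro θ hθ
    exact (h₃ 1 _ (fun x => aestronglyMeasurable_expKernel θ (hk x))
      (enorm_expKernel_le hk0 hθ)).mono (by push_cast; linarith)
  · intro θ hθ
    exact (h₄ 1 _ (fun x => aestronglyMeasurable_expKernel θ (hk x))
      (enorm_expKernel_le hk0 hθ)).mono (by push_cast; linarith)
  · intro θ hθ
    exact (h₅ 1 _ (fun x => aestronglyMeasurable_expKernel θ (hk x))
      (enorm_expKernel_le hk0 hθ)).mono (by push_cast; linarith)
  · intro e he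
    have nc : (0 : ℝ) ≤ c := c.2
    have hK : 0 < c + C₃ + 1 := by positivity
    refine ⟨min (θ₀ / 2) (e * θ₀ / (2 * (c + C₃ + 1))), by positivity, fun θ hθ => ?_⟩
    have hθ1 := hθ.trans (min_le_left _ _)
    have hθ2 := hθ.trans (min_le_right _ _)
    have e1 : expKernel θ (ks + kb) - (ks + kb)
        = (expKernel θ ks - ks) + (expKernel θ kb - kb) := by rw [expKernel_add]; abel
    rw [e1]
    refine ((small h12 h2t _ _ (fun x => ?_) (enorm_expKernel_sub_le hs0 hθ₀ hθ1)).add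
      (h₃ _ _ (fun x => ?_) (enorm_expKernel_sub_le hk0 hθ₀ hθ1))).mono ?_
    · exact (aestronglyMeasurable_expKernel θ (hs x)).sub (hs x)
    · exact (aestronglyMeasurable_expKernel θ (hk x)).sub (hk x)
    · rw [Real.coe_toNNReal _ (by positivity)]
      rw [le_div_iff₀ (by positivity)] at hθ2
      rw [← mul_add, div_mul_eq_mul_div, div_le_iff₀ hθ₀]
      nlinarith [abs_nonneg θ]

end Bounds

/-! ### The splitting for the control system -/

section ControlSystem

variable {Y U Z : Type*}
  [NormedAddCommGroup Y] [InnerProductSpace ℂ Y] [CompleteSpace Y]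
  [TopologicalSpace.SeparableSpace Y]
  [NormedAddCommGroup U] [InnerProductSpace ℂ U] [CompleteSpace U]
  [TopologicalSpace.SeparableSpace U]
  [NormedAddCommGroup Z] [InnerProductSpace ℂ Z] [CompleteSpace Z]
  {S : C0Semigroup Y} {B : U →L[ℂ] Extrapolation S} {R : Y →L[ℂ] Z}
  {F : ℝ → Y →L[ℂ] U} {G : ℝ → DomAdj S →L[ℂ] U} {ω η γ ε q : ℝ}

/-- The integral of a power singularity near `0` is small. -/
lemma exists_lintegral_rpow_le {γ K : ℝ} (hγ : γ < 1) (hK : 0 ≤ K) {c κ₀ : ℝ} (hc : 0 < c)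
    (hκ₀ : 0 < κ₀) : ∃ κ, 0 < κ ∧ κ ≤ κ₀ ∧
      ∫⁻ t in Ioo 0 κ, ENNReal.ofReal (K * t ^ (-γ)) ≤ ENNReal.ofReal c := by
  have hpos : 0 < -γ + 1 := by linarith
  have hlim : Tendsto (fun κ : ℝ => K * (κ ^ (-γ + 1) / (-γ + 1))) (𝓝[>] 0) (𝓝 0) := by
    have h1 : ContinuousAt (fun κ : ℝ => K * (κ ^ (-γ + 1) / (-γ + 1))) 0 :=
      continuousAt_const.mul
        ((Real.continuousAt_rpow_const 0 (-γ + 1) (Or.inr hpos.le)).div_const _)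
    have h2 : Tendsto _ (𝓝 (0 : ℝ)) _ := h1
    simp only [Real.zero_rpow hpos.ne', zero_div, mul_zero] at h2
    exact h2.mono_left nhdsWithin_le_nhds
  obtain ⟨κ, h1, h2, h3⟩ := ((hlim.eventually_lt_const hc).and
    (Ioo_mem_nhdsGT hκ₀)).exists
  refine ⟨κ, h2, h3.le, ?_⟩
  have hi : IntegrableOn (fun t : ℝ => K * t ^ (-γ)) (Ioo 0 κ) :=
    ((intervalIntegral.integrableOn_Ioo_rpow_iff h2).2 (by linarith)).const_mul K
  rw [← ofReal_integral_eq_lintegral_ofReal hi ?_]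
  · refine ENNReal.ofReal_le_ofReal ?_
    rw [← integral_Ioc_eq_integral_Ioo, ← intervalIntegral.integral_of_le h2.le,
      intervalIntegral.integral_const_mul, integral_rpow (Or.inl (by linarith)),
      Real.zero_rpow hpos.ne', sub_zero]
    exact h1.le
  · filter_upwards [ae_restrict_mem measurableSet_Ioo] with t ht
    have : 0 < t := ht.1
    positivity

namespace Assumptions

variable (hyp : Assumptions S B R F G ω η γ ε q)
include hyp

/-- The time `T` of the assumption on `G` serves for all exponents at once. -/
lemma exists_lintegral_G_le : ∃ T : ℝ, 0 < T ∧
    (∀ x : DomAdj S, AEStronglyMeasurable (fun t => G t x) (volume.restrict (Ioo 0 T))) ∧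
    ∀ p : ℝ, 1 ≤ p → ∃ C : ℝ≥0∞, C ≠ ∞ ∧ ∀ x : DomAdj S,
      ∫⁻ t in Ioo 0 T, ‖G t x‖ₑ ^ p ≤ C * ‖x.1.1‖ₑ ^ p := by
  obtain ⟨T, hT, h⟩ := hyp.G_Lp
  refine ⟨T, hT, fun x => ?_, fun p hp => ?_⟩
  · obtain ⟨C, hC⟩ := h 1 le_rfl
    exact (hC x).1.1
  · have hp0 : 0 < p := by linarith
    obtain ⟨C, hC⟩ := h p hp
    refine ⟨(C : ℝ≥0∞) ^ p, ENNReal.rpow_ne_top_of_nonneg hp0.le ENNReal.coe_ne_top, fun x => ?_⟩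
    have h1 := (hC x).2
    rw [eLpNorm_eq_lintegral_rpow_enorm_toReal (by simpa using hp0) ENNReal.ofReal_ne_top,
      ENNReal.toReal_ofReal hp0.le] at h1
    rw [← ENNReal.mul_rpow_of_nonneg _ _ hp0.le]
    have h2 := ENNReal.rpow_le_rpow h1 hp0.le
    rwa [← ENNReal.rpow_mul, one_div_mul_cancel hp0.ne', ENNReal.rpow_one] at h2

/-- The kernel `B* e^{A*τ}` splits at a small `κ`. -/
lemma exists_splitting {θ₀ : ℝ} (hθ₀ : 0 < θ₀) (hθω : θ₀ < ω) {q₁ q₂ : ℝ≥0∞} [Fact (1 ≤ q₁)]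
    [Fact (1 ≤ q₂)] (hq₁ : 1 < q₁) (hq₁' : q₁ ≤ 2) (hq₂ : 2 ≤ q₂) (hq₂' : q₂ ≠ ∞) {c : ℝ≥0}
    (hc : 0 < c) : ∃ κ C : ℝ,
      Splitting (domIncl S) (smallKernel S F κ) (regKernel S B F κ) q₁ q₂ θ₀ c C := by
  obtain ⟨M, hM1, hM⟩ := hyp.stable
  obtain ⟨N, hN, hF⟩ := hyp.F_bound
  obtain ⟨T, hT, hGm, hG⟩ := hyp.exists_lintegral_G_le
  have hω := hyp.omega_pos
  have hη := hyp.eta_pos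
  have hγ := hyp.gamma_mem
  have hdec := hyp.decomposition
  have hF' : ∀ t : ℝ, 0 < t → ‖F t‖ ≤ N * t ^ (-γ) := fun t ht => by
    refine (hF t ht).trans (mul_le_of_le_one_right (by positivity) ?_)
    rw [Real.exp_le_one_iff]; nlinarith
  obtain ⟨κ, hκ, hκT, hκc⟩ := exists_lintegral_rpow_le (K := N * Real.exp (θ₀ * (T / 2))) hγ.2
    (by positivity) (c := c) (κ₀ := T / 2) (by exact_mod_cast hc) (by positivity)
  have hs : ∀ x, AEStronglyMeasurable (fun τ => smallKernel S F κ τ x) volume := fun x =>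
    aestronglyMeasurable_smallKernel hdec
      ((hGm x).mono_measure (Measure.restrict_mono (Ioo_subset_Ioo_right (by linarith)) le_rfl))
  have hr : ∀ x, AEStronglyMeasurable (fun τ => regKernel S B F κ τ x) volume := fun x =>
    (aestronglyMeasurable_sysKernel x).sub (hs x)
  set φ : ℝ → ℝ≥0∞ := (Ioo 0 κ).indicator fun t =>
    ENNReal.ofReal (N * Real.exp (θ₀ * (T / 2)) * t ^ (-γ)) with hφ
  have hφm : Measurable φ := by
    refine Measurable.indicator (Measurable.ennreal_ofReal ?_) measurableSet_Ioo
    exact (measurable_id.pow_const _).const_mul _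
  -- the total weight `θ₀ + b` stays below `ω`
  set b := (ω - θ₀) / 2 with hb
  have hdense : DenseRange (domIncl S) := denseRange_domIncl S (M := M) fun t ht =>
    (hM t ht).trans (mul_le_of_le_one_right (by linarith) (by rw [Real.exp_le_one_iff]; nlinarith))
  refine ⟨κ, LQ.exists_splitting hdense hq₁ hq₁' hq₂ hq₂' hθ₀ (b := b) (by linarith) hs
    smallKernel_of_nonpos hφm (fun x τ => ?_) ?_ hr regKernel_of_nonpos fun p hp => ?_⟩
  · rw [enorm_expKernel]
    by_cases h : τ ∈ Ioo 0 κ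
    · rw [smallKernel_of_mem h, hφ, indicator_of_mem h, domIncl_apply]
      calc ENNReal.ofReal (Real.exp (θ₀ * τ)) * ‖F τ x.1.1‖ₑ
          ≤ ENNReal.ofReal (Real.exp (θ₀ * (T / 2)))
            * (ENNReal.ofReal (N * τ ^ (-γ)) * ‖x.1.1‖ₑ) := by
            gcongr
            · exact h.2.le.trans hκT
            · refine ((F τ).le_opENorm _).trans ?_
              gcongr
              rw [← ofReal_norm]
              exact ENNReal.ofReal_le_ofReal (hF' τ h.1)
        _ = _ := by
            rw [← mul_assoc, ← ENNReal.ofReal_mul (Real.exp_nonneg _)]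
            congr 2; ring
    · rw [smallKernel_of_notMem h]; simp
  · rw [hφ, lintegral_indicator measurableSet_Ioo]
    exact hκc.trans_eq (ENNReal.ofReal_coe_nnreal)
  · obtain ⟨C₁, hC₁, h₁⟩ := hG p hp
    obtain ⟨C₂, hC₂, h₂⟩ := exists_lintegral_sysKernel_le (a := κ / 2) (T := 3 * κ / 2)
      (N := N * (κ / 2) ^ (-γ)) hdec hp
      (fun t ht => (hF' t ((half_pos hκ).trans_le ht.1)).trans (by
        have := Real.rpow_le_rpow_of_nonpos (half_pos hκ) ht.1 (by linarith [hγ.1] : -γ ≤ 0)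
        gcongr)) (half_pos hκ) hC₁
      (fun x => (lintegral_mono_set (Ioo_subset_Ioo_right (by linarith))).trans (h₁ x))
    obtain ⟨C₃, hC₃, h₃⟩ := exists_lintegral_tail_le (b := θ₀ + b) (M := M) hκ hp (by linarith)
      (by linarith) (by linarith) hM hC₂ h₂
    exact exists_lintegral_regKernel_le hdec (b := θ₀ + b) (by linarith : κ ≤ T) hp (by linarith)
      hC₁ hC₃ h₁ h₃

end Assumptions

end ControlSystem

end LQ

end

theorem theorem3p6 {Y U Z : Type*}
    [NormedAddCommGroup Y] [InnerProductSpace ℂ Y] [CompleteSpace Y]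
    [TopologicalSpace.SeparableSpace Y]
    [NormedAddCommGroup U] [InnerProductSpace ℂ U] [CompleteSpace U]
    [TopologicalSpace.SeparableSpace U]
    [NormedAddCommGroup Z] [InnerProductSpace ℂ Z] [CompleteSpace Z]
    [TopologicalSpace.SeparableSpace Z]
    (S : LQ.C0Semigroup Y) (B : U →L[ℂ] LQ.Extrapolation S) (R : Y →L[ℂ] Z)
    (F : ℝ → Y →L[ℂ] U) (G : ℝ → LQ.DomAdj S →L[ℂ] U) (ω η γ ε q : ℝ)
    (hyp : LQ.Assumptions S B R F G ω η γ ε q) :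
    -- `Λ` is an isomorphism of `L^2(0,∞;U)`
    (LQ.IsBoundedOperator (fun g h => LQ.IsLambda S B R g h) 2 0 0 ∧
      LQ.IsBoundedOperator (fun h g => LQ.IsLambda S B R g h) 2 0 0) ∧
    -- `Λ` is a bounded operator in `L^q_θ(0,∞;U)`
    (∀ θ : ℝ, 0 ≤ θ → θ < min ω η →
      LQ.IsBoundedOperator (fun g h => LQ.IsLambda S B R g h) (ENNReal.ofReal q) θ θ) ∧
    -- `Λ` has a bounded inverse from `L^q_δ(0,∞;U)` to `L^q_{δ-σ₀}(0,∞;U)`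
    (∀ δ : ℝ, 0 < δ → δ < min ω η → ∃ σ₀ : ℝ, 0 < σ₀ ∧ σ₀ < δ ∧
      LQ.IsBoundedOperator (fun h g => LQ.IsLambda S B R g h) (ENNReal.ofReal q) δ (δ - σ₀)) := by
  obtain ⟨hq1, hq2⟩ := hyp.q_mem
  have hω := hyp.omega_pos
  have hq0 : 0 < q := by linarith
  have hconj : q.HolderConjugate (q / (q - 1)) := Real.HolderConjugate.conjExponent hq1
  set q₂ : ENNReal := ENNReal.ofReal (q / (q - 1)) with hq₂
  have hE1 : 1 < ENNReal.ofReal q := ENNReal.one_lt_ofReal.2 hq1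
  have hE2 : ENNReal.ofReal q ≤ 2 := by
    rw [← ENNReal.ofReal_ofNat]; exact ENNReal.ofReal_le_ofReal hq2.le
  have h2q : 2 ≤ q₂ := by
    rw [← ENNReal.ofReal_ofNat]
    refine ENNReal.ofReal_le_ofReal ?_
    rw [le_div_iff₀ (by linarith)]; linarith
  have : Fact (1 ≤ ENNReal.ofReal q) := ⟨hE1.le⟩
  have : Fact (1 ≤ q₂) := ⟨le_trans (by norm_num) h2q⟩
  have : ENNReal.HolderConjugate (ENNReal.ofReal q) q₂ := hconj.ennrealOfReal
  -- the exponent `r` with `1/r + 1/2 = 1/q`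
  have hr0 : 0 < q⁻¹ - 2⁻¹ := sub_pos.2 (inv_strictAnti₀ hq0 hq2)
  have htri : Real.HolderTriple (q⁻¹ - 2⁻¹)⁻¹ 2 q :=
    ⟨by rw [inv_inv, sub_add_cancel], inv_pos.2 hr0, by norm_num⟩
  set r : ENNReal := ENNReal.ofReal (q⁻¹ - 2⁻¹)⁻¹ with hr
  have : ENNReal.HolderTriple r 2 (ENNReal.ofReal q) := by
    have := htri.ennrealOfReal
    rwa [ENNReal.ofReal_ofNat] at this
  have : Fact (1 ≤ r) := by
    refine ⟨ENNReal.one_le_ofReal.2 ((one_le_inv₀ hr0).2 ?_)⟩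
    have := inv_le_one_of_one_le₀ hq1.le
    linarith
  -- a bound `c` for the small part with `‖R* R‖ c² < 1`
  obtain ⟨c, hc0, hc⟩ : ∃ c : NNReal, 0 < c ∧
      (c : ℝ) * (‖R.adjoint ∘L R‖ * c) < 1 := by
    refine ⟨(1 + ‖R.adjoint ∘L R‖₊)⁻¹, by positivity, ?_⟩
    have h0 := norm_nonneg (R.adjoint ∘L R)
    push_cast
    set Q := ‖R.adjoint ∘L R‖
    rw [show (1 + Q)⁻¹ * (Q * (1 + Q)⁻¹) = Q / (1 + Q) ^ 2 by field_simp,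
      div_lt_one (by positivity)]
    nlinarith
  have hcongr : ∀ f f₁ g g₁ : ℝ → U, f =ᵐ[LQ.halfLine] f₁ → g =ᵐ[LQ.halfLine] g₁ →
      LQ.IsLambda S B R f g → LQ.IsLambda S B R f₁ g₁ := fun f f₁ g g₁ hf hg => by
    rw [LQ.isLambda_iff, LQ.isLambda_iff]; exact fun H => H.congr hf hg
  refine ⟨?_, fun θ hθ0 hθ => ?_, fun δ hδ0 hδ => ?_⟩
  · obtain ⟨κ, C, h⟩ := hyp.exists_splitting (θ₀ := ω / 2) (by positivity) (by linarith) hE1 hE2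
      h2q ENNReal.ofReal_ne_top hc0
    have hiff := LQ.isLam_expMul_iff (Q := R.adjoint ∘L R) h.dense h.conv_two_zero
      (h.conv_two h.abs_zero_le) (h.adj_two h.abs_zero_le)
    simp only [LQ.smallKernel_add_regKernel, ← LQ.isLambda_iff] at hiff
    refine ⟨LQ.isBoundedOperator_of_clm hcongr _ hiff, ?_⟩
    obtain ⟨u, hu⟩ := h.isUnit_zero (R := R)
    rw [LQ.smallKernel_add_regKernel] at hu
    refine LQ.isBoundedOperator_of_clm (fun f f₁ g g₁ hf hg => hcongr _ _ _ _ hg hf) ↑u⁻¹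
      fun f g => ?_
    rw [← hiff, ← hu]
    constructor
    · rintro rfl
      exact DFunLike.congr_fun u.mul_inv f
    · rintro rfl
      exact DFunLike.congr_fun u.inv_mul g
  · have hθω := hθ.trans_le (min_le_left _ _)
    obtain ⟨κ, C, h⟩ := hyp.exists_splitting (θ₀ := (θ + ω) / 2) (by linarith) (by linarith) hE1 hE2
      h2q ENNReal.ofReal_ne_top hc0
    have hθ' : |θ| ≤ (θ + ω) / 2 := by rw [abs_of_nonneg hθ0]; linarith
    have hiff := LQ.isLam_expMul_iff (Q := R.adjoint ∘L R) h.dense h.conv_two_zero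
      (h.conv_q hθ') (h.adj_q hE1 ENNReal.ofReal_ne_top hθ')
    simp only [LQ.smallKernel_add_regKernel, ← LQ.isLambda_iff] at hiff
    exact LQ.isBoundedOperator_of_clm hcongr _ hiff
  · obtain ⟨κ, C, h⟩ := hyp.exists_splitting hδ0 (hδ.trans_le (min_le_left _ _)) hE1 hE2
      h2q ENNReal.ofReal_ne_top hc0
    obtain ⟨δ', h0, h1, T, hT⟩ := h.exists_inverse (R := R) r hE1 ENNReal.ofReal_ne_top hc hδ0 le_rfl
    simp only [LQ.smallKernel_add_regKernel, ← LQ.isLambda_iff] at hT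
    refine ⟨δ - δ', by linarith, by linarith, ?_⟩
    rw [sub_sub_cancel]
    exact LQ.isBoundedOperator_of_clm (fun f f₁ g g₁ hf hg => hcongr _ _ _ _ hg hf) T hT
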